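/- Let $n\ge 0$ and $[n]=\{1,\dots,n\}$. **Well-labelled positive paths.** A well-labelled positive path of size $n$ is a pair $(p,\pi)$, where $p$ is a lattice path with $n-1$ steps from $\{\nearrow,\rightarrow,\searrow\}=\{(1,1),(1,0),(1,-1)\}$ (no steps if $n=0$) that starts at $(0,0)$ and never goes below the $x$-axis, and $\pi=\pi_1\cdots\pi_n$ is a permutation of $[n]$ with $\pi_i<\pi_{i+1}$ (resp. $\pi_i>\pi_{i+1}$) whenever the $i$th step of $p$ is $\nearrow$ (resp. $\searrow$). Cutting the word $\pi$ between $\pi_i$ and $\pi_{i+1}$ for every $i$ for which the $i$th step is not $\rightarrow$ gives a sequence of nonempty words, the clusters of $(p,\pi)$. Let $\mathcal P_n$ be the set of these pairs. A permutation $\pi$ of $[n]$ is a ballot permutation if every prefix of $\pi$ has at most as many descents as ascents; let $\mathcal B_n$ be the set of ballot permutations. It is regarded as the subset of $\mathcal P_n$ of pairs without $\rightarrow$ steps. **Odd order cluster-permutations.** An odd order cluster-permutation of size $n$ is a set of cycles of odd length (taken up to cyclic shift), the entries of which are nonempty words over $[n]$, called its clusters, such that each element of $[n]$ occurs exactly once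 in exactly one of the clusters. Let $\mathcal{OC}_n$ be the set of them. A permutation of $[n]$ all of whose cycles have odd length is regarded as the element of $\mathcal{OC}_n$ given by its cycles (fixed points included), each letter being a cluster of size one. For a word $c=a_1\cdots a_k$ let $c^r=a_k\cdots a_1$. **The map $\psi$.** A box-permutation on a finite set $A$ of positive integers is a word in which each element of $A$ occurs once and in which boxes $\Box$ may occur, such that it is the increasing word on $A$ if there is no box, and otherwise the integers before the first box and those after the last one form increasing words of length $\ge1$ and the integers between two successive boxes form an increasing word of length $\ge2$. Let $\sigma=\sigma_1\cdots\sigma_N$ be a box-permutation on $A$ and, if $A\ne\emptyset$, $m=\min A$. The set of cycles $\psi(\sigma)$ is defined recursively, with $\psi(\emptyset)=\emptyset$: 1. If $\sigma_1=m$ and $\sigma_2\ne\Box$ (or $N=1$), then $\psi(\sigma)=\{(m)\}\cup\psi(\sigma_2\cdots\sigma_N)$. 2. If $\sigma_{2\ell+1}=m$ with $\ell\ge1$, then $\psi(\sigma)=\{(m\,\sigma_1\cdots\sigma_{2\ell})\}\cup\psi(\sigma_{2\ell+2}\cdots\sigma_N)$. 3. Otherwise let $\sigma'=\phi(\sigma)$,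 in which $m=\sigma'_{2\ell+1}$ for some $\ell\ge1$; then $\psi(\sigma)=\{(m\,\sigma'_{2\ell}\sigma'_{2\ell-1}\cdots\sigma'_1)\}\cup\psi(\sigma'_{2\ell+2}\cdots\sigma'_N)$. Here $\phi$ is as follows. If $\sigma_1=m$ and $\sigma_2=\Box$, interchange $\sigma_1$ and $\sigma_3$. Otherwise $\sigma_j=m$ for an even $j$. Let $\sigma_i=a$ be the left neighbour of the first box, and let $\sigma_k=x$ be the left neighbour of the first box to the right of $m$ (if there is none, $k=N+1$ and $x=\infty$). Let $T=\{\sigma_s: 1\le s<i\text{ or }j<s<k\}$. * If $T\ne\emptyset$ and $t=\min T<\min\{a,x\}$, then $t=\sigma_1$ or $t=\sigma_{j+1}$; if $t=\sigma_1$, delete $t$ and insert it right after $m$; if $t=\sigma_{j+1}$, delete $t$ and insert it at the front. * Otherwise, if $x<a$ (then $k=j+1$), delete the subword $x\,\Box\,\sigma_{k+2}$ and insert $\sigma_{k+2}\,\Box\,x$ at the front. * Otherwise ($a<x$ and $i=1$), delete the subword $a\,\Box\,\sigma_3$ from the front and insert $\sigma_3\,\Box\,a$ right after $m$. **The map $\Psi$.**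 Let $\pi\in\mathcal B_n$. A Dyck factor of $\pi$ is a consecutive subword of length $\ge3$ that has as many ascents as descents and each prefix of which has at most as many descents as ascents. Replace the interior (all but the first and last letters) of each inclusion-maximal Dyck factor of $\pi$ by one box, to get a box-permutation $\sigma$ on a subset of $[n]$. In the cycles of $\psi(\sigma)$, for every maximal Dyck factor $d_1\cdots d_k$, replace the box between $d_1$ and $d_k$ by $d_2\cdots d_{k-1}$ if the cycle has the form $(\dots,d_1,\Box,d_k,\dots)$, and by $d_{k-1}\cdots d_2$ if it has the form $(\dots,d_k,\Box,d_1,\dots)$. The resulting cycles are the cycles of the permutation $\Psi(\pi)$. **Theorem.** There is a bijection $\Phi:\mathcal P_n\to\mathcal{OC}_n$ such that * for every $x\in\mathcal P_n$, the clusters of $x$ and of $\Phi(x)$ coincide up to reversal: for every word $c$, one of $c$, $c^r$ is a cluster of $x$ if and only if one of $c$, $c^r$ is a cluster of $\Phi(x)$; * $\Phi(\pi)=\Psi(\pi)$ for every $\pi\in\mathcal B_n$ (in particular, all cycles of $\Psi(\pi)$ have odd length). -/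

import Mathlib

/-! Letters are the elements of `Fin n` (the alphabet `1 < 2 < ... < n`, shifted by one);
words are lists, and the one-line notation of a permutation `π` is the word `List.ofFn π`. -/

namespace BallotCluster

section Words

variable {α : Type*} [LinearOrder α]

/-- The number of ascents of a word. -/
def asc : List α → ℕ
  | a :: b :: w => (if a < b then 1 else 0) + asc (b :: w)
  | _ => 0

/-- The number of descents of a word. -/
def des : List α → ℕ
  | a :: b :: w => (if b < a then 1 else 0) + des (b :: w)
  | _ => 0

/-- Every prefix has at most as many descents as ascents. -/
def IsBallotWord (w : List α) : Prop := ∀ u ∈ w.inits, des u ≤ asc u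

instance (w : List α) : Decidable (IsBallotWord w) :=
  inferInstanceAs (Decidable (∀ u ∈ w.inits, des u ≤ asc u))

/-- A ballot word whose last letter has height `0`. -/
def IsDyckWord (w : List α) : Prop := IsBallotWord w ∧ asc w = des w

instance (w : List α) : Decidable (IsDyckWord w) :=
  inferInstanceAs (Decidable (_ ∧ _))

end Words

section Paths

/-- The steps `(1,1)`, `(1,0)`, `(1,-1)`. -/
inductive Step
  | up
  | flat
  | down
  deriving DecidableEq

/-- The vertical displacement of a step. -/
def Step.dy : Step → ℤ
  | .up => 1
  | .flat => 0
  | .down => -1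

/-- The height of the endpoint of a path that starts on the `x`-axis. -/
def height (p : List Step) : ℤ := (p.map Step.dy).sum

/-- A well-labelled positive path of size `n`: a path with `n - 1` steps from the origin, all of
whose points have nonnegative height, with a permutation of the letters that ascends along the
up steps and descends along the down steps. -/
@[ext]
structure WellLabelledPath (n : ℕ) where
  path : List Step
  length_path : path.length = n - 1
  nonneg : ∀ k : ℕ, 0 ≤ height (path.take k)
  label : Equiv.Perm (Fin n)
  label_up : ∀ (i : ℕ) (h : i + 1 < n), path[i]? = some Step.up →
    label ⟨i, Nat.lt_of_succ_lt h⟩ < label ⟨i + 1, h⟩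
  label_down : ∀ (i : ℕ) (h : i + 1 < n), path[i]? = some Step.down →
    label ⟨i + 1, h⟩ < label ⟨i, Nat.lt_of_succ_lt h⟩

/-- Cut the word `w` at every step of the path that is not horizontal; the `i`-th step of the path
joins the `i`-th and the `(i+1)`-st letter. -/
def cutWord {α : Type*} : List α → List Step → List (List α)
  | [], _ => []
  | a :: w, [] => [a] :: cutWord w []
  | a :: w, Step.flat :: p =>
    match cutWord w p with
    | [] => [[a]]
    | c :: cs => (a :: c) :: cs
  | a :: w, _ :: p => [a] :: cutWord w p

/-- The clusters of a well-labelled positive path (of the ballot cluster-permutation which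
represents it), from left to right. -/
def WellLabelledPath.clusters {n : ℕ} (x : WellLabelledPath n) : List (List (Fin n)) :=
  cutWord (List.ofFn x.label) x.path

/-- `c` is a cluster in `x`. -/
def WellLabelledPath.HasCluster {n : ℕ} (x : WellLabelledPath n) (c : List (Fin n)) : Prop :=
  c ∈ x.clusters

/-- The path of a word without horizontal steps. -/
def wordPath {α : Type*} [LinearOrder α] : List α → List Step
  | a :: b :: w => (if a < b then Step.up else Step.down) :: wordPath (b :: w)
  | _ => []

/-- A ballot permutation of size `n`. -/
def BallotPerm (n : ℕ) : Type := {π : Equiv.Perm (Fin n) // IsBallotWord (List.ofFn π)}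

theorem length_wordPath {α : Type*} [LinearOrder α] (w : List α) :
    (wordPath w).length = w.length - 1 := by
  induction w with
  | nil => rfl
  | cons a w ih =>
    cases w with
    | nil => rfl
    | cons b w => simp [wordPath, ih]

theorem height_wordPath {α : Type*} [LinearOrder α] (w : List α) (hw : w.Nodup) (k : ℕ) :
    height ((wordPath w).take k) = asc (w.take (k + 1)) - des (w.take (k + 1)) := by
  induction w generalizing k with
  | nil => simp [wordPath, height, asc, des]
  | cons a w ih =>
    cases w with
    | nil => simp [wordPath, height, asc, des]
    | cons b w =>
      cases k with
      | zero => simp [height, asc, des]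
      | succ k =>
        have h := ih hw.of_cons k
        have hab : a ≠ b := by
          intro h
          simp [h] at hw
        rcases lt_or_gt_of_ne hab with hlt | hlt
        · simp [wordPath, height, asc, des, hlt, hlt.not_gt, Step.dy] at h ⊢
          linarith
        · simp [wordPath, height, asc, des, hlt, hlt.not_gt, Step.dy] at h ⊢
          linarith

theorem getElem_wordPath {α : Type*} [LinearOrder α] (w : List α) (i : ℕ)
    (h : i + 1 < w.length) :
    (wordPath w)[i]? = some (if w[i] < w[i + 1] then Step.up else Step.down) := by
  induction w generalizing i with
  | nil => simp at h
  | cons a w ih =>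
    cases w with
    | nil => simp at h
    | cons b w =>
      cases i with
      | zero => simp [wordPath]
      | succ i =>
        have h' := ih i (by simpa using h)
        rw [wordPath, List.getElem?_cons_succ, h']
        rfl

/-- A ballot permutation, as a well-labelled positive path without horizontal steps. -/
def BallotPerm.toPath {n : ℕ} (π : BallotPerm n) : WellLabelledPath n where
  path := wordPath (List.ofFn π.1)
  length_path := by simp [length_wordPath]
  nonneg k := by
    rw [height_wordPath _ (List.nodup_ofFn.2 π.1.injective)]
    have h := π.2 ((List.ofFn π.1).take (k + 1)) ((List.mem_inits _ _).2 (List.take_prefix _ _))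
    omega
  label := π.1
  label_up i h hi := by
    rw [getElem_wordPath _ _ (by simpa using h)] at hi
    by_contra hc
    simp [hc] at hi
  label_down i h hi := by
    rw [getElem_wordPath _ _ (by simpa using h)] at hi
    have hne : π.1 ⟨i, Nat.lt_of_succ_lt h⟩ ≠ π.1 ⟨i + 1, h⟩ := fun e => by
      simpa using π.1.injective e
    rcases lt_or_gt_of_ne hne with hlt | hlt
    · simp [hlt] at hi
    · exact hlt

end Paths

section OddClusterPermutations

/-- An odd order cluster-permutation of size `n`: a set of cycles of odd length, whose entries are
nonempty words (the clusters), in which each letter occurs exactly once altogether. -/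
@[ext]
structure OddClusterPerm (n : ℕ) where
  cycles : Finset (Cycle (List (Fin n)))
  odd_length : ∀ C ∈ cycles, Odd C.length
  ne_nil : ∀ C ∈ cycles, ∀ c ∈ C, c ≠ []
  letters : (cycles.val.bind fun C => C.toMultiset.bind fun c => (c : Multiset (Fin n)))
    = (Finset.univ : Finset (Fin n)).val

/-- `c` is a cluster in `s`. -/
def OddClusterPerm.HasCluster {n : ℕ} (s : OddClusterPerm n) (c : List (Fin n)) : Prop :=
  ∃ C ∈ s.cycles, c ∈ C

end OddClusterPermutations

section BoxPermutations

/-! Words with boxes are lists over `Option α`; the box is `none`. -/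

variable {α : Type*} [LinearOrder α]

/-- The map `φ` on a box-permutation `σ` with smallest letter `m`, for `σ` which either starts with
`m` followed by a box or has `m` in an even position. -/
def boxPhi (m : α) (σ : List (Option α)) : List (Option α) :=
  -- `σ = pre m post`
  let pre := σ.takeWhile (fun c => c ≠ some m)
  let post := σ.drop (pre.length + 1)
  match pre, post with
  -- first kind: `m □ y ⋯ ↦ y □ m ⋯`
  | [], none :: y :: rest => y :: none :: some m :: rest
  | _, _ =>
    -- otherwise, `left` ends in `a`, the left neighbour of the first box; `right` is the increasing
    -- run after `m`, which ends in `x` if a box follows it; otherwise `x = ∞`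
    let left := (pre.takeWhile Option.isSome).reduceOption
    let right := (post.takeWhile Option.isSome).reduceOption
    let boxAfter : Bool := none ∈ post
    let a : WithTop α := left.getLast?.elim ⊤ (fun y => (y : WithTop α))
    let x : WithTop α :=
      if boxAfter then right.getLast?.elim ⊤ (fun y => (y : WithTop α)) else ⊤
    let T := left.dropLast ++ (if boxAfter then right.dropLast else right)
    -- the minimum of the empty list is `⊤`
    let t : WithTop α := T.minimum
    if t < min a x then
      -- move the letter `t` between the front of the word and the place right after `m`
      match left.head?, post with
      | some y, _ =>
        if (y : WithTop α) = t then pre.tail ++ some m :: some y :: post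
        else post.take 1 ++ pre ++ some m :: post.tail
      | none, _ => σ
    else if x < a then
      -- `pre m x □ y ⋯ ↦ y □ x pre m ⋯`
      match post with
      | z :: none :: y :: rest => y :: none :: z :: pre ++ some m :: rest
      | _ => σ
    else
      -- `a □ y rest m post ↦ rest m y □ a post`
      match pre with
      | z :: none :: y :: rest => rest ++ some m :: y :: none :: z :: post
      | _ => σ

/-- The recursion for `ψ`, with a bound on the number of calls; every call splits off one cycle. -/
def boxPsiAux : ℕ → List (Option α) → List (List (Option α))
  | 0, _ => []
  | k + 1, σ =>
    match σ.reduceOption.min? with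
    | none => []
    | some m =>
      -- `i + 1` is the position of the smallest letter `m`
      let i := σ.idxOf (some m)
      if i = 0 ∧ σ[1]? ≠ some none then
        [some m] :: boxPsiAux k σ.tail
      else if i ≠ 0 ∧ Even i then
        (some m :: σ.take i) :: boxPsiAux k (σ.drop (i + 1))
      else
        let τ := boxPhi m σ
        let j := τ.idxOf (some m)
        (some m :: (τ.take j).reverse) :: boxPsiAux k (τ.drop (j + 1))

/-- The map `ψ` from box-permutations to cyclic box-permutations; a cyclic box-permutation is given
by a list of its cycles, and each cycle by one of its representatives. -/
def boxPsi (σ : List (Option α)) : List (List (Option α)) := boxPsiAux σ.length σ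

end BoxPermutations

section Psi

variable {α : Type*} [LinearOrder α]

/-- The consecutive subword of `w` from index `i` to index `j` (both included). -/
def factor (w : List α) (i j : ℕ) : List α := (w.drop i).take (j + 1 - i)

/-- Indices `i`, `j` delimit a consecutive subword of size at least `3` that is a Dyck word. -/
def IsDyckFactor (w : List α) (i j : ℕ) : Prop :=
  i + 2 ≤ j ∧ j < w.length ∧ IsDyckWord (factor w i j)

instance (w : List α) (i j : ℕ) : Decidable (IsDyckFactor w i j) :=
  inferInstanceAs (Decidable (_ ∧ _ ∧ _))

/-- A Dyck factor that is not properly contained in another one. -/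
def IsMaxDyckFactor (w : List α) (i j : ℕ) : Prop :=
  IsDyckFactor w i j ∧
    ∀ i' ≤ i, ∀ j' < w.length, j ≤ j' ∧ IsDyckFactor w i' j' → i' = i ∧ j' = j

instance (w : List α) (i j : ℕ) : Decidable (IsMaxDyckFactor w i j) :=
  inferInstanceAs (Decidable (_ ∧
    ∀ i' ≤ i, ∀ j' < w.length, j ≤ j' ∧ IsDyckFactor w i' j' → i' = i ∧ j' = j))

/-- The list of all (delimiting pairs of) maximal Dyck factors. -/
def maxDyckFactors (w : List α) : List (ℕ × ℕ) :=
  (List.product (List.range w.length) (List.range w.length)).filter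
    (fun f => IsMaxDyckFactor w f.1 f.2)

/-- The maximal Dyck factors themselves. -/
def maxDyckWords (w : List α) : List (List α) :=
  (maxDyckFactors w).map (fun f => factor w f.1 f.2)

/-- Replace the interior of each maximal Dyck factor by a box. -/
def boxWord (w : List α) : List (Option α) :=
  (List.range w.length).flatMap fun k =>
    if ∃ f ∈ maxDyckFactors w, k = f.1 + 1 then [none]
    else if ∃ f ∈ maxDyckFactors w, f.1 < k ∧ k < f.2 then []
    else w[k]?.toList.map some

/-- The word which replaces a box with left neighbour `l` and right neighbour `r`: the interior of
the word of `D` with first and last letters `l`, `r`, or the reversed interior of the word of `D`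
with first and last letters `r`, `l`. -/
def boxContent (D : List (List α)) (l r : Option α) : List α :=
  match D.find? (fun d => d.head? = l ∧ d.getLast? = r) with
  | some d => d.tail.dropLast
  | none =>
    match D.find? (fun d => d.head? = r ∧ d.getLast? = l) with
    | some d => d.tail.dropLast.reverse
    | none => []

/-- Insert the words of `D` into the boxes of a cycle (given by a representative). -/
def fillCycle (D : List (List α)) (C : List (Option α)) : List α :=
  (List.range C.length).flatMap fun k =>
    match C[k]? with
    | some (some a) => [a]
    | some none =>
      boxContent D C[(k + C.length - 1) % C.length]?.join C[(k + 1) % C.length]?.join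
    | none => []

/-- The cycles of the image under `Ψ` of the permutation with one-line notation `w`. -/
def psiCycles (w : List α) : List (List α) :=
  (boxPsi (boxWord w)).map (fillCycle (maxDyckWords w))

/-- The image `Ψ(π)` of a ballot permutation: the set of its cycles, each letter being regarded as
a cluster of size one. -/
def Psi {n : ℕ} (π : BallotPerm n) : Finset (Cycle (List (Fin n))) :=
  ((psiCycles (List.ofFn π.1)).map
    (fun C => ((C.map (fun a => [a]) : List (List (Fin n))) : Cycle (List (Fin n))))).toFinset

end Psi

end BallotCluster

namespace BallotCluster

/-! The bijection is assembled fibre by fibre over the set `K` of reversal classes of the clusters.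
Two facts suffice: the two fibres over each `K` are finite of equal size (`card_fibers`), and `Ψ`
hits every permutation with odd cycles only (`exists_Psi_eq`). On the fibre of one-letter clusters a
section of `Ψ` is injective, hence bijective by the count, and its inverse agrees with `Ψ` on every
ballot permutation; injectivity of `Ψ` needs no separate argument. On every other fibre any
bijection will do.

Counting. Let `k = |K|` and let `w` be the number of ways to pick one word from each class. A path
over `K` is a sequence of such words with nonnegative heights, where consecutive words differ in
height by `±1` according to the last letter of the one and the first letter of the other. Cut an
arbitrary sequence just before its first lowest point and reverse the left part, words included:
this gives two ballot sequences `(L, R)`. Of `(L, R)` and `(R, L)` exactly one arises in this way,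
so there are `2 · k! · w` pairs of ballot sequences. This convolution identity determines the number
of ballot sequences (`card_balArr`). For sets of odd cycles, splitting off the cycle through a fixed
class gives `w · c_k` (`card_oddSets`), where `c_k` is the number of permutations of `k` points with
odd cycles only. The two counts agree since the exponential generating function `C` of `c_k`
satisfies `(1 - x²) C' = C`, whence `C² = (1 + x)/(1 - x)`.

Surjectivity of `Ψ`. Around an odd cycle of length at least three the sum of the rises is odd, hence
positive in exactly one of the two orientations. By the cycle lemma, the cycle with that orientation
can be cut open to a ballot word, and this splits into an odd number of Dyck words joined cyclically
by ascents (`exists_goodCycle`). Only the first and last letters of these pieces survive in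
box-words. A preimage under `ψ` is built by prepending the cycles one at a time, the cycle with the
smallest visible letter `m` being put in front of a word for the others: rotate it so that the piece
ending in `m` comes last, and write it down as it is if its orientation is positive, or take a
preimage under `φ` otherwise (`exists_boxPsiAux`). On pieces, `φ` moves one piece, reversed, from
one side of the piece with `m` to the other, or reverses that piece itself (`exists_boxPhi_eq`). The
concatenation of the resulting pieces is a ballot word whose maximal Dyck factors are the pieces
with at least three letters, so refilling the boxes returns the given cycles. -/

/-- Objects with a first and a last letter and a reversal. -/
structure PieceSys (X α : Type) where
  first : X → α
  last : X → α
  rev : X → X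
  first_rev : ∀ x, first (rev x) = last x
  last_rev : ∀ x, last (rev x) = first x

/-! ### Box-words of sequences of pieces -/

namespace PieceSys

variable {X α : Type} [LinearOrder α] (P : PieceSys X α)

/-- The box-word of a piece: its first and last letters, with a box between them if they differ. -/
def box (x : X) : List (Option α) :=
  if P.first x = P.last x then [some (P.first x)] else [some (P.first x), none, some (P.last x)]

/-- The box-word of a sequence of pieces. -/
def boxes (ws : List X) : List (Option α) := ws.flatMap P.box

/-- `y` may follow `x` with an ascent between them. -/
def Up (x y : X) : Prop := P.last x < P.first y

/-- The letters of the maximal initial segment of pieces of size one. -/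
def runS : List X → List α
  | [] => []
  | y :: B => if P.first y = P.last y then P.first y :: runS B else []

/-- The first letter of the first piece of larger size. -/
def runX : List X → WithTop α
  | [] => ⊤
  | y :: B => if P.first y = P.last y then runX B else (P.first y : WithTop α)

@[simp] theorem boxes_nil : P.boxes [] = [] := rfl
@[simp] theorem boxes_cons (x : X) (ws : List X) : P.boxes (x :: ws) = P.box x ++ P.boxes ws := rfl
@[simp] theorem boxes_append (us ws : List X) :
    P.boxes (us ++ ws) = P.boxes us ++ P.boxes ws := List.flatMap_append

/-- Single-letter pieces joined by ascents form an increasing run, and the first larger piece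
continues the ascent. This supplies all comparisons between letters that `φ` makes. -/
theorem run_lower (y : X) (B : List X) (h : (y :: B).IsChain P.Up) :
    (∀ s ∈ P.runS B, P.last y < s) ∧ (P.last y : WithTop α) < P.runX B := by
  induction B generalizing y with
  | nil => simp [runS, runX]
  | cons z B ih =>
    rw [List.isChain_cons_cons] at h
    have h1 : P.last y < P.first z := h.1
    obtain ⟨i1, i2⟩ := ih z h.2
    by_cases hz : P.first z = P.last z
    · simp only [runS, runX, hz, if_true, List.mem_cons, forall_eq_or_imp]
      rw [hz] at h1
      exact ⟨⟨h1, fun s hs => h1.trans (i1 s hs)⟩, (WithTop.coe_lt_coe.2 h1).trans i2⟩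
    · simp [runS, runX, hz, h1]

/-- Applied to the pieces after `m`, this identifies `runS` with their share of the set `T` in the
definition of `φ`, and `runX` with `x`; the value `⊤` is the convention `x = ∞` when no box follows.
-/
theorem boxes_eq_run (B : List X) :
    (P.boxes B = (P.runS B).map some ∧ P.runX B = ⊤) ∨
      ∃ (x : α) (p : List (Option α)), P.boxes B = (P.runS B).map some ++ some x :: none :: p ∧
        P.runX B = (x : WithTop α) := by
  induction B with
  | nil => left; simp [runS, runX]
  | cons z B ih =>
    by_cases hz : P.first z = P.last z
    · rcases ih with ⟨h1, h2⟩ | ⟨x, p, h1, h2⟩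
      · left; simp [runS, runX, hz, box, h1, h2]
      · right; exact ⟨x, p, by simp [runS, hz, box, h1], by simp [runX, hz, h2]⟩
    · right
      exact ⟨P.first z, some (P.last z) :: P.boxes B, by simp [runS, hz, box], by simp [runX, hz]⟩

/-- The same on the left of `m`: `m` is the last letter of `w`, so the left part stops at the box of
`w`. This box guarantees that `a` exists, and `runX` is `a`. -/
theorem boxes_eq_run_left (A : List X) (w : X) (hw : P.first w ≠ P.last w) :
    ∃ (a : α) (p : List (Option α)), P.boxes A ++ [some (P.first w), none] =
      (P.runS (A ++ [w])).map some ++ some a :: none :: p ∧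
        P.runX (A ++ [w]) = (a : WithTop α) := by
  induction A with
  | nil => exact ⟨P.first w, [], by simp [runS, hw], by simp [runX, hw]⟩
  | cons z A ih =>
    by_cases hz : P.first z = P.last z
    · obtain ⟨a, p, h1, h2⟩ := ih
      exact ⟨a, p, by simp [runS, hz, box, h1], by simp [runX, hz, h2]⟩
    · exact ⟨P.first z, some (P.last z) :: (P.boxes A ++ [some (P.first w), none]),
        by simp [runS, hz, box], by simp [runX, hz]⟩

end PieceSys

/-! ### The map `φ` on box-words -/

section Phi
variable {α : Type}

theorem takeWhile_isSome_run (S : List α) (a : α) (p : List (Option α)) :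
    ((S.map some ++ some a :: none :: p).takeWhile Option.isSome).reduceOption = S ++ [a] := by
  induction S with
  | nil => simp [List.reduceOption]
  | cons s S ih => simp [List.reduceOption]

theorem takeWhile_isSome_map (S : List α) :
    ((S.map some).takeWhile Option.isSome).reduceOption = S := by
  induction S with
  | nil => simp [List.reduceOption]
  | cons s S ih => simpa [List.reduceOption] using ih

theorem takeWhile_ne_of_notMem {β : Type} [DecidableEq β] (c : β) (pre post : List β)
    (h : c ∉ pre) : (pre ++ c :: post).takeWhile (fun d => d ≠ c) = pre := by
  induction pre with
  | nil => simp
  | cons d pre ih =>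
    simp only [List.mem_cons, not_or] at h
    simpa [Ne.symm h.1] using ih h.2

variable [LinearOrder α]

/-- The three general branches of `φ` once a box is known to precede `m`. Here `S` and `R` are the
two halves of `T`, and `d` is the front letter, which is compared with the minimum of `T` to see
from which side that minimum comes. -/
theorem boxPhi_eq (m : α) (pre post : List (Option α)) (hm : some m ∉ pre) (S R : List α) (a : α)
    (p : List (Option α)) (hpre : pre = S.map some ++ some a :: none :: p) (x : WithTop α)
    (hpost : (post = R.map some ∧ x = ⊤) ∨
      ∃ (x' : α) (q : List (Option α)), post = R.map some ++ some x' :: none :: q ∧ x = x') (d : α)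
    (hhead : (S ++ [a]).head? = some d) :
    boxPhi m (pre ++ some m :: post) =
      if (S ++ R).minimum < min (a : WithTop α) x then
        if (d : WithTop α) = (S ++ R).minimum then
          pre.tail ++ some m :: some d :: post
        else post.take 1 ++ pre ++ some m :: post.tail
      else if x < a then
        match (generalizing := false) post with
        | z :: none :: y :: rest => y :: none :: z :: pre ++ some m :: rest
        | _ => pre ++ some m :: post
      else
        match (generalizing := false) pre with
        | z :: none :: y :: rest => rest ++ some m :: y :: none :: z :: post
        | _ => pre ++ some m :: post := by
  have hne : pre ≠ [] := by simp [hpre]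
  unfold boxPhi
  rw [takeWhile_ne_of_notMem _ _ _ hm]
  simp only [List.drop_append, List.drop_of_length_le (Nat.le_succ pre.length)]
  have hd : pre.length + 1 - pre.length = 1 := by omega
  simp only [hd, List.drop_one, List.tail_cons, List.nil_append]
  have hleft : (pre.takeWhile Option.isSome).reduceOption = S ++ [a] := by
    rw [hpre, takeWhile_isSome_run]
  have hx : (if decide (none ∈ post) = true then
      (post.takeWhile Option.isSome).reduceOption.getLast?.elim ⊤ (fun y => (y : WithTop α))
      else ⊤) = x := by
    rcases hpost with ⟨rfl, rfl⟩ | ⟨x', q, rfl, rfl⟩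
    · simp
    · rw [takeWhile_isSome_run]; simp
  have hR : (if decide (none ∈ post) = true then
      (post.takeWhile Option.isSome).reduceOption.dropLast
      else (post.takeWhile Option.isSome).reduceOption) = R := by
    rcases hpost with ⟨rfl, rfl⟩ | ⟨x', q, rfl, rfl⟩
    · simp [takeWhile_isSome_map]
    · rw [takeWhile_isSome_run]; simp
  split
  · simp_all
  · simp only [hleft, hx, hR, hhead]
    simp only [List.getLast?_append, List.getLast?_singleton, Option.some_or, Option.elim_some,
      List.dropLast_concat]
    rfl

end Phi

namespace PieceSys

variable {X α : Type} [LinearOrder α] (P : PieceSys X α)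

theorem boxes_split (A : List X) (w : X) (B : List X) (hw : P.first w ≠ P.last w) :
    P.boxes (A ++ w :: B) = (P.boxes A ++ [some (P.first w), none]) ++
      some (P.last w) :: P.boxes B := by
  simp [box, hw]

/-- In terms of pieces, `φ` takes the leading piece `y` across `w` and reverses it. If `y` is a
letter, it is the minimum of `T` and lies below `a` and `x`. If it is larger, then `a` is its first
letter, no letter of `T` is below `a`, and `a < x`, so the last branch applies. -/
theorem boxPhi_front (y : X) (A : List X) (w : X) (B : List X) (hw : P.first w ≠ P.last w)
    (hm : some (P.last w) ∉ P.boxes (y :: A) ++ [some (P.first w), none])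
    (hy : P.first y = P.last y → (∀ s ∈ P.runS (A ++ [w]), P.first y < s) ∧
      (P.first y : WithTop α) < P.runX (A ++ [w]))
    (hB : (∀ s ∈ P.runS B, P.first y < s) ∧ (P.first y : WithTop α) < P.runX B) :
    boxPhi (P.last w) (P.boxes (y :: A ++ w :: B)) = P.boxes (A ++ w :: P.rev y :: B) := by
  rw [boxes_split _ _ _ _ hw, boxes_split _ _ _ _ hw]
  obtain ⟨a, p, h1, h2⟩ := P.boxes_eq_run_left (y :: A) w hw
  obtain ⟨d, hd⟩ : ∃ d, (P.runS (y :: A ++ [w]) ++ [a]).head? = some d := by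
    rw [← Option.isSome_iff_exists]; simp
  rw [boxPhi_eq (P.last w) _ _ hm _ _ a p h1 _ (P.boxes_eq_run B) d hd]
  rw [← h2]
  by_cases hs : P.first y = P.last y
  · obtain ⟨h3, h4⟩ := hy hs
    have hmin : (P.runS (y :: A ++ [w]) ++ P.runS B).minimum = (P.first y : WithTop α) := by
      have : P.runS (y :: A ++ [w]) ++ P.runS B = P.first y :: (P.runS (A ++ [w]) ++ P.runS B) := by
        simp [runS, hs]
      rw [this, List.minimum_cons, min_eq_left]
      apply List.le_minimum_of_forall_le
      intro b hb
      rcases List.mem_append.1 hb with hb | hb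
      · exact WithTop.coe_le_coe.2 (h3 b hb).le
      · exact WithTop.coe_le_coe.2 (hB.1 b hb).le
    have hX : P.runX (y :: A ++ [w]) = P.runX (A ++ [w]) := by simp [runX, hs]
    have hrun : P.runS (y :: A ++ [w]) = P.first y :: P.runS (A ++ [w]) := by simp [runS, hs]
    rw [hrun] at hd
    obtain rfl : P.first y = d := by simpa using hd
    rw [hmin, hX, if_pos (lt_min h4 hB.2), if_pos rfl]
    simp [box, hs, P.first_rev, P.last_rev]
  · have hrun : P.runS (y :: A ++ [w]) = [] := by simp [runS, hs]
    have hX : P.runX (y :: A ++ [w]) = P.first y := by simp [runX, hs]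
    have ha : P.first y = a := by rw [hX] at h2; exact WithTop.coe_injective h2
    have hs' : P.last y ≠ P.first y := Ne.symm hs
    rw [hX, hrun, if_neg, if_neg]
    · simp [box, hs, hs', P.first_rev, P.last_rev]
    · exact hB.2.not_gt
    · rw [min_eq_left hB.2.le, not_lt]
      apply List.le_minimum_of_forall_le
      intro b hb
      exact WithTop.coe_le_coe.2 (hB.1 b (by simpa using hb)).le

/-- The mirror case: the first piece after `w` starts with a letter below everything compared on the
left, so `φ` brings it to the front, reversed. A letter is moved as the minimum of `T`; a larger
piece has `x` as its first letter, and then `x < a`. -/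
theorem boxPhi_back (A : List X) (w y : X) (B : List X) (hw : P.first w ≠ P.last w)
    (hm : some (P.last w) ∉ P.boxes A ++ [some (P.first w), none])
    (hy : P.first y = P.last y → (∀ s ∈ P.runS B, P.first y < s) ∧
      (P.first y : WithTop α) < P.runX B)
    (hA : (∀ s ∈ P.runS (A ++ [w]), P.first y < s) ∧
      (P.first y : WithTop α) < P.runX (A ++ [w])) :
    boxPhi (P.last w) (P.boxes (A ++ w :: y :: B)) = P.boxes (P.rev y :: A ++ w :: B) := by
  rw [boxes_split _ _ _ _ hw, boxes_split _ _ _ _ hw]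
  obtain ⟨a, p, h1, h2⟩ := P.boxes_eq_run_left A w hw
  obtain ⟨d, hd⟩ : ∃ d, (P.runS (A ++ [w]) ++ [a]).head? = some d := by
    rw [← Option.isSome_iff_exists]; simp
  rw [boxPhi_eq (P.last w) _ _ hm _ _ a p h1 _ (P.boxes_eq_run (y :: B)) d hd]
  rw [← h2]
  by_cases hs : P.first y = P.last y
  · obtain ⟨h3, h4⟩ := hy hs
    have hrun : P.runS (y :: B) = P.first y :: P.runS B := by simp [runS, hs]
    have hmin : (P.runS (A ++ [w]) ++ P.runS (y :: B)).minimum = (P.first y : WithTop α) := by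
      apply le_antisymm
      · apply List.minimum_le_of_mem'
        simp [hrun]
      apply List.le_minimum_of_forall_le
      intro b hb
      rw [hrun] at hb
      rcases List.mem_append.1 hb with hb | hb
      · exact WithTop.coe_le_coe.2 (hA.1 b hb).le
      · rcases List.mem_cons.1 hb with rfl | hb
        · exact le_rfl
        · exact WithTop.coe_le_coe.2 (h3 b hb).le
    have hX : P.runX (y :: B) = P.runX B := by simp [runX, hs]
    -- The front letter differs from the minimum of `T`, so the letter to be moved is the one after
    -- `m`.
    have hh : P.first y < d := by
      have := List.mem_of_head? hd
      rcases List.mem_append.1 this with h | h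
      · exact hA.1 _ h
      · rw [List.mem_singleton.1 h]
        have := hA.2
        rw [h2] at this
        exact WithTop.coe_lt_coe.1 this
    rw [hmin, hX, if_pos (lt_min hA.2 h4), if_neg]
    · simp [box, hs, P.first_rev, P.last_rev]
    · exact fun h => hh.ne' (WithTop.coe_injective h)
  · have hrun : P.runS (y :: B) = [] := by simp [runS, hs]
    have hX : P.runX (y :: B) = P.first y := by simp [runX, hs]
    have hs' : P.last y ≠ P.first y := Ne.symm hs
    rw [hX, hrun, if_neg, if_pos]
    · simp [box, hs, hs', P.first_rev, P.last_rev]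
    · exact hA.2
    · rw [min_eq_right hA.2.le, not_lt]
      apply List.le_minimum_of_forall_le
      intro b hb
      exact WithTop.coe_le_coe.2 (hA.1 b (by simpa using hb)).le

/-- This is the exceptional first kind of `φ`: the interchange `m □ y ↦ y □ m` reverses the piece
that contains `m`. -/
theorem boxPhi_swap (w : X) (B : List X) (hw : P.first w ≠ P.last w) :
    boxPhi (P.last w) (P.boxes (P.rev w :: B)) = P.boxes (w :: B) := by
  have hw' := hw.symm
  simp [boxPhi, box, P.first_rev, P.last_rev, hw, hw']

end PieceSys
-- Preimages under `φ`
namespace PieceSys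

variable {X α : Type} [LinearOrder α] (P : PieceSys X α)

/-- The sequences agree up to permutation and reversal of the pieces. -/
def RevPerm (us ws : List X) : Prop :=
  ∀ {γ : Type} (g : X → γ), (∀ x, g (P.rev x) = g x) → (us.map g).Perm (ws.map g)

omit [LinearOrder α] in
theorem RevPerm.trans {us vs ws : List X} (h : P.RevPerm us vs) (h' : P.RevPerm vs ws) :
    P.RevPerm us ws := fun g hg => (h g hg).trans (h' g hg)

omit [LinearOrder α] in
theorem RevPerm.of_perm {us ws : List X} (h : us.Perm ws) : P.RevPerm us ws :=
  fun g _ => h.map g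

omit [LinearOrder α] in
theorem RevPerm.append {us ws us' ws' : List X} (h : P.RevPerm us ws) (h' : P.RevPerm us' ws') :
    P.RevPerm (us ++ us') (ws ++ ws') := fun g hg => by
  simpa using (h g hg).append (h' g hg)

/-- The letters of a piece that are visible in its box-word. -/
def vis (x : X) : List α := (P.box x).reduceOption

theorem vis_perm_rev (x : X) : (P.vis (P.rev x)).Perm (P.vis x) := by
  unfold vis box
  rw [P.first_rev, P.last_rev]
  by_cases h : P.first x = P.last x
  · simp [h]
  · simp [h, Ne.symm h, List.reduceOption, List.Perm.swap]

theorem first_mem_vis (x : X) : P.first x ∈ P.vis x := by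
  unfold vis box; split <;> simp [List.reduceOption]

theorem last_mem_vis (x : X) : P.last x ∈ P.vis x := by
  unfold vis box; split <;> simp_all [List.reduceOption]

theorem mem_vis {x : X} {a : α} : a ∈ P.vis x ↔ a = P.first x ∨ a = P.last x := by
  unfold vis box; split <;> simp_all [List.reduceOption]

theorem reduceOption_boxes (ws : List X) : (P.boxes ws).reduceOption = ws.flatMap P.vis := by
  induction ws with
  | nil => rfl
  | cons x ws ih => simp [List.reduceOption_append, ih, vis]

theorem some_mem_boxes {a : α} {ws : List X} : some a ∈ P.boxes ws ↔ a ∈ ws.flatMap P.vis := by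
  rw [← reduceOption_boxes, List.reduceOption_mem_iff]

theorem RevPerm.vis_perm {us ws : List X} (h : P.RevPerm us ws) :
    (us.flatMap P.vis).Perm (ws.flatMap P.vis) := by
  have h1 := h (fun x => (P.vis x : Multiset α)) (fun x => Multiset.coe_eq_coe.2 (P.vis_perm_rev x))
  have key : ∀ vs : List X, ((vs.flatMap P.vis : List α) : Multiset α) =
      (vs.map (fun x => (P.vis x : Multiset α))).sum := by
    intro vs
    induction vs with
    | nil => rfl
    | cons v vs ih => simp [← ih]
  rw [← Multiset.coe_eq_coe, key, key, h1.sum_eq]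

theorem odd_length_box (x : X) : Odd (P.box x).length := by
  unfold box; split <;> simp [Nat.odd_iff]

/-- A piece contributes one or three symbols, so the parity of a position in the box-word, on which
the cases of `ψ` depend, is a parity of numbers of pieces. -/
theorem even_length_boxes (ws : List X) : Even (P.boxes ws).length ↔ Even ws.length := by
  induction ws with
  | nil => simp
  | cons x ws ih =>
    have := Nat.not_even_iff_odd.2 (P.odd_length_box x)
    simp only [boxes_cons, List.length_append, Nat.even_add, ih, List.length_cons]
    simp [this]

/-- Compare the leading piece after `w` with the leading piece of `A ++ [w]`, and carry the one with
the smaller first letter, reversed, to the front of the other side; if that one is `w` itself, just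
reverse it. Reversal turns the smaller first letter into a last letter, so an ascent to the other
leading piece appears, while what follows `w` always lies above its last letter, the minimum. `φ`
undoes the move. Since one piece changes sides, the number of pieces before `w` becomes odd, which
puts the new word into the third case of `ψ`. -/
theorem exists_boxPhi_eq (A : List X) (w : X) (B : List X)
    (hc : (A ++ w :: B).IsChain P.Up) (hA : Even A.length) (hw : P.last w < P.first w)
    (hmA : ∀ y ∈ A, P.last w < P.first y ∧ P.last w < P.last y)
    (hmB : ∀ y ∈ B, P.last w < P.first y ∧ P.last w < P.last y)
    (hd : ∀ y ∈ A ++ [w], ∀ z ∈ B, P.first y ≠ P.first z) :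
    ∃ ws : List X, ws.IsChain P.Up ∧ P.RevPerm ws (A ++ w :: B) ∧
      boxPhi (P.last w) (P.boxes ws) = P.boxes (A ++ w :: B) ∧
      (((P.boxes ws).idxOf (some (P.last w)) = 0 ∧ (P.boxes ws)[1]? = some none) ∨
        Odd ((P.boxes ws).idxOf (some (P.last w)))) := by
  have hw' : P.first w ≠ P.last w := hw.ne'
  have hcA : (A ++ [w]).IsChain P.Up := by
    have : A ++ w :: B = (A ++ [w]) ++ B := by simp
    rw [this] at hc
    exact (List.isChain_append.1 hc).1
  have hcB : (w :: B).IsChain P.Up := (List.isChain_append.1 hc).2.1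
  have notMem : ∀ A' : List X, (∀ y ∈ A', P.last w < P.first y ∧ P.last w < P.last y) →
      some (P.last w) ∉ P.boxes A' ++ [some (P.first w), none] := by
    intro A' h hmem
    rcases List.mem_append.1 hmem with h1 | h1
    · rw [some_mem_boxes, List.mem_flatMap] at h1
      obtain ⟨y, hy, h1⟩ := h1
      rcases P.mem_vis.1 h1 with h2 | h2
      · exact (h y hy).1.ne h2
      · exact (h y hy).2.ne h2
    · simp [hw.ne] at h1
  have odd_idx : ∀ (A' B' : List X), (∀ y ∈ A', P.last w < P.first y ∧ P.last w < P.last y) →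
      ¬ Even A'.length → Odd ((P.boxes (A' ++ w :: B')).idxOf (some (P.last w))) := by
    intro A' B' h hodd
    rw [boxes_split _ _ _ _ hw', List.idxOf_append_of_notMem (notMem A' h), List.idxOf_cons_self,
      ← Nat.not_even_iff_odd]
    simp only [List.length_append, List.length_cons, List.length_nil]
    rw [← even_length_boxes P] at hodd
    simpa [Nat.even_add] using hodd
  -- The positive case is that the leading piece after `w` has the smaller first letter. If `A` is
  -- empty, it is compared with `w`.
  by_cases hcase : ∃ y B', B = y :: B' ∧ ∀ z ∈ (A ++ [w]).head?, P.first y < P.first z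
  · obtain ⟨y, B', rfl, hlt⟩ := hcase
    have hmy := hmB y (by simp)
    have hchain : (P.rev y :: (A ++ [w])).IsChain P.Up := by
      rw [List.isChain_cons]
      exact ⟨fun z hz => by rw [Up, P.last_rev]; exact hlt z hz, hcA⟩
    have hl := P.run_lower _ _ hchain
    rw [P.last_rev] at hl
    have hB' : (y :: B').IsChain P.Up := hcB.tail
    refine ⟨P.rev y :: A ++ w :: B', ?_, ?_, ?_, Or.inr ?_⟩
    · have e : P.rev y :: A ++ w :: B' = (P.rev y :: (A ++ [w])) ++ B' := by simp
      rw [e, List.isChain_append]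
      refine ⟨hchain, hB'.tail, ?_⟩
      intro x hx z hz
      have hx' : x = w := by
        rw [← List.cons_append, List.getLast?_concat] at hx
        simpa using hx.symm
      rw [hx', Up]
      exact (hmB z (by simp [List.mem_of_head? hz])).1
    · intro γ g hg
      simp only [List.cons_append, List.map_cons, hg, List.map_append]
      simpa using (List.perm_middle (a := g y) (l₁ := A.map g ++ [g w]) (l₂ := B'.map g)).symm
    · rw [P.boxPhi_front _ _ _ _ hw']
      · simp only [boxes_append, boxes_cons]
        congr 3
        unfold box
        simp only [P.first_rev, P.last_rev]
      · apply notMem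
        intro z hz
        rcases List.mem_cons.1 hz with rfl | hz
        · rw [P.first_rev, P.last_rev]; exact ⟨hmy.2, hmy.1⟩
        · exact hmA z hz
      · intro hs
        rw [P.first_rev, P.last_rev] at hs
        rw [P.first_rev, hs]
        exact hl
      · rw [P.first_rev]
        exact P.run_lower _ _ hB'
    · apply odd_idx
      · intro z hz
        rcases List.mem_cons.1 hz with rfl | hz
        · rw [P.first_rev, P.last_rev]; exact ⟨hmy.2, hmy.1⟩
        · exact hmA z hz
      · simpa [Nat.even_add] using hA
  · have hlt : ∀ z ∈ (A ++ [w]).head?, ∀ y ∈ B.head?, P.first z < P.first y := by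
      intro z hz y hy
      by_contra hcon
      obtain ⟨B', rfl⟩ : ∃ B', B = y :: B' := ⟨B.tail, List.eq_cons_of_mem_head? hy⟩
      apply hcase
      refine ⟨y, B', rfl, fun z' hz' => ?_⟩
      obtain rfl : z = z' := by
        rw [Option.mem_def] at hz hz'
        rw [hz] at hz'
        exact Option.some_injective _ hz'
      exact lt_of_le_of_ne (not_lt.1 hcon)
        (Ne.symm (hd z (List.mem_of_head? hz) y (by simp)))
    cases A with
    | nil =>
      refine ⟨P.rev w :: B, ?_, ?_, P.boxPhi_swap w B hw', Or.inl ?_⟩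
      · rw [List.isChain_cons]
        exact ⟨fun z hz => by rw [Up, P.last_rev]; exact hlt w (by simp) z hz, hcB.tail⟩
      · intro γ g hg
        simp [hg]
      · simp [box, P.first_rev, P.last_rev, hw.ne]
    | cons z A =>
      have hmz := hmA z (by simp)
      have hzB : (P.rev z :: B).IsChain P.Up := by
        rw [List.isChain_cons]
        exact ⟨fun y hy => by rw [Up, P.last_rev]; exact hlt z (by simp) y hy, hcB.tail⟩
      have hl := P.run_lower _ _ hzB
      rw [P.last_rev] at hl
      refine ⟨A ++ w :: P.rev z :: B, ?_, ?_, ?_, Or.inr ?_⟩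
      · have e : A ++ w :: P.rev z :: B = (A ++ [w]) ++ P.rev z :: B := by simp
        rw [e, List.isChain_append]
        refine ⟨hcA.tail, hzB, ?_⟩
        intro x hx y hy
        have hx' : x = w := by
          rw [List.getLast?_concat] at hx
          simpa using hx.symm
        obtain rfl : y = P.rev z := by simpa using hy.symm
        rw [hx', Up, P.first_rev]
        exact hmz.2
      · intro γ g hg
        simp only [List.cons_append, List.map_cons, hg, List.map_append]
        simpa using List.perm_middle (a := g z) (l₁ := A.map g ++ [g w]) (l₂ := B.map g)
      · rw [P.boxPhi_back _ _ _ _ hw']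
        · simp only [boxes_append, boxes_cons]
          congr 2
          unfold box
          simp only [P.first_rev, P.last_rev]
        · exact notMem _ fun y hy => hmA y (by simp [hy])
        · intro hs
          rw [P.first_rev, P.last_rev] at hs
          rw [P.first_rev, hs]
          exact hl
        · rw [P.first_rev]
          exact P.run_lower _ _ hcA
      · apply odd_idx
        · exact fun y hy => hmA y (by simp [hy])
        · simpa [Nat.even_add_one] using hA

end PieceSys

/-! ### Preimages under `ψ` -/

theorem boxPsiAux_nil {α : Type} [LinearOrder α] (k : ℕ) :
    boxPsiAux k ([] : List (Option α)) = [] := by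
  cases k <;> simp [boxPsiAux]

theorem idxOf_append_cons {β : Type} [BEq β] [LawfulBEq β] {c : β} {pre : List β} (post : List β)
    (h : c ∉ pre) : (pre ++ c :: post).idxOf c = pre.length := by
  rw [List.idxOf_append_of_notMem h, List.idxOf_cons_self, add_zero]

namespace PieceSys

variable {X α : Type} [LinearOrder α] (P : PieceSys X α)

/-- A cycle of pieces, with an orientation: an odd number of pieces that are joined by ascents
cyclically, or a single letter. -/
def GoodCycle (g : Bool × List X) : Prop :=
  Odd g.2.length ∧ (Cycle.Chain P.Up (g.2 : Cycle X) ∨ ∃ x, g = (true, [x]) ∧ P.first x = P.last x)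

/-- The cyclic box-word of an oriented cycle of pieces. -/
def boxedCycle (g : Bool × List X) : List (Option α) :=
  if g.1 then P.boxes g.2 else (P.boxes g.2).reverse

theorem RevPerm.mem_vis {us ws : List X} (h : P.RevPerm us ws) {y : X} (hy : y ∈ us) :
    P.first y ∈ ws.flatMap P.vis ∧ P.last y ∈ ws.flatMap P.vis :=
  ⟨(h.vis_perm).subset (List.mem_flatMap.2 ⟨y, hy, P.first_mem_vis y⟩),
    (h.vis_perm).subset (List.mem_flatMap.2 ⟨y, hy, P.last_mem_vis y⟩)⟩

/-- Induction on the number of cycles: the cycle with the smallest visible letter is the one that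
`ψ` splits off first, so it is prepended to the word obtained for the remaining cycles. Any bound on
the number of calls which is at least the number of cycles gives the same result, as each call
produces one cycle. -/
theorem exists_boxPsiAux (G : List (Bool × List X)) (hG : ∀ g ∈ G, P.GoodCycle g)
    (hn : ((G.flatMap Prod.snd).flatMap P.vis).Nodup) :
    ∃ (ws : List X) (cs : List (List (Option α))) (G' : List (Bool × List X)),
      ws.IsChain P.Up ∧ P.RevPerm ws (G.flatMap Prod.snd) ∧
      (∀ k, G.length ≤ k → boxPsiAux k (P.boxes ws) = cs) ∧ G'.Perm G ∧
      List.Forall₂ (fun c g => c ~r P.boxedCycle g) cs G' := by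
  obtain ⟨N, hN⟩ : ∃ N, G.length = N := ⟨_, rfl⟩
  induction N generalizing G with
  | zero =>
    obtain rfl := List.length_eq_zero_iff.1 hN
    exact ⟨[], [], [], by simp, by intro γ g hg; simp, fun k _ => boxPsiAux_nil k, by simp,
      by simp⟩
  | succ N ih =>
    -- the smallest visible letter
    have hne : ((G.flatMap Prod.snd).flatMap P.vis) ≠ [] := by
      obtain ⟨g, hg⟩ := List.exists_mem_of_length_pos (l := G) (by omega)
      obtain ⟨x, hx⟩ := List.exists_mem_of_length_pos (l := g.2) (hG g hg).1.pos
      exact List.ne_nil_of_mem (List.mem_flatMap.2 ⟨x, List.mem_flatMap.2 ⟨g, hg, hx⟩,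
        P.first_mem_vis x⟩)
    obtain ⟨m, hm⟩ := Option.isSome_iff_exists.1 (List.isSome_min?_of_ne_nil hne)
    have hm' := (List.min?_eq_some_iff).1 hm
    obtain ⟨hmem, hmin⟩ := hm'
    obtain ⟨x, hxG, hmx⟩ := List.mem_flatMap.1 hmem
    obtain ⟨g, hgG, hxg⟩ := List.mem_flatMap.1 hxG
    obtain ⟨G1, G2, rfl⟩ := List.append_of_mem hgG
    have hperm : (G1 ++ g :: G2).Perm (g :: (G1 ++ G2)) := List.perm_middle
    obtain ⟨G0, hG0⟩ : ∃ G0, G0 = G1 ++ G2 := ⟨_, rfl⟩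
    rw [← hG0] at hperm
    have hsnd := hperm.flatMap_right Prod.snd
    have hvis := hsnd.flatMap_right P.vis
    simp only [List.flatMap_cons, List.flatMap_append] at hvis
    have hn2 := hvis.nodup_iff.1 (by simpa using hn)
    rw [← List.flatMap_append, List.flatMap_append, List.nodup_append] at hn2
    obtain ⟨hng, hn0, hdisj⟩ := hn2
    have hlen := hperm.length_eq
    obtain ⟨ws, cs, G', hch, hrp, hps, hGp, hfa⟩ := ih G0
      (fun g' hg' => hG g' (hperm.symm.subset (by simp [hg']))) hn0 (by simp at hlen hN; omega)
    have hmin' : ∀ b ∈ g.2.flatMap P.vis ++ (G0.flatMap Prod.snd).flatMap P.vis, m ≤ b := by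
      intro b hb
      apply hmin b
      simp only [List.flatMap_append, List.flatMap_cons]
      apply hvis.symm.subset
      simpa using hb
    have hmg : m ∈ g.2.flatMap P.vis := List.mem_flatMap.2 ⟨x, hxg, hmx⟩
    have hws : ∀ y ∈ ws, m < P.first y ∧ m < P.last y := by
      intro y hy
      have h := hrp.mem_vis P hy
      exact ⟨lt_of_le_of_ne (hmin' _ (List.mem_append_right _ h.1)) (hdisj _ hmg _ h.1),
        lt_of_le_of_ne (hmin' _ (List.mem_append_right _ h.2)) (hdisj _ hmg _ h.2)⟩
    have hminOf : ∀ vs : List X, P.RevPerm vs (g.2 ++ ws) →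
        (P.boxes vs).reduceOption.min? = some m := by
      intro vs hvs
      have h : (vs.flatMap P.vis).Perm
          (g.2.flatMap P.vis ++ (G0.flatMap Prod.snd).flatMap P.vis) := by
        refine hvs.vis_perm.trans ?_
        rw [List.flatMap_append]
        exact List.Perm.append_left _ hrp.vis_perm
      rw [reduceOption_boxes, List.min?_eq_some_iff]
      exact ⟨h.symm.subset (List.mem_append_left _ hmg), fun b hb => hmin' b (h.subset hb)⟩
    have hrpG : ∀ vs : List X, P.RevPerm vs (g.2 ++ ws) →
        P.RevPerm vs ((G1 ++ g :: G2).flatMap Prod.snd) := by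
      intro vs hvs
      refine RevPerm.trans P (RevPerm.trans P hvs ?_) (RevPerm.of_perm P hsnd.symm)
      rw [List.flatMap_cons]
      exact RevPerm.append P (RevPerm.of_perm P (List.Perm.refl _)) hrp
    have hfin : ∀ c, c ~r P.boxedCycle g →
        (g :: G').Perm (G1 ++ g :: G2) ∧
          List.Forall₂ (fun c g => c ~r P.boxedCycle g) (c :: cs) (g :: G') :=
      fun c hc => ⟨(hGp.cons g).trans hperm.symm, List.Forall₂.cons hc hfa⟩
    have hk : ∀ k, (G1 ++ g :: G2).length ≤ k → ∃ k', k = k' + 1 ∧ G0.length ≤ k' := by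
      intro k hk
      rw [hlen, List.length_cons] at hk
      exact ⟨k - 1, by omega, by omega⟩
    obtain ⟨hodd, hcyc | ⟨x', rfl, hx'⟩⟩ := hG g hgG
    · -- rotate the cycle so that it ends in `m`
      obtain ⟨u, v, huv⟩ := List.append_of_mem hxg
      obtain ⟨A, hA⟩ : ∃ A, A = v ++ u := ⟨_, rfl⟩
      have hrot : g.2 ~r (x :: A) := by
        rw [huv, hA, ← List.cons_append]
        exact List.isRotated_append
      have hrot' : g.2 ~r (A ++ [x]) := hrot.trans (List.isRotated_append (l := [x]) (l' := A))
      have hcoe : (g.2 : Cycle X) = ((x :: A : List X) : Cycle X) := Cycle.coe_eq_coe.2 hrot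
      rw [hcoe, Cycle.chain_coe_cons] at hcyc
      have hngA : ((A ++ [x]).flatMap P.vis).Nodup :=
        ((hrot'.perm.flatMap_right P.vis).nodup_iff).1 hng
      have hminA : ∀ y ∈ A ++ [x], m ≤ P.first y ∧ m ≤ P.last y := by
        intro y hy
        have hy' := hrot'.perm.symm.subset hy
        exact ⟨hmin' _ (List.mem_append_left _ (List.mem_flatMap.2 ⟨y, hy', P.first_mem_vis y⟩)),
          hmin' _ (List.mem_append_left _ (List.mem_flatMap.2 ⟨y, hy', P.last_mem_vis y⟩))⟩
      have hAeven : Even A.length := by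
        have := hrot.perm.length_eq
        rw [this, List.length_cons, ← Nat.not_even_iff_odd, Nat.even_add_one, not_not] at hodd
        exact hodd
      -- The cyclic predecessor of `x` ends in a letter that is at least `m` and ascends to the
      -- first letter of `x`. Hence `m` can only be the last letter of `x`.
      have hfirst : m < P.first x := by
        obtain ⟨z, hz, hzx⟩ : ∃ z ∈ A ++ [x], P.Up z x := by
          rcases List.eq_nil_or_concat A with rfl | ⟨A', z, rfl⟩
          · exact ⟨x, by simp, by simpa using hcyc⟩
          · refine ⟨z, by simp, ?_⟩
            have h := (List.isChain_append.1 (show (x :: A' ++ ([z] ++ [x])).IsChain P.Up by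
              simpa using hcyc)).2.1
            simpa using h
        exact (hminA z hz).2.trans_lt hzx
      obtain rfl : m = P.last x := by
        rcases P.mem_vis.1 hmx with h | h
        · exact absurd h hfirst.ne
        · exact h
      have hmA : ∀ y ∈ A, P.last x < P.first y ∧ P.last x < P.last y := by
        intro y hy
        rw [List.flatMap_append, List.nodup_append] at hngA
        have hd := hngA.2.2
        have hxm : P.last x ∈ List.flatMap P.vis [x] := by simp [P.last_mem_vis]
        have h1 := hminA y (by simp [hy])
        exact ⟨lt_of_le_of_ne h1.1 (hd _ (List.mem_flatMap.2 ⟨y, hy, P.first_mem_vis y⟩) _ hxm).symm,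
          lt_of_le_of_ne h1.2 (hd _ (List.mem_flatMap.2 ⟨y, hy, P.last_mem_vis y⟩) _ hxm).symm⟩
      have hchain : (A ++ x :: ws).IsChain P.Up := by
        have e : A ++ x :: ws = (A ++ [x]) ++ ws := by simp
        rw [e, List.isChain_append]
        refine ⟨hcyc.tail, hch, ?_⟩
        intro y hy z hz
        obtain rfl : y = x := by simpa using hy.symm
        exact (hws z (List.mem_of_head? hz)).1
      have hpermA : P.RevPerm (A ++ x :: ws) (g.2 ++ ws) := by
        apply RevPerm.of_perm
        have e : A ++ x :: ws = (A ++ [x]) ++ ws := by simp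
        rw [e]
        exact (hrot'.perm.symm).append_right ws
      have hne' : P.first x ≠ P.last x := hfirst.ne'
      have hnm : some (P.last x) ∉ P.boxes A ++ [some (P.first x), none] := by
        intro hmem
        rcases List.mem_append.1 hmem with h1 | h1
        · rw [some_mem_boxes, List.mem_flatMap] at h1
          obtain ⟨y, hy, h1⟩ := h1
          rcases P.mem_vis.1 h1 with h2 | h2
          · exact (hmA y hy).1.ne h2
          · exact (hmA y hy).2.ne h2
        · simp [hfirst.ne] at h1
      have hsplit := P.boxes_split A x ws hne'
      have hbr : P.boxes (A ++ [x]) ~r P.boxes g.2 := by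
        have e1 : P.boxes (A ++ [x]) ~r P.boxes (x :: A) := by
          rw [boxes_append]
          exact List.isRotated_append.trans (by simp [List.IsRotated.refl])
        refine e1.trans ?_
        rw [huv, hA, ← List.cons_append, boxes_append, boxes_append]
        exact List.isRotated_append
      have hend : P.boxes (A ++ [x]) = (P.boxes A ++ [some (P.first x), none]) ++
          [some (P.last x)] := P.boxes_split A x [] hne'
      obtain ⟨pre, hpre⟩ : ∃ pre, pre = P.boxes A ++ [some (P.first x), none] := ⟨_, rfl⟩
      rw [← hpre] at hnm hsplit hend
      have hidx : (P.boxes (A ++ x :: ws)).idxOf (some (P.last x)) = pre.length := by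
        rw [hsplit, idxOf_append_cons _ hnm]
      -- An even number of pieces and the two symbols of `x` before `m` precede it, so `m` sits
      -- where the second case of `ψ` expects it.
      have hprelen : pre.length ≠ 0 ∧ Even pre.length := by
        have h := (P.even_length_boxes A).2 hAeven
        rw [hpre]
        simp [Nat.even_add, h]
      cases hg1 : g.1 with
      | true =>
        obtain ⟨h1, h2⟩ := hfin (some (P.last x) :: pre) (by
          simp only [boxedCycle, hg1, if_true]
          refine List.IsRotated.trans ?_ hbr
          rw [hend]
          exact List.isRotated_append (l := [some (P.last x)]) (l' := pre))
        refine ⟨A ++ x :: ws, _, _, hchain, hrpG _ hpermA, ?_, h1, h2⟩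
        intro k hk1
        obtain ⟨k, rfl, hk2⟩ := hk k hk1
        rw [boxPsiAux, hminOf _ hpermA]
        simp only [hidx]
        rw [if_neg (fun h => hprelen.1 h.1), if_pos hprelen, hsplit]
        simp [hps k hk2]
      | false =>
        obtain ⟨h1, h2⟩ := hfin (some (P.last x) :: pre.reverse) (by
          simp only [boxedCycle, hg1]
          refine List.IsRotated.trans ?_ hbr.reverse
          rw [hend]
          simp [List.IsRotated.refl])
        have hfd : ∀ y ∈ A ++ [x], ∀ z ∈ ws, P.first y ≠ P.first z := by
          intro y hy z hz
          exact hdisj _ (List.mem_flatMap.2 ⟨y, hrot'.perm.symm.subset hy, P.first_mem_vis y⟩) _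
            (hrp.mem_vis P hz).1
        -- For the opposite orientation the third case of `ψ` is wanted, which reads off the
        -- reversed prefix of the `φ`-image; so the word with this orientation undone must be that
        -- image.
        obtain ⟨vs, hvs1, hvs2, hvs3, hvs4⟩ :=
          P.exists_boxPhi_eq A x ws hchain hAeven hfirst hmA hws hfd
        refine ⟨vs, _, _, hvs1, hrpG _ (RevPerm.trans P hvs2 hpermA), ?_, h1, h2⟩
        intro k hk1
        obtain ⟨k, rfl, hk2⟩ := hk k hk1
        rw [boxPsiAux, hminOf _ (RevPerm.trans P hvs2 hpermA)]
        simp only [hvs3, hidx]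
        rw [if_neg, if_neg, hsplit]
        · simp [hps k hk2]
        · rintro ⟨h3, h4⟩
          rcases hvs4 with h5 | h5
          · exact h3 h5.1
          · exact Nat.not_even_iff_odd.2 h5 h4
        · rintro ⟨h3, h4⟩
          rcases hvs4 with h5 | h5
          · exact h4 h5.2
          · rw [h3] at h5; simp at h5
    · -- a fixed point
      have hxx : x = x' := by simpa using hxg
      subst hxx
      have hmf : m = P.first x := by
        rcases P.mem_vis.1 hmx with h | h
        · exact h
        · rw [h, hx']
      subst hmf
      obtain ⟨h1, h2⟩ := hfin [some (P.first x)] (by simp [boxedCycle, box, hx', List.IsRotated.refl])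
      have hrp' : P.RevPerm (x :: ws) ([x] ++ ws) := RevPerm.of_perm P (List.Perm.refl _)
      refine ⟨x :: ws, _, _, ?_, hrpG _ hrp', ?_, h1, h2⟩
      · rw [List.isChain_cons]
        refine ⟨fun z hz => ?_, hch⟩
        rw [Up, ← hx']
        exact (hws z (List.mem_of_head? hz)).1
      · intro k hk1
        obtain ⟨k, rfl, hk2⟩ := hk k hk1
        rw [boxPsiAux, hminOf _ hrp']
        have hb : P.boxes (x :: ws) = some (P.first x) :: P.boxes ws := by simp [box, hx']
        have hb1 : (P.boxes (x :: ws))[1]? ≠ some none := by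
          rw [hb]
          cases ws with
          | nil => simp
          | cons y ws => simp [box]; split <;> simp
        simp only []
        rw [if_pos ⟨by rw [hb]; simp, hb1⟩, hb]
        simp [hps k hk2]

end PieceSys

/-! ### Heights, Dyck decompositions and the cycle lemma -/

section Heights
variable {α : Type} [LinearOrder α]

/-- The height of the last letter of a word. -/
def hgt (w : List α) : ℤ := asc w - des w

/-- The height difference of two successive letters. -/
def rise (a b : α) : ℤ := (if a < b then 1 else 0) - (if b < a then 1 else 0)

theorem rise_of_lt {a b : α} (h : a < b) : rise a b = 1 := by simp [rise, h, h.not_gt]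
theorem rise_of_gt {a b : α} (h : b < a) : rise a b = -1 := by simp [rise, h, h.not_gt]
theorem rise_swap (a b : α) : rise b a = -rise a b := by simp [rise]

@[simp] theorem hgt_nil : hgt ([] : List α) = 0 := rfl
@[simp] theorem hgt_singleton (a : α) : hgt [a] = 0 := rfl
theorem hgt_cons_cons (a b : α) (w : List α) : hgt (a :: b :: w) = rise a b + hgt (b :: w) := by
  simp only [hgt, asc, des, rise]; push_cast; ring

theorem hgt_append (u v : List α) (hu : u ≠ []) (hv : v ≠ []) :
    hgt (u ++ v) = hgt u + rise (u.getLast hu) (v.head hv) + hgt v := by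
  induction u with
  | nil => exact absurd rfl hu
  | cons a u ih =>
    cases u with
    | nil =>
      obtain ⟨b, v, rfl⟩ := List.exists_cons_of_ne_nil hv
      simp [hgt_cons_cons]
    | cons b u =>
      have := ih (by simp)
      simp only [List.cons_append] at this ⊢
      rw [hgt_cons_cons, hgt_cons_cons, this, List.getLast_cons (List.cons_ne_nil b u)]
      ring

theorem hgt_reverse (w : List α) : hgt w.reverse = -hgt w := by
  induction w with
  | nil => rfl
  | cons a w ih =>
    cases w with
    | nil => rfl
    | cons b w =>
      rw [List.reverse_cons, hgt_append _ _ (by simp) (by simp), ih, hgt_cons_cons]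
      simp [rise_swap a b]

theorem isBallotWord_iff (w : List α) : IsBallotWord w ↔ ∀ u, u <+: w → 0 ≤ hgt u := by
  unfold IsBallotWord hgt
  constructor
  · intro h u hu
    have := h u ((List.mem_inits _ _).2 hu)
    omega
  · intro h u hu
    have := h u ((List.mem_inits _ _).1 hu)
    omega

theorem isDyckWord_iff (w : List α) :
    IsDyckWord w ↔ (∀ u, u <+: w → 0 ≤ hgt u) ∧ hgt w = 0 := by
  unfold IsDyckWord
  rw [isBallotWord_iff]
  unfold hgt
  constructor
  · rintro ⟨h1, h2⟩; exact ⟨h1, by omega⟩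
  · rintro ⟨h1, h2⟩; exact ⟨h1, by omega⟩

theorem prefix_append_cases {β : Type} {p u v : List β} (h : p <+: u ++ v) :
    p <+: u ∨ ∃ q, q ≠ [] ∧ q <+: v ∧ p = u ++ q := by
  obtain ⟨t, ht⟩ := h
  rcases List.append_eq_append_iff.1 ht with ⟨a, h1, _⟩ | ⟨a, h1, h2⟩
  · exact Or.inl ⟨a, h1.symm⟩
  · by_cases ha : a = []
    · left; subst ha; simp only [List.append_nil] at h1; rw [h1]
    · exact Or.inr ⟨a, ha, ⟨t, h2.symm⟩, h1⟩

theorem hgt_parity (w : List α) (hw : w.IsChain (· ≠ ·)) (hne : w ≠ []) :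
    Even (hgt w) ↔ Odd w.length := by
  induction w with
  | nil => exact absurd rfl hne
  | cons a w ih =>
    cases w with
    | nil => simp
    | cons b w =>
      rw [List.isChain_cons_cons] at hw
      have := ih hw.2 (by simp)
      have hr : ¬ Even (rise a b) := by
        rcases lt_or_gt_of_ne hw.1 with h | h
        · rw [rise_of_lt h]; decide
        · rw [rise_of_gt h]; decide
      rw [hgt_cons_cons, Int.even_add, this, List.length_cons (a := a), Nat.odd_add_one]
      tauto

/-- Nonempty words, with their first and last letters and reversal. -/
def wordSys (α : Type) : PieceSys {w : List α // w ≠ []} α where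
  first w := w.1.head w.2
  last w := w.1.getLast w.2
  rev w := ⟨w.1.reverse, by simpa using w.2⟩
  first_rev w := by simp
  last_rev w := by simp

/-- The concatenation of a sequence of nonempty words. -/
def flat (ws : List {w : List α // w ≠ []}) : List α := ws.flatMap Subtype.val

omit [LinearOrder α] in
@[simp] theorem flat_nil : flat ([] : List {w : List α // w ≠ []}) = [] := rfl
omit [LinearOrder α] in
@[simp] theorem flat_cons (w : {w : List α // w ≠ []}) (ws) : flat (w :: ws) = w.1 ++ flat ws := rfl
omit [LinearOrder α] in
@[simp] theorem flat_append (us ws : List {w : List α // w ≠ []}) :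
    flat (us ++ ws) = flat us ++ flat ws := List.flatMap_append

omit [LinearOrder α] in
theorem head_flat_cons (w : {w : List α // w ≠ []}) (ws) (h : flat (w :: ws) ≠ []) :
    (flat (w :: ws)).head h = (wordSys α).first w := by
  simp only [flat_cons]
  rw [List.head_append_of_ne_nil w.2]
  rfl

omit [LinearOrder α] in
theorem getLast_flat_concat (w : {w : List α // w ≠ []}) (ws) (h : flat (ws ++ [w]) ≠ []) :
    (flat (ws ++ [w])).getLast h = (wordSys α).last w := by
  simp only [flat_append, flat_cons, flat_nil, List.append_nil]
  rw [List.getLast_append_of_ne_nil _ w.2]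
  rfl

/-- Each Dyck piece returns to the height at which it starts, and each junction raises that height
by one. -/
theorem isBallotWord_flat (ws : List {w : List α // w ≠ []}) (hD : ∀ w ∈ ws, IsDyckWord w.1)
    (hc : ws.IsChain (wordSys α).Up) : IsBallotWord (flat ws) := by
  induction ws with
  | nil => rw [isBallotWord_iff]; simp
  | cons w ws ih =>
    have ih := ih (fun v hv => hD v (by simp [hv])) hc.tail
    rw [isBallotWord_iff] at ih ⊢
    have hw := (isDyckWord_iff _).1 (hD w (by simp))
    intro p hp
    rcases prefix_append_cases hp with h | ⟨q, hq, hqv, rfl⟩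
    · exact hw.1 p h
    · cases ws with
      | nil => exact absurd (List.prefix_nil.1 hqv) hq
      | cons v ws =>
        have hup : (wordSys α).Up w v := (List.isChain_cons_cons.1 hc).1
        have hh : q.head hq = (wordSys α).first v := by
          rw [← head_flat_cons v ws (by simp [v.2])]
          exact hqv.head hq
        rw [hgt_append _ _ w.2 hq, hw.2, hh]
        have : rise (w.1.getLast w.2) ((wordSys α).first v) = 1 := rise_of_lt hup
        rw [this]
        have := ih q hqv
        omega

/-- Read the word letter by letter. An ascending letter opens a new piece; a descending letter
merges with the last two pieces into a single Dyck word. The number of pieces thus follows the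
height, and the relation `length = height + 1` is what later controls its parity. -/
theorem exists_dyck_pieces (t : List α) (hne : t ≠ []) (hc : t.IsChain (· ≠ ·))
    (hb : ∀ u, u <+: t → 0 ≤ hgt u) :
    ∃ ws : List {w : List α // w ≠ []}, (∀ w ∈ ws, IsDyckWord w.1) ∧
      ws.IsChain (wordSys α).Up ∧ flat ws = t ∧ (ws.length : ℤ) = hgt t + 1 := by
  induction t using List.reverseRecOn with
  | nil => exact absurd rfl hne
  | append_singleton t c ih =>
    have hsing : IsDyckWord [c] := by
      rw [isDyckWord_iff]
      refine ⟨fun u hu => ?_, rfl⟩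
      rcases List.prefix_concat_iff.1 (show u <+: [] ++ [c] from hu) with rfl | h
      · simp
      · rw [List.prefix_nil.1 h]; simp
    by_cases ht : t = []
    · subst ht
      exact ⟨[⟨[c], by simp⟩], by simpa using hsing, by simp, by simp, by simp⟩
    · have hct := (List.isChain_append.1 hc).1
      obtain ⟨ws, h1, h2, h3, h4⟩ := ih ht hct (fun u hu => hb u (hu.trans (List.prefix_append _ _)))
      have hh : hgt (t ++ [c]) = hgt t + rise (t.getLast ht) c := by
        rw [hgt_append t [c] ht (by simp)]; simp
      have hne' : t.getLast ht ≠ c :=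
        (List.isChain_append.1 hc).2.2 _ (List.getLast?_eq_some_getLast ht) _ (by simp)
      rcases List.eq_nil_or_concat' ws with rfl | ⟨vs, D, rfl⟩
      · exact absurd h3.symm ht
      · have hlast : t.getLast ht = (wordSys α).last D := by
          rw [← getLast_flat_concat D vs (by rw [h3]; exact ht)]
          congr 1; exact h3.symm
        rcases lt_or_gt_of_ne hne' with hlt | hlt
        · refine ⟨vs ++ [D] ++ [⟨[c], by simp⟩], ?_, ?_, ?_, ?_⟩
          · intro w hw
            rcases List.mem_append.1 hw with hw | hw
            · exact h1 w hw
            · obtain rfl := List.mem_singleton.1 hw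
              exact hsing
          · rw [List.isChain_append]
            refine ⟨h2, by simp, ?_⟩
            intro x hx y hy
            obtain rfl : x = D := by simpa using hx.symm
            obtain rfl : y = ⟨[c], by simp⟩ := by simpa using hy.symm
            show (wordSys α).last x < c
            rw [← hlast]; exact hlt
          · rw [flat_append, h3]; simp
          · rw [hh, rise_of_lt hlt, List.length_append, Nat.cast_add, h4]; simp
        · have h0 := hb _ (List.prefix_refl _)
          rw [hh, rise_of_gt hlt] at h0
          -- With only one piece the height before the descent would be `0`, and the new letter
          -- would lie below the axis.
          rcases List.eq_nil_or_concat' vs with rfl | ⟨vs, E, rfl⟩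
          · simp at h4; omega
          have hED : (wordSys α).Up E D := by
            have := (List.isChain_append.1 h2).2.2 E (by simp) D (by simp)
            exact this
          have hE := (isDyckWord_iff _).1 (h1 E (by simp))
          have hDd := (isDyckWord_iff _).1 (h1 D (by simp))
          have hr : rise (E.1.getLast E.2) (D.1.head D.2) = 1 := rise_of_lt hED
          have hr' : rise (D.1.getLast D.2) c = -1 := by
            apply rise_of_gt
            rw [hlast] at hlt
            exact hlt
          have hEDh : hgt (E.1 ++ D.1) = 1 := by
            rw [hgt_append _ _ E.2 D.2, hE.2, hDd.2, hr]; rfl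
          have hall : hgt (E.1 ++ D.1 ++ [c]) = 0 := by
            rw [hgt_append _ [c] (by simp [E.2]) (by simp), hEDh,
              List.getLast_append_of_ne_nil _ D.2]
            simp [hr']
          refine ⟨vs ++ [⟨E.1 ++ D.1 ++ [c], by simp⟩], ?_, ?_, ?_, ?_⟩
          · intro w hw
            rcases List.mem_append.1 hw with hw | hw
            · exact h1 w (by simp [hw])
            · obtain rfl := List.mem_singleton.1 hw
              rw [isDyckWord_iff]
              refine ⟨?_, hall⟩
              intro u hu
              rcases List.prefix_concat_iff.1 hu with rfl | h
              · rw [hall]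
              rcases prefix_append_cases h with h | ⟨q, hq, hqv, rfl⟩
              · exact hE.1 u h
              · have e := hqv.head hq
                rw [hgt_append _ _ E.2 hq, hE.2, e, hr]
                have := hDd.1 q hqv
                omega
          · have h2' := (List.isChain_append.1 h2).1
            rw [List.isChain_append] at h2'
            rw [List.isChain_append]
            refine ⟨h2'.1, by simp, ?_⟩
            intro x hx y hy
            obtain rfl : y = ⟨E.1 ++ D.1 ++ [c], by simp⟩ := by simpa using hy.symm
            have := h2'.2.2 x hx E (by simp)
            unfold PieceSys.Up at this ⊢
            have e : (wordSys α).first ⟨E.1 ++ D.1 ++ [c], by simp⟩ = (wordSys α).first E := by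
              simp only [wordSys, List.append_assoc]
              rw [List.head_append_of_ne_nil E.2]
            rw [e]; exact this
          · rw [← h3]; simp
          · rw [hh, rise_of_gt hlt]
            simp at h4 ⊢
            omega

/-- The cycle of letters given by an oriented cycle of words. -/
def flatCycle (g : Bool × List {w : List α // w ≠ []}) : List α :=
  if g.1 then flat g.2 else (flat g.2).reverse

/-- The cut is at the last minimum of the partial sums, the empty sum included. -/
theorem exists_split_prefix_sum_pos (s : List ℤ) :
    ∃ u v, s = u ++ v ∧ (∀ p, p <+: v → p ≠ [] → 0 < p.sum) ∧ ∀ p, p <+: u → u.sum ≤ p.sum := by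
  induction s with
  | nil => exact ⟨[], [], rfl, fun p hp h => absurd (List.prefix_nil.1 hp) h, fun p hp => by
      rw [List.prefix_nil.1 hp]⟩
  | cons a s ih =>
    obtain ⟨u, v, rfl, h1, h2⟩ := ih
    by_cases h : a + u.sum ≤ 0
    · refine ⟨a :: u, v, rfl, h1, fun p hp => ?_⟩
      cases p with
      | nil => simpa using h
      | cons b p =>
        obtain ⟨rfl, hp'⟩ := List.cons_prefix_cons.1 hp
        simpa using h2 p hp'
    · refine ⟨[], a :: (u ++ v), rfl, fun p hp hne => ?_, fun p hp => by
        rw [List.prefix_nil.1 hp]⟩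
      cases p with
      | nil => exact absurd rfl hne
      | cons b p =>
        obtain ⟨rfl, hp'⟩ := List.cons_prefix_cons.1 hp
        rcases prefix_append_cases hp' with h3 | ⟨q, hq, hqv, rfl⟩
        · have := h2 p h3
          simp only [List.sum_cons]; omega
        · have := h1 q hqv hq
          simp only [List.sum_cons, List.sum_append]; omega

/-- The cycle lemma: start at the last minimum. Up to the end of the sequence the sums are positive
by the choice of the cut; after wrapping around they equal the positive total plus a partial sum
that is at least the minimum, minus that minimum. -/
theorem exists_rotate_prefix_sum_pos (s : List ℤ) (hs : 0 < s.sum) :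
    ∃ k, ∀ p, p <+: s.rotate k → p ≠ [] → 0 < p.sum := by
  obtain ⟨u, v, rfl, h1, h2⟩ := exists_split_prefix_sum_pos s
  refine ⟨u.length, fun p hp hne => ?_⟩
  rw [List.rotate_append_length_eq] at hp
  rcases prefix_append_cases hp with h3 | ⟨q, hq, hqv, rfl⟩
  · exact h1 p h3 hne
  · have := h2 q hqv
    simp only [List.sum_append] at hs ⊢
    omega

theorem sum_zipWith_rise (a : α) (r : List α) (b : α) :
    (List.zipWith rise (a :: r) (r ++ [b])).sum = hgt (a :: r ++ [b]) := by
  induction r generalizing a with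
  | nil => simp [hgt_cons_cons]
  | cons c r ih => simp [hgt_cons_cons, ih c]

theorem sum_zipWith_rise' (a : α) (v : List α) :
    (List.zipWith rise (a :: v) v).sum = hgt (a :: v) := by
  induction v generalizing a with
  | nil => simp
  | cons e u ih => rw [List.zipWith_cons_cons, List.sum_cons, ih, ← hgt_cons_cons]

omit [LinearOrder α] in
theorem zipWith_prefix {β : Type} (f : α → α → β) (a : α) {t v : List α} {c : α}
    (h : v <+: t ++ [c]) :
    List.zipWith f (a :: v) v <+: List.zipWith f (a :: t) (t ++ [c]) := by
  induction t generalizing a v with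
  | nil =>
    rcases List.prefix_concat_iff.1 h with rfl | h
    · simp
    · rw [List.prefix_nil.1 h]; simp
  | cons e t ih =>
    cases v with
    | nil => simp
    | cons d v =>
      obtain ⟨rfl, h'⟩ := List.cons_prefix_cons.1 h
      simpa using ih d h'

/-- Rotate so that all partial sums of the cyclic rises are positive. The first rise, from `b` to
`c`, is then an ascent; moving `b` to the end lowers the sums by one, so the word from `c` to `b` is
ballot and splits into Dyck pieces. The ascent from `b` to `c` closes the chain of pieces
cyclically. A word of odd length has even height, so the number of pieces is odd. -/
theorem exists_goodCycle_of_pos (a : α) (r : List α) (hr : r ≠ []) (hn : (a :: r).Nodup)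
    (hodd : Odd (a :: r).length) (hpos : 0 < hgt (a :: r ++ [a])) :
    ∃ ws : List {w : List α // w ≠ []}, (∀ w ∈ ws, IsDyckWord w.1) ∧ Odd ws.length ∧
      Cycle.Chain (wordSys α).Up (ws : Cycle {w : List α // w ≠ []}) ∧ (a :: r) ~r flat ws := by
  obtain ⟨k, hk⟩ := exists_rotate_prefix_sum_pos
    (List.zipWith rise (a :: r) ((a :: r).rotate 1)) (by
      rw [List.rotate_cons_succ, List.rotate_zero, sum_zipWith_rise]; exact hpos)
  rw [List.zipWith_rotate_distrib _ _ _ _ (by simp), List.rotate_rotate, Nat.add_comm,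
    ← List.rotate_rotate] at hk
  obtain ⟨t, ht⟩ : ∃ t, t = (a :: r).rotate k := ⟨_, rfl⟩
  rw [← ht] at hk
  have hrot : (a :: r) ~r t := ⟨k, ht.symm⟩
  have hlen : t.length = (a :: r).length := by rw [ht, List.length_rotate]
  have hrl : r.length ≠ 0 := by simpa using hr
  rcases t with _ | ⟨b, _ | ⟨c, t⟩⟩
  · simp at hlen
  · exact absurd (by simpa using hlen) hr
  rw [List.rotate_cons_succ, List.rotate_zero] at hk
  have hbc : b < c := by
    by_contra hcon
    have h := hk [rise b c] (by simp) (by simp)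
    simp [rise, hcon] at h
    split at h <;> simp at h
  have hn' : ((c :: t) ++ [b]).Nodup := by
    have h1 : (b :: c :: t) ~r ((c :: t) ++ [b]) :=
      List.isRotated_append (l := [b]) (l' := c :: t)
    exact (hrot.trans h1).perm.nodup_iff.1 hn
  obtain ⟨ws, h1, h2, h3, h4⟩ := exists_dyck_pieces ((c :: t) ++ [b]) (by simp)
    (List.Pairwise.isChain hn') (by
      intro u hu
      rcases u with _ | ⟨d, u⟩
      · simp
      have h := hk _ (zipWith_prefix rise b hu) (by simp)
      obtain ⟨rfl, -⟩ := List.cons_prefix_cons.1 hu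
      rw [sum_zipWith_rise', hgt_cons_cons, rise_of_lt hbc] at h
      omega)
  refine ⟨ws, h1, ?_, ?_, ?_⟩
  · have hp := (hgt_parity _ (List.Pairwise.isChain hn') (by simp)).2 (by
      have e : (c :: t ++ [b]).length = (a :: r).length := by rw [← hlen]; simp
      rw [e]; exact hodd)
    have : Odd (ws.length : ℤ) := by rw [h4]; exact hp.add_one
    exact_mod_cast this
  · cases ws with
    | nil => simp at h3
    | cons w ws =>
      rw [Cycle.chain_coe_cons, ← List.cons_append, List.isChain_append]
      refine ⟨h2, by simp, ?_⟩
      intro x hx y hy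
      obtain rfl : y = w := by simpa using hy.symm
      have hfirst : (wordSys α).first y = c := by
        rw [← head_flat_cons y ws (by simp [y.2])]
        simp [h3]
      obtain ⟨vs, hvs⟩ := List.getLast?_eq_some_iff.1 hx
      have hlast : (wordSys α).last x = b := by
        rw [← getLast_flat_concat x vs (by rw [← hvs]; simp [y.2])]
        simp [← hvs, h3]
      rw [PieceSys.Up, hfirst, hlast]
      exact hbc
  · rw [h3]
    exact hrot.trans (List.isRotated_append (l := [b]) (l' := c :: t))

/-- The sum of an odd number of terms `±1` is not zero, and reversal changes its sign; the Boolean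
records the orientation in which it is positive. A single letter has no rises and is treated apart.
-/
theorem exists_goodCycle (t : List α) (hn : t.Nodup) (hodd : Odd t.length) :
    ∃ g : Bool × List {w : List α // w ≠ []}, (wordSys α).GoodCycle g ∧
      (∀ w ∈ g.2, IsDyckWord w.1) ∧ t ~r flatCycle g := by
  rcases t with _ | ⟨a, r⟩
  · simp at hodd
  by_cases hr : r = []
  · subst hr
    refine ⟨(true, [⟨[a], by simp⟩]), ⟨by simp, Or.inr ⟨_, rfl, rfl⟩⟩, ?_, ?_⟩
    · intro w hw
      obtain rfl := List.mem_singleton.1 hw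
      rw [isDyckWord_iff]
      refine ⟨fun u hu => ?_, rfl⟩
      rcases List.prefix_concat_iff.1 (show u <+: [] ++ [a] from hu) with rfl | h
      · simp
      · rw [List.prefix_nil.1 h]; simp
    · simp [flatCycle, List.IsRotated.refl]
  · have hchain : (a :: r ++ [a]).IsChain (· ≠ ·) := by
      rw [List.isChain_append]
      refine ⟨List.Pairwise.isChain hn, by simp, ?_⟩
      intro x hx y hy
      obtain rfl : y = a := by simpa using hy.symm
      rw [List.nodup_cons] at hn
      rintro rfl
      rw [List.getLast?_cons_of_ne_nil hr] at hx
      exact hn.1 (List.mem_of_getLast? hx)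
    have hz : hgt (a :: r ++ [a]) ≠ 0 := by
      intro h0
      have := (hgt_parity _ hchain (by simp)).1 (by rw [h0]; simp)
      rw [List.length_append, ← Nat.not_even_iff_odd, List.length_singleton,
        Nat.even_add_one, not_not] at this
      exact Nat.not_even_iff_odd.2 hodd this
    rcases lt_or_gt_of_ne hz with hneg | hpos
    · have hperm : (a :: r.reverse).Perm (a :: r) := (List.reverse_perm r).cons a
      obtain ⟨ws, h1, h2, h3, h4⟩ := exists_goodCycle_of_pos a r.reverse (by simpa using hr)
        (hperm.nodup_iff.2 hn) (by rw [hperm.length_eq]; exact hodd) (by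
          have e : a :: r.reverse ++ [a] = (a :: r ++ [a]).reverse := by simp
          rw [e, hgt_reverse]; omega)
      refine ⟨(false, ws), ⟨h2, Or.inl h3⟩, h1, ?_⟩
      have h5 := h4.reverse
      have h6 : (a :: r) ~r (a :: r.reverse).reverse := by
        simpa using List.isRotated_append (l := [a]) (l' := r)
      simpa [flatCycle] using h6.trans h5
    · obtain ⟨ws, h1, h2, h3, h4⟩ := exists_goodCycle_of_pos a r hr hn hodd hpos
      exact ⟨(true, ws), ⟨h2, Or.inl h3⟩, h1, by simpa [flatCycle] using h4⟩

end Heights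

/-! ### Maximal Dyck factors of a concatenation of Dyck pieces -/

section BoxWord
variable {α : Type} [LinearOrder α]

theorem mem_maxDyckFactors {w : List α} {f : ℕ × ℕ} :
    f ∈ maxDyckFactors w ↔ IsMaxDyckFactor w f.1 f.2 := by
  unfold maxDyckFactors
  simp only [List.mem_filter, decide_eq_true_eq, and_iff_right_iff_imp, List.product]
  intro h
  have h1 := h.1.1
  have h2 := h.1.2.1
  simp only [List.mem_flatMap, List.mem_map, List.mem_range]
  exact ⟨f.1, by omega, f.2, h2, rfl⟩

/-- A nonempty Dyck word followed by a ballot word, with an ascent in between. -/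
structure DyckSplit (u v : List α) : Prop where
  ne_nil : u ≠ []
  dyck : IsDyckWord u
  ballot : IsBallotWord v
  up : ∀ h : v ≠ [], u.getLast ne_nil < v.head h

/-- No Dyck factor crosses the cut: its part in `u` is a prefix of a Dyck word, the junction adds
one, and its part in `v` is a prefix of a ballot word, so its total height would be positive. -/
theorem isDyckFactor_append {u v : List α} (h : DyckSplit u v) (i j : ℕ) :
    IsDyckFactor (u ++ v) i j ↔ (j < u.length ∧ IsDyckFactor u i j) ∨
      (u.length ≤ i ∧ IsDyckFactor v (i - u.length) (j - u.length)) := by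
  have hL : j < u.length → factor (u ++ v) i j = factor u i j := by
    intro hj
    unfold factor
    rw [List.drop_append, List.take_append_of_le_length]
    · by_cases hij : i ≤ u.length
      · simp; omega
      · rw [List.length_drop]; omega
  have hR : u.length ≤ i → i ≤ j →
      factor (u ++ v) i j = factor v (i - u.length) (j - u.length) := by
    intro hi hij
    unfold factor
    rw [List.drop_append, List.drop_of_length_le hi, List.nil_append]
    congr 1
    omega
  by_cases hj : j < u.length
  · have h1 : ¬ (u.length ≤ i ∧ IsDyckFactor v (i - u.length) (j - u.length)) := by
      rintro ⟨h2, h3, _⟩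
      omega
    simp only [h1, or_false, hj, true_and]
    unfold IsDyckFactor
    rw [hL hj, List.length_append]
    constructor
    · rintro ⟨h2, _, h3⟩; exact ⟨h2, hj, h3⟩
    · rintro ⟨h2, _, h3⟩; exact ⟨h2, by omega, h3⟩
  · by_cases hi : u.length ≤ i
    · simp only [hj, hi, false_and, true_and, false_or]
      unfold IsDyckFactor
      rw [List.length_append]
      constructor
      · rintro ⟨h2, h3, h4⟩
        rw [hR hi (by omega)] at h4
        exact ⟨by omega, by omega, h4⟩
      · rintro ⟨h2, h3, h4⟩
        rw [← hR hi (by omega)] at h4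
        exact ⟨by omega, by omega, h4⟩
    · simp only [hj, hi, false_and, or_false, iff_false]
      rintro ⟨h2, h3, h4⟩
      rw [List.length_append] at h3
      -- a factor which straddles the cut has positive height
      have hs : u.drop i ≠ [] := by simp; omega
      have hq : v.take (j + 1 - u.length) ≠ [] := by
        have : v ≠ [] := by rintro rfl; simp at h3; omega
        simp [this]; omega
      have hf : factor (u ++ v) i j = u.drop i ++ v.take (j + 1 - u.length) := by
        unfold factor
        rw [List.drop_append, List.take_append]
        have e1 : i - u.length = 0 := by omega
        have e2 : j + 1 - i - (u.drop i).length = j + 1 - u.length := by simp; omega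
        rw [e1, e2, List.drop_zero, List.take_of_length_le]
        simp; omega
      rw [hf, isDyckWord_iff] at h4
      have h5 := h4.1 (u.drop i) (List.prefix_append _ _)
      have h6 := (isBallotWord_iff v).1 h.ballot _ (List.take_prefix (j + 1 - u.length) v)
      have h7 := h4.2
      have hv : v ≠ [] := by rintro rfl; simp at hq
      rw [hgt_append _ _ hs hq] at h7
      have h8 : rise ((u.drop i).getLast hs) ((v.take (j + 1 - u.length)).head hq) = 1 := by
        apply rise_of_lt
        rw [List.getLast_drop, List.head_take]
        exact h.up hv
      omega

theorem isDyckFactor_whole {u : List α} (h : IsDyckWord u) (hl : 3 ≤ u.length) :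
    IsDyckFactor u 0 (u.length - 1) := by
  refine ⟨by omega, by omega, ?_⟩
  unfold factor
  rw [List.drop_zero, List.take_of_length_le (by omega)]
  exact h

/-- Since no Dyck factor crosses the cut and `u` is itself a Dyck factor when it is long enough, `u`
absorbs every factor inside it, and maximality on the right is decided within `v`. -/
theorem isMaxDyckFactor_append {u v : List α} (h : DyckSplit u v) (i j : ℕ) :
    IsMaxDyckFactor (u ++ v) i j ↔ (i = 0 ∧ j + 1 = u.length ∧ 3 ≤ u.length) ∨
      (u.length ≤ i ∧ IsMaxDyckFactor v (i - u.length) (j - u.length)) := by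
  constructor
  · rintro ⟨h1, h2⟩
    rcases (isDyckFactor_append h i j).1 h1 with ⟨hj, h3⟩ | ⟨hi, h3⟩
    · left
      have hl : 3 ≤ u.length := by have := h3.1; omega
      have := h2 0 (by omega) (u.length - 1) (by rw [List.length_append]; omega)
        ⟨by omega, (isDyckFactor_append h _ _).2 (Or.inl ⟨by omega, isDyckFactor_whole h.dyck hl⟩)⟩
      exact ⟨this.1.symm, by omega, hl⟩
    · right
      refine ⟨hi, h3, ?_⟩
      rintro i' hi' j' hj' ⟨hjj, hf⟩
      have := h2 (i' + u.length) (by omega) (j' + u.length) (by rw [List.length_append]; omega)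
        ⟨by omega, (isDyckFactor_append h _ _).2 (Or.inr ⟨by omega, by simpa using hf⟩)⟩
      omega
  · rintro (⟨rfl, hj, hl⟩ | ⟨hi, h1, h2⟩)
    · obtain rfl : j = u.length - 1 := by omega
      refine ⟨(isDyckFactor_append h _ _).2 (Or.inl ⟨by omega, isDyckFactor_whole h.dyck hl⟩), ?_⟩
      rintro i' hi' j' hj' ⟨hjj, hf⟩
      rcases (isDyckFactor_append h _ _).1 hf with ⟨h3, _⟩ | ⟨h3, _⟩ <;> omega
    · refine ⟨(isDyckFactor_append h _ _).2 (Or.inr ⟨hi, h1⟩), ?_⟩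
      rintro i' hi' j' hj' ⟨hjj, hf⟩
      have hb := h1.1
      rcases (isDyckFactor_append h _ _).1 hf with ⟨h3, _⟩ | ⟨h3, h4⟩
      · omega
      · rw [List.length_append] at hj'
        have := h2 (i' - u.length) (by omega) (j' - u.length) (by omega) ⟨by omega, h4⟩
        omega

/-- The contribution of the `k`-th letter to the box-word. -/
def boxLetter (w : List α) (k : ℕ) : List (Option α) :=
  if ∃ f ∈ maxDyckFactors w, k = f.1 + 1 then [none]
  else if ∃ f ∈ maxDyckFactors w, f.1 < k ∧ k < f.2 then []
  else w[k]?.toList.map some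

theorem boxWord_eq (w : List α) : boxWord w = (List.range w.length).flatMap (boxLetter w) := rfl

theorem boxLetter_append_right {u v : List α} (h : DyckSplit u v) (k : ℕ) :
    boxLetter (u ++ v) (u.length + k) = boxLetter v k := by
  have hu := List.length_pos_iff.2 h.ne_nil
  have e1 : (∃ f ∈ maxDyckFactors (u ++ v), u.length + k = f.1 + 1) ↔
      ∃ f ∈ maxDyckFactors v, k = f.1 + 1 := by
    constructor
    · rintro ⟨f, hf, hk⟩
      rw [mem_maxDyckFactors, isMaxDyckFactor_append h] at hf
      rcases hf with hf | ⟨h1, h2⟩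
      · omega
      · exact ⟨(f.1 - u.length, f.2 - u.length), mem_maxDyckFactors.2 h2, by simp; omega⟩
    · rintro ⟨f, hf, hk⟩
      refine ⟨(f.1 + u.length, f.2 + u.length), ?_, by simp; omega⟩
      rw [mem_maxDyckFactors, isMaxDyckFactor_append h]
      right
      exact ⟨by simp, by simpa using mem_maxDyckFactors.1 hf⟩
  have e2 : (∃ f ∈ maxDyckFactors (u ++ v), f.1 < u.length + k ∧ u.length + k < f.2) ↔
      ∃ f ∈ maxDyckFactors v, f.1 < k ∧ k < f.2 := by
    constructor
    · rintro ⟨f, hf, hk⟩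
      rw [mem_maxDyckFactors, isMaxDyckFactor_append h] at hf
      rcases hf with hf | ⟨h1, h2⟩
      · omega
      · exact ⟨(f.1 - u.length, f.2 - u.length), mem_maxDyckFactors.2 h2, by simp; omega⟩
    · rintro ⟨f, hf, hk⟩
      refine ⟨(f.1 + u.length, f.2 + u.length), ?_, by simp; omega⟩
      rw [mem_maxDyckFactors, isMaxDyckFactor_append h]
      right
      exact ⟨by simp, by simpa using mem_maxDyckFactors.1 hf⟩
  unfold boxLetter
  simp only [e1, e2]
  rw [List.getElem?_append_right (by omega)]
  simp

theorem boxLetter_append_left {u v : List α} (h : DyckSplit u v) (k : ℕ) (hk : k < u.length) :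
    boxLetter (u ++ v) k = if 3 ≤ u.length ∧ k = 1 then [none]
      else if 0 < k ∧ k + 1 < u.length then [] else u[k]?.toList.map some := by
  have e1 : (∃ f ∈ maxDyckFactors (u ++ v), k = f.1 + 1) ↔ 3 ≤ u.length ∧ k = 1 := by
    constructor
    · rintro ⟨f, hf, hk⟩
      rw [mem_maxDyckFactors, isMaxDyckFactor_append h] at hf
      omega
    · rintro ⟨h1, h2⟩
      refine ⟨(0, u.length - 1), ?_, by simp [h2]⟩
      rw [mem_maxDyckFactors, isMaxDyckFactor_append h]
      left
      exact ⟨rfl, by simp; omega, h1⟩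
  have e2 : (∃ f ∈ maxDyckFactors (u ++ v), f.1 < k ∧ k < f.2) ↔ 0 < k ∧ k + 1 < u.length := by
    constructor
    · rintro ⟨f, hf, hk⟩
      rw [mem_maxDyckFactors, isMaxDyckFactor_append h] at hf
      omega
    · rintro ⟨h1, h2⟩
      refine ⟨(0, u.length - 1), ?_, by simp; omega⟩
      rw [mem_maxDyckFactors, isMaxDyckFactor_append h]
      left
      exact ⟨rfl, by simp; omega, by omega⟩
  unfold boxLetter
  simp only [e1, e2]
  rw [List.getElem?_append_left hk]

/-- Two distinct letters have different heights. A Dyck piece therefore has one letter or at least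
three, which are exactly the two shapes of `PieceSys.box`. -/
theorem dyck_length_ne_two {u : List α} (h : IsDyckWord u) (hn : u.Nodup) : u.length ≠ 2 := by
  intro hl
  obtain ⟨a, b, rfl⟩ := List.length_eq_two.1 hl
  have h0 := ((isDyckWord_iff _).1 h).2
  rw [hgt_cons_cons] at h0
  have hab : a ≠ b := by simpa using hn
  rcases lt_or_gt_of_ne hab with h1 | h1
  · simp [rise_of_lt h1] at h0
  · simp [rise_of_gt h1] at h0

omit [LinearOrder α] in
theorem first_ne_last {x : {w : List α // w ≠ []}} (hn : x.1.Nodup) (hl : 2 ≤ x.1.length) :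
    (wordSys α).first x ≠ (wordSys α).last x := by
  obtain ⟨_ | ⟨a, _ | ⟨b, w⟩⟩, hx⟩ := x
  · exact absurd rfl hx
  · simp at hl
  · intro h
    have h' : a = (a :: b :: w).getLast (by simp) := h
    rw [List.getLast_cons (by simp)] at h'
    exact (List.nodup_cons.1 hn).1 (h' ▸ List.getLast_mem _)

/-- The leading piece is contracted independently of the rest, because it is either a letter or a
maximal Dyck factor. Iterated, this shows that the concrete box-word of a concatenation is the
abstract one of its pieces. -/
theorem boxWord_append {u v : List α} (h : DyckSplit u v) (hn : u.Nodup) :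
    boxWord (u ++ v) = (wordSys α).box ⟨u, h.ne_nil⟩ ++ boxWord v := by
  rw [boxWord_eq, boxWord_eq, List.length_append, List.range_add, List.flatMap_append]
  congr 1
  · have h2 := dyck_length_ne_two h.dyck hn
    have hl := List.length_pos_iff.2 h.ne_nil
    rw [List.flatMap_congr (g := fun k => if 3 ≤ u.length ∧ k = 1 then [none]
      else if 0 < k ∧ k + 1 < u.length then [] else u[k]?.toList.map some)
      (fun k hk => boxLetter_append_left h k (List.mem_range.1 hk))]
    by_cases h3 : u.length = 1
    · obtain ⟨a, rfl⟩ := List.length_eq_one_iff.1 h3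
      simp [PieceSys.box, wordSys]
    · have hne := first_ne_last (x := ⟨u, h.ne_nil⟩) hn (by show 2 ≤ u.length; omega)
      rw [PieceSys.box, if_neg hne]
      obtain ⟨n, hn'⟩ : ∃ n, u.length = 2 + n + 1 := ⟨u.length - 3, by omega⟩
      rw [hn', List.range_succ, List.range_add]
      simp only [List.flatMap_append, List.flatMap_map, List.flatMap_cons, List.flatMap_nil,
        show List.range 2 = [0, 1] from rfl]
      have hmid : (List.range n).flatMap (fun a => if 3 ≤ 2 + n + 1 ∧ 2 + a = 1 then [none]
          else if 0 < 2 + a ∧ 2 + a + 1 < 2 + n + 1 then []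
          else u[2 + a]?.toList.map some) = [] := by
        rw [List.flatMap_eq_nil_iff]
        intro a ha
        rw [List.mem_range] at ha
        rw [if_neg (by omega), if_pos (by omega)]
      rw [hmid]
      have hlast : u[2 + n]? = some (u.getLast h.ne_nil) := by
        rw [List.getLast_eq_getElem, ← List.getElem?_eq_getElem]
        congr 1; omega
      have hfirst : u[0]? = some (u.head h.ne_nil) := by
        rw [← List.head?_eq_getElem?, List.head?_eq_some_head]
      simp only [hlast, hfirst]
      simp [wordSys, show 2 + n ≠ 1 by omega]
  · rw [List.flatMap_map]
    exact List.flatMap_congr fun k _ => boxLetter_append_right h k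

theorem dyckSplit_flat {w : {w : List α // w ≠ []}} {ws : List {w : List α // w ≠ []}}
    (hD : ∀ v ∈ w :: ws, IsDyckWord v.1) (hc : (w :: ws).IsChain (wordSys α).Up) :
    DyckSplit w.1 (flat ws) where
  ne_nil := w.2
  dyck := hD w (by simp)
  ballot := isBallotWord_flat ws (fun v hv => hD v (by simp [hv])) hc.tail
  up h := by
    cases ws with
    | nil => simp at h
    | cons v ws =>
      rw [head_flat_cons]
      exact (List.isChain_cons_cons.1 hc).1

theorem boxWord_flat (ws : List {w : List α // w ≠ []}) (hD : ∀ w ∈ ws, IsDyckWord w.1)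
    (hc : ws.IsChain (wordSys α).Up) (hn : (flat ws).Nodup) :
    boxWord (flat ws) = (wordSys α).boxes ws := by
  induction ws with
  | nil => rfl
  | cons w ws ih =>
    rw [flat_cons, List.nodup_append] at hn
    rw [flat_cons, boxWord_append (dyckSplit_flat hD hc) hn.1,
      ih (fun v hv => hD v (by simp [hv])) hc.tail hn.2.1]
    rfl

theorem mem_maxDyckWords {w d : List α} :
    d ∈ maxDyckWords w ↔ ∃ i j, IsMaxDyckFactor w i j ∧ factor w i j = d := by
  unfold maxDyckWords
  rw [List.mem_map]
  constructor
  · rintro ⟨f, hf, rfl⟩; exact ⟨f.1, f.2, mem_maxDyckFactors.1 hf, rfl⟩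
  · rintro ⟨i, j, h, rfl⟩; exact ⟨(i, j), mem_maxDyckFactors.2 h, rfl⟩

theorem mem_maxDyckWords_append {u v : List α} (h : DyckSplit u v) (d : List α) :
    d ∈ maxDyckWords (u ++ v) ↔ (d = u ∧ 3 ≤ u.length) ∨ d ∈ maxDyckWords v := by
  rw [mem_maxDyckWords, mem_maxDyckWords]
  have hR : ∀ i j, factor (u ++ v) (i + u.length) (j + u.length) = factor v i j := by
    intro i j
    unfold factor
    rw [List.drop_append, List.drop_of_length_le (by omega), List.nil_append]
    congr 1
    · omega
    · congr 1; omega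
  have hL : 3 ≤ u.length → factor (u ++ v) 0 (u.length - 1) = u := by
    intro hl
    unfold factor
    rw [List.drop_zero, List.take_append_of_le_length (by omega), List.take_of_length_le (by omega)]
  constructor
  · rintro ⟨i, j, h1, rfl⟩
    rcases (isMaxDyckFactor_append h i j).1 h1 with ⟨rfl, h3, h4⟩ | ⟨h3, h4⟩
    · obtain rfl : j = u.length - 1 := by omega
      exact Or.inl ⟨hL h4, h4⟩
    · refine Or.inr ⟨_, _, h4, ?_⟩
      have := h4.1.1
      rw [← hR, Nat.sub_add_cancel h3, Nat.sub_add_cancel (by omega)]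
  · rintro (⟨rfl, hl⟩ | ⟨i, j, h1, rfl⟩)
    · exact ⟨0, d.length - 1, (isMaxDyckFactor_append h _ _).2 (Or.inl ⟨rfl, by omega, hl⟩), hL hl⟩
    · exact ⟨i + u.length, j + u.length,
        (isMaxDyckFactor_append h _ _).2 (Or.inr ⟨by omega, by simpa using h1⟩), hR i j⟩

theorem mem_maxDyckWords_flat (ws : List {w : List α // w ≠ []}) (hD : ∀ w ∈ ws, IsDyckWord w.1)
    (hc : ws.IsChain (wordSys α).Up) (d : List α) :
    d ∈ maxDyckWords (flat ws) ↔ ∃ w ∈ ws, w.1 = d ∧ 3 ≤ d.length := by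
  induction ws with
  | nil => simp [maxDyckWords, maxDyckFactors]
  | cons w ws ih =>
    rw [flat_cons, mem_maxDyckWords_append (dyckSplit_flat hD hc),
      ih (fun v hv => hD v (by simp [hv])) hc.tail]
    constructor
    · rintro (⟨rfl, h⟩ | ⟨v, h1, h2⟩)
      · exact ⟨w, by simp, rfl, h⟩
      · exact ⟨v, by simp [h1], h2⟩
    · rintro ⟨v, h1, rfl, h2⟩
      rcases List.mem_cons.1 h1 with rfl | h1
      · exact Or.inl ⟨rfl, h2⟩
      · exact Or.inr ⟨v, h1, rfl, h2⟩

end BoxWord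

/-! ### Refilling the boxes of a cycle -/

section Fill
variable {α : Type} [LinearOrder α]

/-- What is inserted at position `k` of a cyclic box-word. -/
def fillLetter (D : List (List α)) (C : List (Option α)) (k : ℕ) : List α :=
  match C[k]? with
  | some (some a) => [a]
  | some none =>
    boxContent D C[(k + C.length - 1) % C.length]?.join C[(k + 1) % C.length]?.join
  | none => []

theorem fillCycle_eq (D : List (List α)) (C : List (Option α)) :
    fillCycle D C = (List.range C.length).flatMap (fillLetter D C) := rfl

theorem fillLetter_rotate (D : List (List α)) (C : List (Option α)) (n k : ℕ)
    (hk : k < C.length) :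
    fillLetter D (C.rotate n) k = fillLetter D C ((k + n) % C.length) := by
  have hN : 0 < C.length := by omega
  have hr : ∀ i, i < C.length → (C.rotate n)[i]? = C[(i + n) % C.length]? := fun i hi =>
    List.getElem?_rotate hi
  unfold fillLetter
  rw [hr k hk, List.length_rotate, hr _ (Nat.mod_lt _ hN), hr _ (Nat.mod_lt _ hN)]
  have e1 : ((k + C.length - 1) % C.length + n) % C.length =
      ((k + n) % C.length + C.length - 1) % C.length := by
    rw [Nat.mod_add_mod, Nat.add_sub_assoc (by omega), Nat.add_sub_assoc (by omega),
      Nat.mod_add_mod]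
    congr 1; omega
  have e2 : ((k + 1) % C.length + n) % C.length = ((k + n) % C.length + 1) % C.length := by
    rw [Nat.mod_add_mod, Nat.mod_add_mod]
    congr 1; omega
  rw [e1, e2]

/-- The neighbours of a box are read with indices modulo the length, so filling commutes with
rotation and does not depend on the representative up to rotation. -/
theorem fillCycle_isRotated (D : List (List α)) {C C' : List (Option α)} (h : C ~r C') :
    fillCycle D C ~r fillCycle D C' := by
  obtain ⟨n, rfl⟩ := h
  rw [fillCycle_eq, fillCycle_eq, List.length_rotate]
  have e : (List.range C.length).flatMap (fillLetter D (C.rotate n)) =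
      ((List.range C.length).rotate n).flatMap (fillLetter D C) := by
    have e1 : (List.range C.length).rotate n =
        (List.range C.length).map (fun k => (k + n) % C.length) := by
      apply List.ext_getElem
      · simp
      · intro i h1 h2
        simp [List.getElem_rotate]
    rw [e1, List.flatMap_map]
    exact List.flatMap_congr fun k hk => fillLetter_rotate D C n k (List.mem_range.1 hk)
  rw [e]
  obtain ⟨a, b, hab, hba⟩ : ∃ a b, List.range C.length = a ++ b ∧
      (List.range C.length).rotate n = b ++ a := by
    refine ⟨(List.range C.length).take (n % (List.range C.length).length),
      (List.range C.length).drop (n % (List.range C.length).length),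
      (List.take_append_drop _ _).symm, ?_⟩
    rw [List.rotate_eq_drop_append_take_mod]
  rw [hba]
  conv_lhs => rw [hab]
  rw [List.flatMap_append, List.flatMap_append]
  exact List.isRotated_append

/-- The words are determined by each of their two extremal letters. -/
def SepEnds (D : List (List α)) : Prop :=
  ∀ d ∈ D, ∀ d' ∈ D, (d.head? = d'.head? ∨ d.head? = d'.getLast? ∨ d.getLast? = d'.getLast?) →
    d = d'

theorem boxContent_of_mem {D : List (List α)} (hs : SepEnds D) {d : List α} (hd : d ∈ D) :
    boxContent D d.head? d.getLast? = d.tail.dropLast := by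
  unfold boxContent
  cases hf : D.find? (fun e => decide (e.head? = d.head? ∧ e.getLast? = d.getLast?)) with
  | none =>
    have := List.find?_eq_none.1 hf d hd
    simp at this
  | some e =>
    have h1 := List.find?_some hf
    have h2 := List.mem_of_find?_eq_some hf
    simp only [decide_eq_true_eq] at h1
    rw [hs e h2 d hd (Or.inl h1.1)]

theorem boxContent_of_mem_reverse {D : List (List α)} (hs : SepEnds D) {d : List α} (hd : d ∈ D)
    (hne : d.head? ≠ d.getLast?) :
    boxContent D d.getLast? d.head? = d.tail.dropLast.reverse := by
  unfold boxContent
  -- The first search must fail: a word starting with the last letter of `d` would be `d` itself,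
  -- whose two end letters differ.
  have hf : D.find? (fun e => decide (e.head? = d.getLast? ∧ e.getLast? = d.head?)) = none := by
    rw [List.find?_eq_none]
    intro e he h
    simp only [decide_eq_true_eq] at h
    obtain rfl := hs e he d hd (Or.inr (Or.inl h.1))
    exact hne h.1
  rw [hf]
  cases hf' : D.find? (fun e => decide (e.head? = d.head? ∧ e.getLast? = d.getLast?)) with
  | none =>
    have := List.find?_eq_none.1 hf' d hd
    simp at this
  | some e =>
    have h1 := List.find?_some hf'
    have h2 := List.mem_of_find?_eq_some hf'
    simp only [decide_eq_true_eq] at h1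
    rw [hs e h2 d hd (Or.inl h1.1)]

/-- A piece which is a letter or which occurs in `D` up to reversal. -/
def Fillable (D : List (List α)) (x : {w : List α // w ≠ []}) : Prop :=
  x.1.length = 1 ∨
    ((wordSys α).first x ≠ (wordSys α).last x ∧ (x.1 ∈ D ∨ x.1.reverse ∈ D))

theorem boxContent_fillable {D : List (List α)} (hs : SepEnds D) {x : {w : List α // w ≠ []}}
    (hne : (wordSys α).first x ≠ (wordSys α).last x) (hx : x.1 ∈ D ∨ x.1.reverse ∈ D) :
    boxContent D (some ((wordSys α).first x)) (some ((wordSys α).last x)) =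
      x.1.tail.dropLast := by
  have h1 : some ((wordSys α).first x) = x.1.head? := (List.head?_eq_some_head x.2).symm
  have h2 : some ((wordSys α).last x) = x.1.getLast? := (List.getLast?_eq_some_getLast x.2).symm
  rw [h1, h2]
  rcases hx with hx | hx
  · exact boxContent_of_mem hs hx
  · have := boxContent_of_mem_reverse hs hx (by
      rw [List.head?_reverse, List.getLast?_reverse, ← h1, ← h2]
      exact fun h => hne (Option.some_injective _ h).symm)
    rw [List.head?_reverse, List.getLast?_reverse] at this
    rw [this, List.tail_reverse, List.dropLast_reverse, List.reverse_reverse, List.tail_dropLast]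

/-- A box lies strictly inside the box-word of its piece, so its neighbours are the end letters of
that piece and the lookup returns its interior. The prefix `us` keeps the full cycle fixed in the
induction while the window of positions moves right. -/
theorem flatMap_fillLetter_boxes {D : List (List α)} (hs : SepEnds D)
    (us vs : List {w : List α // w ≠ []}) (hv : ∀ x ∈ vs, Fillable D x) :
    (List.range ((wordSys α).boxes vs).length).flatMap
      (fun k => fillLetter D ((wordSys α).boxes (us ++ vs)) (((wordSys α).boxes us).length + k)) =
    flat vs := by
  induction vs generalizing us with
  | nil => simp
  | cons x vs ih =>
    have h := ih (us ++ [x]) (fun y hy => hv y (by simp [hy]))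
    have e : us ++ x :: vs = us ++ [x] ++ vs := by simp
    rw [flat_cons, ← h, PieceSys.boxes_cons, List.length_append, List.range_add,
      List.flatMap_append, List.flatMap_map]
    congr 1
    · rw [PieceSys.boxes_append, PieceSys.boxes_cons]
      obtain ⟨p, hp⟩ : ∃ p, p = (wordSys α).boxes us := ⟨_, rfl⟩
      obtain ⟨q, hq⟩ : ∃ q, q = (wordSys α).boxes vs := ⟨_, rfl⟩
      rw [← hp, ← hq]
      rcases hv x (by simp) with h1 | ⟨h1, h2⟩
      · obtain ⟨a, ha⟩ := List.length_eq_one_iff.1 h1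
        obtain ⟨x, hx⟩ := x
        subst ha
        simp [PieceSys.box, wordSys, fillLetter]
      · rw [PieceSys.box, if_neg h1]
        have hc := boxContent_fillable hs h1 h2
        obtain ⟨w, hw⟩ := x
        obtain ⟨a, w, rfl⟩ := List.exists_cons_of_ne_nil hw
        have hw0 : w ≠ [] := by
          rintro rfl
          exact h1 rfl
        obtain ⟨w', b, rfl⟩ := (List.eq_nil_or_concat' w).resolve_left hw0
        have hf : (wordSys α).first ⟨a :: (w' ++ [b]), hw⟩ = a := rfl
        have hl : (wordSys α).last ⟨a :: (w' ++ [b]), hw⟩ = b := by simp [wordSys]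
        rw [hf, hl] at hc ⊢
        obtain ⟨C, hC⟩ : ∃ C, C = p ++ ([some a, none, some b] ++ q) := ⟨_, rfl⟩
        rw [← hC]
        have hlen : C.length = p.length + 3 + q.length := by rw [hC]; simp; omega
        have g0 : C[p.length + 0]? = some (some a) := by rw [hC]; simp
        have g1 : C[p.length + 1]? = some none := by rw [hC]; simp
        have g2 : C[p.length + 2]? = some (some b) := by rw [hC]; simp
        have f0 : fillLetter D C (p.length + 0) = [a] := by
          unfold fillLetter; rw [g0]
        have f2 : fillLetter D C (p.length + 2) = [b] := by
          unfold fillLetter; rw [g2]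
        have f1 : fillLetter D C (p.length + 1) = w' := by
          unfold fillLetter
          have m1 : (p.length + 1 + C.length - 1) % C.length = p.length + 0 := by
            rw [show p.length + 1 + C.length - 1 = p.length + C.length by omega,
              Nat.add_mod_right, Nat.mod_eq_of_lt (by omega), Nat.add_zero]
          have m2 : (p.length + 1 + 1) % C.length = p.length + 2 :=
            Nat.mod_eq_of_lt (by omega)
          rw [g1, m1, m2, g0, g2]
          simpa using hc
        have hr : List.range [some a, none, some b].length = [0, 1, 2] := rfl
        rw [hr]
        simp only [List.flatMap_cons, List.flatMap_nil, f0, f1, f2]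
        simp
    · refine List.flatMap_congr fun k _ => ?_
      rw [e]
      congr 1
      simp; omega

theorem fillCycle_boxes {D : List (List α)} (hs : SepEnds D)
    (vs : List {w : List α // w ≠ []}) (hv : ∀ x ∈ vs, Fillable D x) :
    fillCycle D ((wordSys α).boxes vs) = flat vs := by
  have := flatMap_fillLetter_boxes hs [] vs hv
  rw [← this, fillCycle_eq]
  simp

theorem boxes_reverse (vs : List {w : List α // w ≠ []}) :
    ((wordSys α).boxes vs).reverse = (wordSys α).boxes (vs.map (wordSys α).rev).reverse := by
  induction vs with
  | nil => rfl
  | cons x vs ih =>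
    rw [PieceSys.boxes_cons, List.reverse_append, ih, List.map_cons, List.reverse_cons,
      PieceSys.boxes_append]
    congr 1
    rw [PieceSys.boxes_cons, PieceSys.boxes_nil, List.append_nil, PieceSys.box, PieceSys.box,
      (wordSys α).first_rev, (wordSys α).last_rev]
    by_cases h : (wordSys α).first x = (wordSys α).last x
    · simp [h]
    · simp [h, Ne.symm h]

omit [LinearOrder α] in
theorem flat_reverse (vs : List {w : List α // w ≠ []}) :
    (flat vs).reverse = flat (vs.map (wordSys α).rev).reverse := by
  induction vs with
  | nil => rfl
  | cons x vs ih =>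
    rw [flat_cons, List.reverse_append, ih, List.map_cons, List.reverse_cons, flat_append]
    simp [wordSys]

omit [LinearOrder α] in
theorem Fillable.rev {D : List (List α)} {x : {w : List α // w ≠ []}} (h : Fillable D x) :
    Fillable D ((wordSys α).rev x) := by
  rcases h with h | ⟨h1, h2⟩
  · exact Or.inl (by simpa [wordSys] using h)
  · right
    rw [(wordSys α).first_rev, (wordSys α).last_rev]
    refine ⟨h1.symm, ?_⟩
    have : ((wordSys α).rev x).1 = x.1.reverse := rfl
    rw [this, List.reverse_reverse]
    exact h2.symm

/-- A negatively oriented cycle is the positively oriented box-word of its reversed pieces, in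
reversed order, and `boxContent` treats a word and its reversal alike. -/
theorem fillCycle_boxedCycle {D : List (List α)} (hs : SepEnds D)
    (g : Bool × List {w : List α // w ≠ []}) (hv : ∀ x ∈ g.2, Fillable D x) :
    fillCycle D ((wordSys α).boxedCycle g) = flatCycle g := by
  unfold PieceSys.boxedCycle flatCycle
  cases g.1 with
  | true => simpa using fillCycle_boxes hs g.2 hv
  | false =>
    simp only [Bool.false_eq_true, if_false]
    rw [boxes_reverse, flat_reverse]
    apply fillCycle_boxes hs
    intro x hx
    simp only [List.mem_reverse, List.mem_map] at hx
    obtain ⟨y, hy, rfl⟩ := hx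
    exact (hv y hy).rev

end Fill

/-! ### Surjectivity of `Ψ` -/

section Surjective
variable {α : Type} [LinearOrder α]

theorem IsDyckWord.reverse {w : List α} (h : IsDyckWord w) : IsDyckWord w.reverse := by
  rw [isDyckWord_iff] at h ⊢
  refine ⟨fun u hu => ?_, by rw [hgt_reverse, h.2]; rfl⟩
  obtain ⟨v, hv⟩ := hu
  by_cases hu0 : u = []
  · simp [hu0]
  have hw : w = v.reverse ++ u.reverse := by
    rw [← List.reverse_append, hv, List.reverse_reverse]
  by_cases hv0 : v = []
  · subst hv0
    simp only [List.append_nil] at hv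
    rw [hv, hgt_reverse, h.2]; rfl
  · have h1 := h.2
    have h2 := h.1 v.reverse ⟨_, hw.symm⟩
    have hne : v.reverse ≠ [] := by simpa using hv0
    have hne' : u.reverse ≠ [] := by simpa using hu0
    rw [hw, hgt_append _ _ hne hne', hgt_reverse u] at h1
    -- This is the height in `w` of the point at which the reversed prefix ends; as `w` ends at
    -- height `0`, it equals the height of `u`.
    have h3 : 0 ≤ hgt v.reverse + rise (v.reverse.getLast hne) (u.reverse.head hne') := by
      have h4 := h.1 (v.reverse ++ [u.reverse.head hne']) ⟨u.reverse.tail, by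
        rw [List.append_assoc, List.singleton_append, List.cons_head_tail, ← hw]⟩
      rw [hgt_append _ _ hne (by simp)] at h4
      simpa using h4
    omega

omit [LinearOrder α] in
theorem flat_coe (ws : List {w : List α // w ≠ []}) :
    (flat ws : Multiset α) = (ws.map (fun w => (w.1 : Multiset α))).sum := by
  induction ws with
  | nil => rfl
  | cons v vs ih => rw [flat_cons, List.map_cons, List.sum_cons, ← ih, Multiset.coe_add]

omit [LinearOrder α] in
theorem RevPerm.flat_perm {us ws : List {w : List α // w ≠ []}} (h : (wordSys α).RevPerm us ws) :
    (flat us).Perm (flat ws) := by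
  rw [← Multiset.coe_eq_coe, flat_coe, flat_coe]
  exact (h _ (fun x => by
    show ((x.1.reverse : List α) : Multiset α) = _
    exact Multiset.coe_reverse x.1)).sum_eq

omit [LinearOrder α] in
theorem rev_rev (x : {w : List α // w ≠ []}) : (wordSys α).rev ((wordSys α).rev x) = x :=
  Subtype.ext (List.reverse_reverse x.1)

-- The unordered pair of a piece and its reversal is reversal-invariant, so `RevPerm` may be tested
-- on it.
omit [LinearOrder α] in
theorem RevPerm.mem {us ws : List {w : List α // w ≠ []}} (h : (wordSys α).RevPerm us ws)
    {x : {w : List α // w ≠ []}} (hx : x ∈ ws) : x ∈ us ∨ (wordSys α).rev x ∈ us := by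
  have h1 := h (fun x => s(x, (wordSys α).rev x)) (fun x => by
    simp only [rev_rev]; exact Sym2.eq_swap)
  have h2 := h1.symm.subset (List.mem_map_of_mem hx)
  obtain ⟨y, hy, he⟩ := List.mem_map.1 h2
  rcases Sym2.eq_iff.1 he with ⟨rfl, _⟩ | ⟨rfl, _⟩
  · exact Or.inl hy
  · exact Or.inr hy

theorem vis_subset (x : {w : List α // w ≠ []}) : (wordSys α).vis x ⊆ x.1 := by
  intro a ha
  rcases (wordSys α).mem_vis.1 ha with rfl | rfl
  · exact List.head_mem x.2
  · exact List.getLast_mem x.2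

theorem nodup_flatMap_vis (ws : List {w : List α // w ≠ []}) (hn : (flat ws).Nodup) :
    (ws.flatMap (wordSys α).vis).Nodup := by
  rw [flat, List.nodup_flatMap] at hn
  rw [List.nodup_flatMap]
  refine ⟨fun x hx => ?_, hn.2.imp ?_⟩
  · unfold PieceSys.vis PieceSys.box
    split
    · simp [List.reduceOption]
    · rename_i h
      simp [List.reduceOption, h]
  · intro x y hxy
    exact fun a ha hb => hxy (vis_subset x ha) (vis_subset y hb)

theorem sepEnds_of_nodup (ws : List {w : List α // w ≠ []}) (hn : (flat ws).Nodup)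
    (D : List (List α)) (hD : ∀ d ∈ D, ∃ w ∈ ws, w.1 = d) : SepEnds D := by
  rw [flat, List.nodup_flatMap] at hn
  have key : ∀ x ∈ ws, ∀ y ∈ ws, ∀ a ∈ x.1, a ∈ y.1 → x = y := by
    intro x hx y hy a ha hb
    by_contra hne
    have : Std.Symm (Function.onFun (α := {w : List α // w ≠ []}) List.Disjoint Subtype.val) :=
      ⟨fun _ _ h => h.symm⟩
    have h2 := List.Pairwise.forall (R := Function.onFun List.Disjoint Subtype.val)
      hn.2 hx hy hne
    exact h2 ha hb
  intro d hd d' hd' h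
  obtain ⟨x, hx, rfl⟩ := hD d hd
  obtain ⟨y, hy, rfl⟩ := hD d' hd'
  rw [List.head?_eq_some_head x.2, List.head?_eq_some_head y.2,
    List.getLast?_eq_some_getLast x.2, List.getLast?_eq_some_getLast y.2] at h
  simp only [Option.some.injEq] at h
  congr 1
  rcases h with h | h | h
  · exact key x hx y hy _ (List.head_mem x.2) (h ▸ List.head_mem y.2)
  · exact key x hx y hy _ (List.head_mem x.2) (h ▸ List.getLast_mem y.2)
  · exact key x hx y hy _ (List.getLast_mem x.2) (h ▸ List.getLast_mem y.2)

theorem exists_goodCycles (T : List (List α)) (hodd : ∀ t ∈ T, Odd t.length)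
    (hn : ∀ t ∈ T, t.Nodup) :
    ∃ G : List (Bool × List {w : List α // w ≠ []}),
      (∀ g ∈ G, (wordSys α).GoodCycle g ∧ ∀ w ∈ g.2, IsDyckWord w.1) ∧
      G.map (fun g => (flatCycle g : Cycle α)) = T.map (fun t : List α => (t : Cycle α)) := by
  induction T with
  | nil => exact ⟨[], by simp, rfl⟩
  | cons t T ih =>
    obtain ⟨G, h1, h2⟩ := ih (fun t ht => hodd t (by simp [ht])) (fun t ht => hn t (by simp [ht]))
    obtain ⟨g, h3, h4, h5⟩ := exists_goodCycle t (hn t (by simp)) (hodd t (by simp))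
    refine ⟨g :: G, ?_, ?_⟩
    · intro g' hg'
      rcases List.mem_cons.1 hg' with rfl | hg'
      · exact ⟨h3, h4⟩
      · exact h1 g' hg'
    · rw [List.map_cons, List.map_cons, h2, Cycle.coe_eq_coe.2 h5.symm]

/-- Cut the cycles into Dyck pieces, invert `ψ` on their box-words and concatenate the resulting
pieces. They are the original pieces up to order and reversal, so they are again Dyck words with the
same letters, and the dictionary of maximal Dyck words has an entry, up to reversal, for each
original piece that is not a letter. -/
theorem exists_psiCycles (T : List (List α)) (hodd : ∀ t ∈ T, Odd t.length)
    (hn : T.flatten.Nodup) :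
    ∃ w : List α, IsBallotWord w ∧ w.Perm T.flatten ∧
      ((psiCycles w).map (fun C : List α => (C : Cycle α))).Perm (T.map (fun t : List α => (t : Cycle α))) := by
  obtain ⟨G, hG, hGT⟩ := exists_goodCycles T hodd (fun t ht => (List.nodup_flatten.1 hn).1 t ht)
  obtain ⟨us, hus⟩ : ∃ us, us = G.flatMap Prod.snd := ⟨_, rfl⟩
  have hpT : (flat us).Perm T.flatten := by
    rw [← Multiset.coe_eq_coe]
    have h1 : ∀ S : List (List α), (S.flatten : Multiset α) =
        ((S.map (fun t : List α => (t : Cycle α))).map Cycle.toMultiset).sum := by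
      intro S
      induction S with
      | nil => rfl
      | cons t S ih =>
        rw [List.flatten_cons, List.map_cons, List.map_cons, List.sum_cons, ← ih,
          ← Multiset.coe_add, Cycle.coe_toMultiset]
    rw [h1, ← hGT, hus]
    clear * -
    induction G with
    | nil => rfl
    | cons g G ih =>
      simp only [List.flatMap_cons, flat_append, ← Multiset.coe_add, ih, List.map_cons,
        List.sum_cons]
      congr 1
      unfold flatCycle
      cases g.1 <;> simp
  have hnus : (flat us).Nodup := hpT.nodup_iff.2 hn
  obtain ⟨ws, cs, G', hch, hrp, hps, hGp, hfa⟩ := (wordSys α).exists_boxPsiAux G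
    (fun g hg => (hG g hg).1) (by rw [← hus]; exact nodup_flatMap_vis us hnus)
  rw [← hus] at hrp
  have hperm := RevPerm.flat_perm hrp
  have hnws : (flat ws).Nodup := hperm.nodup_iff.2 hnus
  have hDus : ∀ w ∈ us, IsDyckWord w.1 := by
    intro w hw
    rw [hus] at hw
    obtain ⟨g, hg, hw⟩ := List.mem_flatMap.1 hw
    exact (hG g hg).2 w hw
  have hDws : ∀ w ∈ ws, IsDyckWord w.1 := by
    intro w hw
    -- Being a Dyck word is a reversal-invariant, proposition-valued function of the piece.
    have h1 := hrp (fun x => IsDyckWord x.1) (fun x => propext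
      ⟨fun h => by simpa [wordSys] using h.reverse, fun h => h.reverse⟩)
    obtain ⟨v, hv, he⟩ := List.mem_map.1 (h1.subset (List.mem_map_of_mem hw))
    exact he ▸ hDus v hv
  refine ⟨flat ws, isBallotWord_flat ws hDws hch, hperm.trans hpT, ?_⟩
  -- `boxPsi` allows as many calls as the word has symbols; this is enough, since each cycle
  -- contains a piece and each piece a symbol.
  have hlen : G.length ≤ ((wordSys α).boxes ws).length := by
    have h1 : G.length ≤ us.length := by
      rw [hus, List.length_flatMap]
      have := List.length_le_sum_of_one_le (G.map fun g => g.2.length) (by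
        intro i hi
        obtain ⟨g, hg, rfl⟩ := List.mem_map.1 hi
        exact (hG g hg).1.1.pos)
      simpa using this
    have h2 : us.length = ws.length := by
      have := (hrp (fun _ => ()) (fun _ => rfl)).length_eq
      simpa using this.symm
    have h3 : ws.length ≤ ((wordSys α).boxes ws).length := by
      rw [PieceSys.boxes, List.length_flatMap]
      have := List.length_le_sum_of_one_le (ws.map fun x => ((wordSys α).box x).length) (by
        intro i hi
        obtain ⟨g, hg, rfl⟩ := List.mem_map.1 hi
        exact ((wordSys α).odd_length_box g).pos)
      simpa using this
    omega
  obtain ⟨D, hDdef⟩ : ∃ D, D = maxDyckWords (flat ws) := ⟨_, rfl⟩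
  have hmemD : ∀ d, d ∈ D ↔ ∃ w ∈ ws, w.1 = d ∧ 3 ≤ d.length := by
    rw [hDdef]; exact mem_maxDyckWords_flat ws hDws hch
  have hsep : SepEnds D := sepEnds_of_nodup ws hnws D (fun d hd => by
    obtain ⟨w, h1, h2, _⟩ := (hmemD d).1 hd
    exact ⟨w, h1, h2⟩)
  have hfill : ∀ x ∈ us, Fillable D x := by
    intro x hx
    have hnx : x.1.Nodup := (List.nodup_flatMap.1 hnus).1 x hx
    by_cases h1 : x.1.length = 1
    · exact Or.inl h1
    · have h0 := List.length_pos_iff.2 x.2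
      have h2 := dyck_length_ne_two (hDus x hx) hnx
      refine Or.inr ⟨first_ne_last hnx (by omega), ?_⟩
      rcases RevPerm.mem hrp hx with h3 | h3
      · exact Or.inl ((hmemD _).2 ⟨x, h3, rfl, by omega⟩)
      · exact Or.inr ((hmemD _).2 ⟨_, h3, rfl, by simp; omega⟩)
  have hcs : psiCycles (flat ws) = cs.map (fillCycle D) := by
    unfold psiCycles
    rw [boxWord_flat ws hDws hch hnws, boxPsi, hps _ hlen, hDdef]
  rw [hcs, List.map_map, ← hGT]
  refine List.Perm.trans ?_ (hGp.map _)
  have hG'us : ∀ g ∈ G', ∀ x ∈ g.2, x ∈ us := by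
    intro g hg x hx
    rw [hus]
    exact List.mem_flatMap.2 ⟨g, hGp.subset hg, hx⟩
  have heq : cs.map ((fun C : List α => (C : Cycle α)) ∘ fillCycle D) =
      G'.map (fun g => (flatCycle g : Cycle α)) := by
    clear * - hfa hG'us hfill hsep
    induction hfa with
    | nil => rfl
    | @cons c g cs G' hcg _ ih =>
      rw [List.map_cons, List.map_cons, ih (fun g' hg' => hG'us g' (by simp [hg']))]
      congr 1
      have h1 := fillCycle_isRotated D hcg
      rw [fillCycle_boxedCycle hsep g
        (fun x hx => hfill x (hG'us g (by simp) x hx))] at h1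
      exact Cycle.coe_eq_coe.2 h1
  rw [heq]

end Surjective

theorem exists_perm_ofFn {n : ℕ} (w : List (Fin n)) (hw : w.Perm (List.finRange n)) :
    ∃ π : Equiv.Perm (Fin n), List.ofFn π = w := by
  have hlen : w.length = n := by simpa using hw.length_eq
  have hn : w.Nodup := hw.nodup_iff.2 (List.nodup_finRange n)
  have hinj : Function.Injective (fun i : Fin n => w[i.1]'(by omega)) := by
    intro i j hij
    exact Fin.ext ((hn.getElem_inj_iff).1 hij)
  refine ⟨Equiv.ofBijective _ (Finite.injective_iff_bijective.1 hinj), ?_⟩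
  apply List.ext_getElem
  · simp [hlen]
  · intro i h1 h2
    simp

theorem exists_letterCycles {α : Type} (Cs : List (Cycle (List α)))
    (h1 : ∀ C ∈ Cs, ∀ c ∈ C, c.length = 1) :
    ∃ T : List (List α), T.map (fun t => ((t.map (fun a => [a]) : List (List α)) : Cycle (List α)))
      = Cs := by
  induction Cs with
  | nil => exact ⟨[], rfl⟩
  | cons C Cs ih =>
    obtain ⟨T, hT⟩ := ih (fun C hC => h1 C (by simp [hC]))
    obtain ⟨l, rfl⟩ := Quot.exists_rep C
    have hl : ∀ c ∈ l, c.length = 1 := fun c hc => h1 _ (by simp) c (Cycle.mem_coe_iff.2 hc)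
    obtain ⟨t, ht⟩ : ∃ t : List α, t.map (fun a => [a]) = l := by
      clear * - hl
      induction l with
      | nil => exact ⟨[], rfl⟩
      | cons c l ih =>
        obtain ⟨t, rfl⟩ := ih (fun c hc => hl c (by simp [hc]))
        obtain ⟨a, rfl⟩ := List.length_eq_one_iff.1 (hl c (by simp))
        exact ⟨a :: t, rfl⟩
    exact ⟨t :: T, by rw [List.map_cons, hT, ht]; rfl⟩

/-- Only a preimage is produced; that it is the only one comes from the equality of the fibre sizes.
-/
theorem exists_Psi_eq {n : ℕ} (y : OddClusterPerm n)
    (hy : ∀ C ∈ y.cycles, ∀ c ∈ C, c.length = 1) : ∃ π : BallotPerm n, Psi π = y.cycles := by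
  obtain ⟨T, hT⟩ := exists_letterCycles y.cycles.toList (fun C hC => hy C (by simpa using hC))
  have hodd : ∀ t ∈ T, Odd t.length := by
    intro t ht
    have h1 : ((t.map (fun a => [a]) : List (List (Fin n))) : Cycle (List (Fin n))) ∈
        y.cycles.toList := by
      rw [← hT]; exact List.mem_map_of_mem ht
    have := y.odd_length _ (by simpa using h1)
    simpa using this
  have hflat : (T.flatten : Multiset (Fin n)) = (Finset.univ : Finset (Fin n)).val := by
    rw [← y.letters]
    have h1 : y.cycles.val = (y.cycles.toList : Multiset (Cycle (List (Fin n)))) := by simp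
    rw [h1, ← hT]
    clear * -
    induction T with
    | nil => rfl
    | cons t T ih =>
      rw [List.flatten_cons, ← Multiset.coe_add, ih, List.map_cons, ← Multiset.cons_coe,
        Multiset.cons_bind]
      congr 1
      clear * -
      rw [Cycle.coe_toMultiset]
      induction t with
      | nil => rfl
      | cons a t ih =>
        rw [List.map_cons, ← Multiset.cons_coe [a], Multiset.cons_bind, ← ih]
        rfl
  have hp : T.flatten.Perm (List.finRange n) := by
    rw [← Multiset.coe_eq_coe, hflat]; rfl
  obtain ⟨w, h1, h2, h3⟩ := exists_psiCycles T hodd (hp.nodup_iff.2 (List.nodup_finRange n))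
  obtain ⟨π, rfl⟩ := exists_perm_ofFn w (h2.trans hp)
  refine ⟨⟨π, h1⟩, ?_⟩
  unfold Psi
  have h4 := h3.map (Cycle.map (fun a => [a]))
  simp only [List.map_map] at h4
  have e : ∀ S : List (List (Fin n)), S.map (Cycle.map (fun a => [a]) ∘ fun t : List (Fin n) => (t : Cycle (Fin n)))
      = S.map (fun t => ((t.map (fun a => [a]) : List (List (Fin n))) : Cycle (List (Fin n)))) :=
    fun S => rfl
  rw [e, e, hT] at h4
  rw [List.toFinset_eq_of_perm _ _ h4]
  simp


/-! ### Permutations with odd cycles: recursion and generating function -/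

section Numbers

/-- The number of permutations with odd cycles only. -/
def oddCount : ℕ → ℕ
  | 0 => 1
  | 1 => 1
  | n + 2 => oddCount (n + 1) + (n + 1) * n * oddCount n

/-- Combinatorially, `j` is the number of further elements on the cycle through a fixed element, and
they can be chosen and arranged in `n.choose j * j!` ways. In the induction by two, the term `j = 0`
gives the first summand of the recursion, `j = 1` vanishes, and the rest is `(n + 2)(n + 1)` times
the sum for `n`. -/
theorem sum_even_choose_oddCount (n : ℕ) :
    ∑ j ∈ Finset.range (n + 1), (if Even j then n.choose j * j.factorial * oddCount (n - j) else 0)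
      = oddCount (n + 1) := by
  induction n using Nat.twoStepInduction with
  | zero => simp [oddCount]
  | one => simp [Finset.sum_range_succ, oddCount]
  | more n ih _ =>
    rw [Finset.sum_range_succ', Finset.sum_range_succ']
    have h : ∀ j, (if Even (j + 1 + 1) then (n + 2).choose (j + 1 + 1) * (j + 1 + 1).factorial *
        oddCount (n + 2 - (j + 1 + 1)) else 0) = (n + 2) * (n + 1) *
        (if Even j then n.choose j * j.factorial * oddCount (n - j) else 0) := by
      intro j
      have e : Even (j + 1 + 1) ↔ Even j := by simp [Nat.even_add_one]
      have d1 := Nat.descFactorial_eq_factorial_mul_choose (n + 2) (j + 1 + 1)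
      have d2 := Nat.descFactorial_eq_factorial_mul_choose n j
      rw [Nat.succ_descFactorial_succ, Nat.succ_descFactorial_succ, d2] at d1
      simp only [e]
      split
      · rw [show n + 2 - (j + 1 + 1) = n - j by omega, mul_comm ((n + 2).choose _), ← d1]
        ring
      · simp
    simp only [h]
    rw [← Finset.mul_sum, ih]
    simp [oddCount]
    ring

-- The recursion says that the exponential generating function satisfies `(1 - x²) C' = C`. Hence `F
-- = C²` solves `(1 - x²) F' = 2F` with `F(0) = 1`, so `F = (1 + x)/(1 - x)`, all of whose
-- coefficients after the first are `2`.
open PowerSeries in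
theorem sum_choose_oddCount (k : ℕ) (hk : k ≠ 0) :
    ∑ j ∈ Finset.range (k + 1), k.choose j * (oddCount j * oddCount (k - j)) =
      2 * k.factorial := by
  set C : PowerSeries ℚ := PowerSeries.mk (fun n => (oddCount n : ℚ) / n.factorial) with hC
  have hC' : ∀ n, coeff n (derivative ℚ C) = (oddCount (n + 1) : ℚ) / n.factorial := by
    intro n
    rw [coeff_derivative, hC, coeff_mk, Nat.factorial_succ]
    have : (n.factorial : ℚ) ≠ 0 := by positivity
    push_cast
    field_simp
  have h1 : derivative ℚ C - X ^ 2 * derivative ℚ C = C := by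
    ext n
    rw [map_sub, coeff_X_pow_mul', hC']
    have hcn : coeff n C = (oddCount n : ℚ) / n.factorial := by rw [hC, coeff_mk]
    rw [hcn]
    rcases n with _ | _ | n
    · simp [oddCount]
    · simp [oddCount]
    · rw [if_pos (by omega), show n + 1 + 1 - 2 = n by omega, hC', oddCount,
        Nat.factorial_succ, Nat.factorial_succ]
      have : (n.factorial : ℚ) ≠ 0 := by positivity
      push_cast
      field_simp
      ring
  have h2 : derivative ℚ (C * C) - X ^ 2 * derivative ℚ (C * C) = 2 * (C * C) := by
    have h3 : derivative ℚ (C * C) = 2 * C * derivative ℚ C := by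
      rw [Derivation.leibniz, smul_eq_mul]; ring
    rw [h3]
    linear_combination (2 * C) * h1
  have h4 : ∀ n, coeff (n + 1) (C * C) = 2 := by
    -- The differential equation for `C²`, read coefficientwise, is a recursion that forces the
    -- constant value `2`.
    have hc : ∀ n, coeff (n + 1) (C * C) * (n + 1) -
        (if 2 ≤ n then coeff (n - 2 + 1) (C * C) * ((n - 2 : ℕ) + 1) else 0) =
        2 * coeff n (C * C) := by
      intro n
      have := congrArg (coeff n) h2
      rw [map_sub, coeff_X_pow_mul', coeff_derivative,
        coeff_derivative] at this
      rw [this, show (2 : PowerSeries ℚ) = PowerSeries.C (2 : ℚ) from (map_ofNat _ 2).symm,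
        coeff_C_mul]
    have h0 : coeff 0 (C * C) = 1 := by
      rw [coeff_mul]; simp [hC, oddCount]
    intro n
    induction n using Nat.twoStepInduction with
    | zero => have := hc 0; simp [h0] at this; simpa using this
    | one =>
      have e0 := hc 0; simp [h0] at e0
      have := hc 1; simp [e0] at this; linarith
    | more n ih1 ih2 =>
      have := hc (n + 2)
      rw [if_pos (by omega), Nat.add_sub_cancel, ih1, show n + 2 = n + 1 + 1 from rfl, ih2] at this
      push_cast at this
      have hpos : (n : ℚ) + 3 ≠ 0 := by positivity
      have h5 : coeff (n + 1 + 1 + 1) (C * C) * ((n : ℚ) + 3) = 2 * (n + 3) := by linarith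
      exact mul_right_cancel₀ hpos h5
  obtain ⟨k, rfl⟩ := Nat.exists_eq_succ_of_ne_zero hk
  have h5 := h4 k
  rw [coeff_mul, Finset.Nat.sum_antidiagonal_eq_sum_range_succ_mk] at h5
  have h6 : ∀ j ∈ Finset.range (k + 1).succ,
      coeff j C * coeff (k + 1 - j) C * ((k + 1).factorial : ℚ) =
        (((k + 1).choose j * (oddCount j * oddCount (k + 1 - j)) : ℕ) : ℚ) := by
    intro j hj
    have hj' : j ≤ k + 1 := by rw [Finset.mem_range] at hj; omega
    have := Nat.choose_mul_factorial_mul_factorial hj'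
    rw [← this, hC, coeff_mk, coeff_mk]
    push_cast
    have e1 : (j.factorial : ℚ) ≠ 0 := by positivity
    have e2 : ((k + 1 - j).factorial : ℚ) ≠ 0 := by positivity
    field_simp
  have h7 : ((∑ j ∈ Finset.range (k + 1).succ,
      (k + 1).choose j * (oddCount j * oddCount (k + 1 - j)) : ℕ) : ℚ) =
      ((2 * (k + 1).factorial : ℕ) : ℚ) := by
    rw [Nat.cast_sum, ← Finset.sum_congr rfl h6, ← Finset.sum_mul, h5]
    push_cast; ring
  exact_mod_cast h7

end Numbers

/-! ### Counting arbitrary sequences of pieces -/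

section Arrangements
variable {X Q : Type} (cls : X → Q)

/-- The sequences of pieces which contain each class in `K` once. -/
def Arr (K : Finset Q) : Type := {ws : List X // ((ws.map cls : List Q) : Multiset Q) = K.val}

/-- The number of ways to choose one piece of each class in `K`. -/
noncomputable def wt (K : Finset Q) : ℕ := ∏ q ∈ K, Nat.card {x // cls x = q}

variable [DecidableEq Q]

theorem card_arr (hfin : ∀ q, Finite {x // cls x = q}) (K : Finset Q) :
    Finite (Arr cls K) ∧ Nat.card (Arr cls K) = K.card.factorial * wt cls K := by
  obtain ⟨n, hn⟩ : ∃ n, K.card = n := ⟨_, rfl⟩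
  induction n generalizing K with
  | zero =>
    obtain rfl := Finset.card_eq_zero.1 hn
    have : Unique (Arr cls (∅ : Finset Q)) :=
      { default := ⟨[], rfl⟩
        uniq := fun ws => by
          obtain ⟨ws, h⟩ := ws
          have : ws = [] := by simpa using h
          subst this; rfl }
    exact ⟨inferInstance, by simp [wt]⟩
  | succ n ih =>
    have hK : ∀ q : K, (K.erase q.1).card = n := fun q => by
      rw [Finset.card_erase_of_mem q.2]; omega
    let f : (Σ q : K, {x // cls x = q.1} × Arr cls (K.erase q.1)) → Arr cls K := fun p =>
      ⟨p.2.1.1 :: p.2.2.1, by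
        rw [List.map_cons, ← Multiset.cons_coe, p.2.2.2, p.2.1.2, Finset.erase_val,
          Multiset.cons_erase p.1.2]⟩
    have hf : Function.Bijective f := by
      constructor
      · rintro ⟨⟨q, hq⟩, ⟨x, hx⟩, ⟨t, ht⟩⟩ ⟨⟨q', hq'⟩, ⟨x', hx'⟩, ⟨t', ht'⟩⟩ h
        simp only at hx hx'
        have h1 := congrArg Subtype.val h
        simp only [f, List.cons.injEq] at h1
        obtain ⟨rfl, rfl⟩ := h1
        subst hx
        subst hx'
        rfl
      · rintro ⟨ws, h⟩
        cases ws with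
        | nil =>
          have := congrArg Multiset.card h
          simp at this
          omega
        | cons x t =>
          rw [List.map_cons, ← Multiset.cons_coe] at h
          have hx : cls x ∈ K := by
            show cls x ∈ K.val
            rw [← h]; exact Multiset.mem_cons_self _ _
          refine ⟨⟨⟨cls x, hx⟩, ⟨x, rfl⟩, ⟨t, ?_⟩⟩, rfl⟩
          rw [Finset.erase_val, ← h, Multiset.erase_cons_head]
    have hfin' : ∀ q : K, Finite ({x // cls x = q.1} × Arr cls (K.erase q.1)) := fun q => by
      have := (ih _ (hK q)).1
      infer_instance
    have e := Equiv.ofBijective f hf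
    refine ⟨Finite.of_equiv _ e, ?_⟩
    rw [← Nat.card_congr e, Nat.card_sigma]
    have hterm : ∀ q : K, Nat.card ({x // cls x = q.1} × Arr cls (K.erase q.1)) =
        n.factorial * wt cls K := by
      intro q
      rw [Nat.card_prod, (ih _ (hK q)).2, hK q, wt, wt, ← Finset.mul_prod_erase K _ q.2]
      ring
    rw [Finset.sum_congr rfl (fun q _ => hterm q), Finset.sum_const, Finset.card_univ,
      Fintype.card_coe, hn, Nat.factorial_succ, smul_eq_mul, mul_assoc]

end Arrangements

/-! ### Splitting a sequence at its first lowest point -/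

section PathHeights
variable {X : Type} (r : X → X → ℤ)

/-- The height of the last element of a sequence with height differences `r`. -/
def pathHt : List X → ℤ
  | a :: b :: w => r a b + pathHt (b :: w)
  | _ => 0

@[simp] theorem pathHt_nil : pathHt r [] = 0 := rfl
@[simp] theorem pathHt_singleton (a : X) : pathHt r [a] = 0 := rfl
theorem pathHt_cons_cons (a b : X) (w : List X) :
    pathHt r (a :: b :: w) = r a b + pathHt r (b :: w) := rfl

theorem pathHt_cons (a : X) (v : List X) (hv : v ≠ []) :
    pathHt r (a :: v) = r a (v.head hv) + pathHt r v := by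
  obtain ⟨b, v, rfl⟩ := List.exists_cons_of_ne_nil hv
  rfl

theorem pathHt_append (u v : List X) (hu : u ≠ []) (hv : v ≠ []) :
    pathHt r (u ++ v) = pathHt r u + r (u.getLast hu) (v.head hv) + pathHt r v := by
  induction u with
  | nil => exact absurd rfl hu
  | cons a u ih =>
    cases u with
    | nil => simpa using pathHt_cons r a v hv
    | cons b u =>
      have := ih (by simp)
      simp only [List.cons_append] at this ⊢
      rw [pathHt_cons_cons, pathHt_cons_cons, this, List.getLast_cons (List.cons_ne_nil b u)]
      ring

/-- All heights are nonnegative. -/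
def Ballot (ws : List X) : Prop := ∀ u, u <+: ws → 0 ≤ pathHt r u

/-- All heights, relative to the last one, are nonnegative. -/
def CoBallot (ws : List X) : Prop := ∀ u, u <:+ ws → pathHt r u ≤ 0

/-- `R` starts at the first lowest point: the last element of `A` is lowest within `A`, one descent
leads to the head of `R`, and `R` never goes below its head. -/
theorem exists_split_first_min (hr : ∀ x y, r x y = 1 ∨ r x y = -1) (ws : List X) (hne : ws ≠ []) :
    ∃ A R : List X, ws = A ++ R ∧ ∃ hR : R ≠ [], CoBallot r A ∧ Ballot r R ∧
      ∀ hA : A ≠ [], r (A.getLast hA) (R.head hR) = -1 := by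
  induction ws with
  | nil => exact absurd rfl hne
  | cons x ws ih =>
    have hnil : CoBallot r ([] : List X) := fun u hu => by rw [List.suffix_nil.1 hu]; simp
    by_cases hws : ws = []
    · subst hws
      refine ⟨[], [x], rfl, by simp, hnil, fun u hu => ?_, fun h => absurd rfl h⟩
      rcases List.prefix_concat_iff.1 (show u <+: [] ++ [x] from hu) with rfl | h
      · simp
      · rw [List.prefix_nil.1 h]; simp
    obtain ⟨A, R, rfl, hR, h1, h2, h3⟩ := ih hws
    by_cases hA : A = []
    · subst hA
      rcases hr x (R.head hR) with hx | hx
      · refine ⟨[], x :: R, rfl, by simp, hnil, fun u hu => ?_, fun h => absurd rfl h⟩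
        cases u with
        | nil => simp
        | cons y u =>
          obtain ⟨rfl, hu'⟩ := List.cons_prefix_cons.1 hu
          by_cases hu0 : u = []
          · subst hu0; simp
          · rw [pathHt_cons r _ _ hu0, hu'.head hu0, hx]
            have := h2 u hu'
            omega
      · refine ⟨[x], R, rfl, hR, fun u hu => ?_, h2, fun _ => by simpa using hx⟩
        rcases List.suffix_cons_iff.1 hu with rfl | h
        · simp
        · rw [List.suffix_nil.1 h]; simp
    -- If `x` is at least as high as the end of `A`, the old lowest point remains first. Otherwise
    -- the old lowest point, one step below the end of `A`, is not below `x`, and `x` takes over.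
    · by_cases hle : pathHt r (x :: A) ≤ 0
      · refine ⟨x :: A, R, rfl, hR, fun u hu => ?_, h2, fun _ => ?_⟩
        · rcases List.suffix_cons_iff.1 hu with rfl | h
          · exact hle
          · exact h1 u h
        · rw [List.getLast_cons hA]; exact h3 hA
      · refine ⟨[], x :: (A ++ R), rfl, by simp, hnil, fun u hu => ?_, fun h => absurd rfl h⟩
        rcases prefix_append_cases (show u <+: (x :: A) ++ R from hu) with h | ⟨q, hq, hqR, rfl⟩
        · obtain ⟨s, hs⟩ := h
          by_cases hs0 : s = []
          · subst hs0
            rw [List.append_nil] at hs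
            rw [hs]; omega
          by_cases hu0 : u = []
          · rw [hu0]; simp
          have hsA : s <:+ A := by
            obtain ⟨y, u, rfl⟩ := List.exists_cons_of_ne_nil hu0
            simp only [List.cons_append, List.cons.injEq] at hs
            exact ⟨u, hs.2⟩
          have h4 := h1 s hsA
          rw [← hs, pathHt_append r u s hu0 hs0] at hle
          rcases hr (u.getLast hu0) (s.head hs0) with h5 | h5 <;> omega
        · rw [pathHt_append r (x :: A) q (by simp) hq, List.getLast_cons hA, hqR.head hq, h3 hA]
          have := h2 q hqR
          omega

/-- If the second cut lay further right by a nonempty `B`, then `B` would not rise in total and a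
descent would follow it, so `R` would drop below its head. -/
theorem split_first_min_unique_aux {A R B R' : List X} (hR' : R' ≠ [])
    (he : A ++ R = (A ++ B) ++ R') (hB : CoBallot r (A ++ B)) (hbR : Ballot r R)
    (hj : ∀ h : A ++ B ≠ [], r ((A ++ B).getLast h) (R'.head hR') = -1) : B = [] := by
  by_contra hB0
  rw [List.append_assoc, List.append_cancel_left_eq] at he
  have h1 := hB B (List.suffix_append A B)
  have h2 := hbR (B ++ [R'.head hR']) ⟨R'.tail, by
    rw [List.append_assoc, List.singleton_append, List.cons_head_tail, ← he]⟩
  rw [pathHt_append r B _ hB0 (by simp)] at h2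
  have h3 := hj (by simp [hB0])
  rw [List.getLast_append_of_ne_nil _ hB0] at h3
  simp only [List.head_cons, h3, pathHt_singleton] at h2
  omega

theorem split_first_min_unique {A R A' R' : List X} (hR : R ≠ []) (hR' : R' ≠ [])
    (he : A ++ R = A' ++ R') (hA : CoBallot r A) (hA' : CoBallot r A') (hb : Ballot r R)
    (hb' : Ballot r R') (hj : ∀ h : A ≠ [], r (A.getLast h) (R.head hR) = -1)
    (hj' : ∀ h : A' ≠ [], r (A'.getLast h) (R'.head hR') = -1) : A = A' ∧ R = R' := by
  rcases List.append_eq_append_iff.1 he with ⟨B, rfl, h2⟩ | ⟨B, rfl, h2⟩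
  · obtain rfl := split_first_min_unique_aux r hR' he hA' hb hj'
    simpa using h2
  · obtain rfl := split_first_min_unique_aux r hR he.symm hA hb' hj
    simpa using h2.symm

variable (rev : X → X)

/-- The reversed sequence of the reversed pieces. -/
def revList (ws : List X) : List X := (ws.map rev).reverse

theorem pathHt_revList (ws : List X) (h : ws.IsChain (fun x y => r (rev y) (rev x) = -r x y)) :
    pathHt r (revList rev ws) = -pathHt r ws := by
  induction ws with
  | nil => rfl
  | cons a ws ih =>
    cases ws with
    | nil => rfl
    | cons b ws =>
      rw [List.isChain_cons_cons] at h
      have h1 := ih h.2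
      unfold revList at h1 ⊢
      rw [List.map_cons, List.reverse_cons, pathHt_append r _ _ (by simp) (by simp), h1,
        pathHt_cons_cons]
      simp [h.1]

/-- Reversing order and pieces traverses the same profile backwards, so prefixes become suffixes and
heights change sign. -/
theorem ballot_revList_iff (hrev : ∀ x, rev (rev x) = x) (ws : List X)
    (h : ws.IsChain (fun x y => r (rev y) (rev x) = -r x y)) :
    Ballot r (revList rev ws) ↔ CoBallot r ws := by
  have hinv : ∀ u, revList rev (revList rev u) = u := by
    intro u
    unfold revList
    rw [List.map_reverse, List.reverse_reverse, List.map_map]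
    conv_rhs => rw [← List.map_id u]
    congr 1
    funext x; exact hrev x
  have hpre : ∀ u v, u <:+ v → revList rev u <+: revList rev v := by
    intro u v huv
    unfold revList
    exact List.reverse_prefix.2 (huv.map rev)
  have hsuf : ∀ u v, u <+: v → revList rev u <:+ revList rev v := by
    intro u v huv
    unfold revList
    exact List.reverse_suffix.2 (huv.map rev)
  constructor
  · intro hb u hu
    have h1 := hb _ (hpre u ws hu)
    rw [pathHt_revList r rev u (h.suffix hu)] at h1
    omega
  · intro hb u hu
    have h1 := hsuf _ _ hu
    rw [hinv] at h1
    have h2 := hb _ h1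
    have h3 := pathHt_revList r rev _ (h.suffix h1)
    rw [hinv] at h3
    omega

end PathHeights

/-! ### Counting ballot sequences of pieces -/

section BallotCount
variable {X Q : Type} (cls : X → Q) (r : X → X → ℤ) (rev : X → X)

/-- The ballot sequences of pieces which contain each class in `K` once. -/
def BalArr (K : Finset Q) : Type :=
  {ws : List X // ((ws.map cls : List Q) : Multiset Q) = K.val ∧ Ballot r ws}

/-- Pairs of ballot sequences which together contain each class in `K` once. -/
def BalPairs (K : Finset Q) : Type :=
  {p : List X × List X // ((p.1.map cls ++ p.2.map cls : List Q) : Multiset Q) = K.val ∧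
    Ballot r p.1 ∧ Ballot r p.2}

/-- Reversal changes the sign of the height differences between different classes in `K`. -/
def AntiOn (K : Finset Q) : Prop := ∀ x y, cls x ∈ K → cls y ∈ K → cls x ≠ cls y →
  r (rev y) (rev x) = -r x y

/-- The reversal of the first sequence is followed by the second one after a descent. -/
def JoinsDown (p : List X × List X) : Prop :=
  ∃ hR : p.2 ≠ [], ∀ hL : p.1 ≠ [], r (rev (p.1.head hL)) (p.2.head hR) = -1

theorem isChain_anti {K : Finset Q} (hK : AntiOn cls r rev K) (ws : List X)
    (h : ((ws.map cls : List Q) : Multiset Q) ≤ K.val) :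
    ws.IsChain (fun x y => r (rev y) (rev x) = -r x y) := by
  have hn : (ws.map cls).Nodup := Multiset.coe_nodup.1 (Multiset.nodup_of_le h K.nodup)
  have hmem : ∀ x ∈ ws, cls x ∈ K := fun x hx =>
    Multiset.mem_of_le h (Multiset.mem_coe.2 (List.mem_map_of_mem hx))
  rw [List.Nodup, List.pairwise_map] at hn
  exact List.Pairwise.isChain (hn.imp_of_mem fun hx hy hne => hK _ _ (hmem _ hx) (hmem _ hy) hne)

theorem revList_revList (hrev : ∀ x, rev (rev x) = x) (u : List X) :
    revList rev (revList rev u) = u := by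
  unfold revList
  rw [List.map_reverse, List.reverse_reverse, List.map_map]
  conv_rhs => rw [← List.map_id u]
  congr 1
  funext x; exact hrev x

theorem coe_map_revList (hcr : ∀ x, cls (rev x) = cls x) (u : List X) :
    (((revList rev u).map cls : List Q) : Multiset Q) = ((u.map cls : List Q) : Multiset Q) := by
  unfold revList
  rw [List.map_reverse, Multiset.coe_reverse, List.map_map]
  congr 2
  funext x; exact hcr x

theorem getLast_revList (u : List X) (h : revList rev u ≠ []) (h' : u ≠ []) :
    (revList rev u).getLast h = rev (u.head h') := by
  simp [revList, List.getLast_reverse]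

variable {cls r rev}

/-- The correspondence sends `(L, R)` to the reversal of `L` followed by `R`; its inverse is the
split at the first lowest point. -/
theorem exists_joinsDown_equiv (hr : ∀ x y, r x y = 1 ∨ r x y = -1)
    (hrev : ∀ x, rev (rev x) = x) (hcr : ∀ x, cls (rev x) = cls x) {K : Finset Q}
    (hK : AntiOn cls r rev K) (hne : K.Nonempty) :
    Nonempty ({p : BalPairs cls r K // JoinsDown r rev p.1} ≃ Arr cls K) := by
  let f : {p : BalPairs cls r K // JoinsDown r rev p.1} → Arr cls K := fun p =>
    ⟨revList rev p.1.1.1 ++ p.1.1.2, by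
      rw [List.map_append, ← Multiset.coe_add, coe_map_revList cls rev hcr, Multiset.coe_add]
      exact p.1.2.1⟩
  have hle1 : ∀ L R : List X, ((L.map cls ++ R.map cls : List Q) : Multiset Q) = K.val →
      ((L.map cls : List Q) : Multiset Q) ≤ K.val := fun L R h => by
    rw [← h, ← Multiset.coe_add]; exact Multiset.le_add_right _ _
  have hco : ∀ L R : List X, ((L.map cls ++ R.map cls : List Q) : Multiset Q) = K.val →
      Ballot r L → CoBallot r (revList rev L) := by
    intro L R h hb
    have h1 : ((((revList rev L).map cls : List Q)) : Multiset Q) ≤ K.val := by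
      rw [coe_map_revList cls rev hcr]; exact hle1 L R h
    rw [← ballot_revList_iff r rev hrev _ (isChain_anti cls r rev hK _ h1),
      revList_revList rev hrev]
    exact hb
  refine ⟨Equiv.ofBijective f ⟨?_, ?_⟩⟩
  · rintro ⟨⟨⟨L, R⟩, h1, h2, h3⟩, hR, h4⟩ ⟨⟨⟨L', R'⟩, h1', h2', h3'⟩, hR', h4'⟩ h
    have he : revList rev L ++ R = revList rev L' ++ R' := congrArg Subtype.val h
    have hj : ∀ (L R : List X) (hR : R ≠ []),
        (∀ hL : L ≠ [], r (rev (L.head hL)) (R.head hR) = -1) →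
        ∀ h : revList rev L ≠ [], r ((revList rev L).getLast h) (R.head hR) = -1 := by
      intro L R hR h h'
      have hL : L ≠ [] := by rintro rfl; exact h' rfl
      rw [getLast_revList rev L h' hL]
      exact h hL
    obtain ⟨h5, rfl⟩ := split_first_min_unique r hR hR' he (hco L R h1 h2) (hco L' R' h1' h2')
      h3 h3' (hj L R hR h4) (hj L' R' hR' h4')
    have h6 := congrArg (revList rev) h5
    rw [revList_revList rev hrev, revList_revList rev hrev] at h6
    subst h6
    rfl
  · rintro ⟨ws, h⟩
    have hws : ws ≠ [] := by
      rintro rfl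
      have := congrArg Multiset.card h
      simp at this
      exact hne.ne_empty (Finset.card_eq_zero.1 this.symm)
    obtain ⟨A, R, rfl, hR, h1, h2, h3⟩ := exists_split_first_min r hr ws hws
    have h' : (((revList rev A).map cls ++ R.map cls : List Q) : Multiset Q) = K.val := by
      rw [← Multiset.coe_add, coe_map_revList cls rev hcr, Multiset.coe_add, ← List.map_append]
      exact h
    have hA : ((A.map cls : List Q) : Multiset Q) ≤ K.val := by
      apply hle1 A R; rw [← List.map_append]; exact h
    refine ⟨⟨⟨(revList rev A, R), h',
      (ballot_revList_iff r rev hrev A (isChain_anti cls r rev hK A hA)).2 h1, h2⟩,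
      hR, fun hL => ?_⟩, Subtype.ext ?_⟩
    · have hA0 : A ≠ [] := by rintro rfl; exact hL rfl
      have : (revList rev A).head hL = rev (A.getLast hA0) := by
        simp [revList, List.head_reverse]
      simp only [this, hrev]
      exact h3 hA0
    · show revList rev (revList rev A) ++ R = A ++ R
      rw [revList_revList rev hrev]

/-- Exchanging the two sequences reverses the junction, whose sign therefore changes. If one
sequence is empty, only the order with the empty one first joins down. -/
theorem joinsDown_swap (hr : ∀ x y, r x y = 1 ∨ r x y = -1)
    (hrev : ∀ x, rev (rev x) = x) (hcr : ∀ x, cls (rev x) = cls x) {K : Finset Q}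
    (hK : AntiOn cls r rev K) (hne : K.Nonempty) (p : List X × List X)
    (hp : ((p.1.map cls ++ p.2.map cls : List Q) : Multiset Q) = K.val) :
    JoinsDown r rev p.swap ↔ ¬ JoinsDown r rev p := by
  obtain ⟨L, R⟩ := p
  rcases L with _ | ⟨x, L⟩ <;> rcases R with _ | ⟨y, R⟩
  · exfalso
    have := congrArg Multiset.card hp
    simp at this
    exact hne.ne_empty (Finset.card_eq_zero.1 this.symm)
  · simp [JoinsDown]
  · simp [JoinsDown]
  · simp only [JoinsDown, Prod.swap, ne_eq, reduceCtorEq, not_false_eq_true, exists_true_left,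
      List.head_cons, forall_true_left]
    have hn : (cls x :: (L.map cls ++ cls y :: R.map cls)).Nodup := by
      rw [← Multiset.coe_nodup]
      have := K.nodup
      rw [← hp] at this
      simpa using this
    have hxy : cls x ≠ cls y := by
      intro h
      rw [h, List.nodup_cons] at hn
      simp at hn
    have hx : cls x ∈ K := by
      show cls x ∈ K.val
      rw [← hp]; simp
    have hy : cls y ∈ K := by
      show cls y ∈ K.val
      rw [← hp]; simp
    have h1 := hK (rev x) y (by rwa [hcr]) hy (by rwa [hcr])
    rw [hrev] at h1
    rw [h1]
    rcases hr (rev x) y with h | h <;> rw [h] <;> decide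

theorem card_balPairs (hr : ∀ x y, r x y = 1 ∨ r x y = -1)
    (hrev : ∀ x, rev (rev x) = x) (hcr : ∀ x, cls (rev x) = cls x) {K : Finset Q}
    (hK : AntiOn cls r rev K) (hne : K.Nonempty) [Finite (Arr cls K)] :
    Nat.card (BalPairs cls r K) = 2 * Nat.card (Arr cls K) := by
  classical
  obtain ⟨e⟩ := exists_joinsDown_equiv hr hrev hcr hK hne
  let swp : BalPairs cls r K → BalPairs cls r K := fun p =>
    ⟨p.1.swap, by
      obtain ⟨⟨L, R⟩, h1, h2, h3⟩ := p
      refine ⟨?_, h3, h2⟩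
      show ((R.map cls ++ L.map cls : List Q) : Multiset Q) = K.val
      rw [← h1, ← Multiset.coe_add, ← Multiset.coe_add, add_comm]⟩
  have e2 : {p : BalPairs cls r K // ¬ JoinsDown r rev p.1} ≃
      {p : BalPairs cls r K // JoinsDown r rev p.1} :=
    { toFun := fun p => ⟨swp p.1, (joinsDown_swap hr hrev hcr hK hne _ p.1.2.1).2 p.2⟩
      invFun := fun p => ⟨swp p.1, by
        have h := (joinsDown_swap hr hrev hcr hK hne _ (swp p.1).2.1).1 p.2
        exact h⟩
      left_inv := fun p => rfl
      right_inv := fun p => rfl }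
  have e3 := Equiv.sumCompl (fun p : BalPairs cls r K => JoinsDown r rev p.1)
  have e4 := e3.symm.trans (Equiv.sumCongr e (e2.trans e))
  rw [Nat.card_congr e4, Nat.card_sum]
  ring

variable [DecidableEq Q]

theorem card_balPairs_eq_sum (K : Finset Q) (hfin : ∀ J ⊆ K, Finite (BalArr cls r J)) :
    Nat.card (BalPairs cls r K) =
      ∑ J ∈ K.powerset, Nat.card (BalArr cls r J) * Nat.card (BalArr cls r (K \ J)) := by
  let f : (Σ J : K.powerset, BalArr cls r J.1 × BalArr cls r (K \ J.1)) → BalPairs cls r K :=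
    fun p => ⟨(p.2.1.1, p.2.2.1), by
      refine ⟨?_, p.2.1.2.2, p.2.2.2.2⟩
      have h := Finset.mem_powerset.1 p.1.2
      show ((p.2.1.1.map cls ++ p.2.2.1.map cls : List Q) : Multiset Q) = K.val
      rw [← Multiset.coe_add, p.2.1.2.1, p.2.2.2.1, Finset.sdiff_val, add_comm,
        Multiset.sub_add_cancel (Finset.val_le_iff.2 h)]⟩
  have hf : Function.Bijective f := by
    constructor
    · rintro ⟨⟨J, hJ⟩, ⟨L, hL⟩, ⟨R, hR⟩⟩ ⟨⟨J', hJ'⟩, ⟨L', hL'⟩, ⟨R', hR'⟩⟩ h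
      have h1 := congrArg Subtype.val h
      simp only [f, Prod.mk.injEq] at h1
      obtain ⟨rfl, rfl⟩ := h1
      obtain rfl : J = J' := Finset.val_injective (hL.1.symm.trans hL'.1)
      rfl
    · rintro ⟨⟨L, R⟩, h1, h2, h3⟩
      simp only at h1
      rw [← Multiset.coe_add] at h1
      have hle : ((L.map cls : List Q) : Multiset Q) ≤ K.val := by
        rw [← h1]; exact Multiset.le_add_right _ _
      let J : Finset Q := ⟨((L.map cls : List Q) : Multiset Q), Multiset.nodup_of_le hle K.nodup⟩
      have hsub : ((R.map cls : List Q) : Multiset Q) = K.val - ((L.map cls : List Q) : Multiset Q) := by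
        rw [← h1, add_tsub_cancel_left]
      refine ⟨⟨⟨J, Finset.mem_powerset.2 (Finset.val_le_iff.1 hle)⟩, ⟨L, rfl, h2⟩, ⟨R, ?_, h3⟩⟩, rfl⟩
      rw [Finset.sdiff_val]
      exact hsub
  have e := Equiv.ofBijective f hf
  have hfin' : ∀ J : K.powerset, Finite (BalArr cls r J.1 × BalArr cls r (K \ J.1)) := fun J => by
    have h1 := hfin J.1 (Finset.mem_powerset.1 J.2)
    have h2 := hfin (K \ J.1) Finset.sdiff_subset
    infer_instance
  rw [← Nat.card_congr e, Nat.card_sigma]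
  rw [← Finset.sum_coe_sort K.powerset
    (fun J => Nat.card (BalArr cls r J) * Nat.card (BalArr cls r (K \ J)))]
  exact Finset.sum_congr rfl fun J _ => Nat.card_prod _ _

theorem wt_mul_wt_sdiff {K J : Finset Q} (h : J ⊆ K) : wt cls J * wt cls (K \ J) = wt cls K := by
  unfold wt
  rw [mul_comm, Finset.prod_sdiff h]

theorem finite_balArr (hfin : ∀ q, Finite {x // cls x = q}) (K : Finset Q) :
    Finite (BalArr cls r K) := by
  have := (card_arr cls hfin K).1
  exact Finite.of_injective (β := Arr cls K) (fun ws => ⟨ws.1, ws.2.1⟩)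
    (fun a b h => Subtype.ext (congrArg (fun z : Arr cls K => z.1) h))

/-- Pairs of ballot sequences are counted in two ways. In the sum over subsets the terms for `∅` and
`K` both equal the unknown number, and all others are known by induction; `sum_choose_oddCount`
shows that `wt * oddCount` satisfies the same equation. -/
theorem card_balArr (hr : ∀ x y, r x y = 1 ∨ r x y = -1)
    (hrev : ∀ x, rev (rev x) = x) (hcr : ∀ x, cls (rev x) = cls x)
    (hfin : ∀ q, Finite {x // cls x = q}) (K : Finset Q) (hK : AntiOn cls r rev K) :
    Nat.card (BalArr cls r K) = wt cls K * oddCount K.card := by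
  induction K using Finset.strongInduction with
  | H K ih =>
    have h0 : Nat.card (BalArr cls r ∅) = 1 := by
      have : Unique (BalArr cls r ∅) :=
        { default := ⟨[], rfl, fun u hu => by rw [List.prefix_nil.1 hu]; simp⟩
          uniq := fun ws => by
            obtain ⟨ws, h, h'⟩ := ws
            have : ws = [] := by simpa using h
            subst this; rfl }
      exact Nat.card_unique
    rcases K.eq_empty_or_nonempty with rfl | hne
    · rw [h0]; simp [wt, oddCount]
    have hT := card_arr cls hfin K
    have := hT.1
    have h1 := card_balPairs hr hrev hcr hK hne
    rw [card_balPairs_eq_sum K (fun J _ => finite_balArr hfin J), hT.2] at h1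
    have h2 := sum_choose_oddCount K.card (Finset.card_ne_zero.2 hne)
    have h3 : ∑ J ∈ K.powerset, wt cls K * (oddCount J.card * oddCount (K.card - J.card)) =
        2 * (K.card.factorial * wt cls K) := by
      rw [← Finset.mul_sum, Finset.sum_powerset_apply_card
        (fun j => oddCount j * oddCount (K.card - j))]
      simp only [smul_eq_mul]
      rw [h2]; ring
    have hrest : ∀ J ∈ (K.powerset.erase ∅).erase K,
        Nat.card (BalArr cls r J) * Nat.card (BalArr cls r (K \ J)) =
          wt cls K * (oddCount J.card * oddCount (K.card - J.card)) := by
      intro J hJ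
      simp only [Finset.mem_erase, Finset.mem_powerset] at hJ
      obtain ⟨hJK, hJ0, hsub⟩ := hJ
      have hs : K \ J ⊂ K := Finset.sdiff_ssubset hsub (Finset.nonempty_iff_ne_empty.2 hJ0)
      rw [ih J (Finset.ssubset_iff_subset_ne.2 ⟨hsub, hJK⟩)
          (fun x y hx hy => hK x y (hsub hx) (hsub hy)),
        ih _ hs (fun x y hx hy => hK x y (hs.1 hx) (hs.1 hy)), ← wt_mul_wt_sdiff hsub,
        Finset.card_sdiff_of_subset hsub]
      ring
    have hm0 : (∅ : Finset Q) ∈ K.powerset := Finset.empty_mem_powerset K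
    have hmK : K ∈ K.powerset.erase ∅ :=
      Finset.mem_erase.2 ⟨hne.ne_empty, Finset.mem_powerset_self K⟩
    rw [← Finset.add_sum_erase _ _ hm0, ← Finset.add_sum_erase _ _ hmK,
      Finset.sum_congr rfl hrest] at h1
    rw [← Finset.add_sum_erase _ _ hm0, ← Finset.add_sum_erase _ _ hmK] at h3
    simp only [h0, Finset.sdiff_self, Finset.sdiff_empty, Finset.card_empty, Nat.sub_zero,
      Nat.sub_self, oddCount] at h1 h3
    have : wt cls K * (1 * oddCount K.card) = wt cls K * oddCount K.card := by ring
    have : wt cls K * (oddCount K.card * 1) = wt cls K * oddCount K.card := by ring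
    omega

end BallotCount

/-! ### Counting sets of odd cycles of pieces -/

section OddSets
variable {X Q : Type} (cls : X → Q)

/-- The classes of the entries of a set of cycles. -/
def cycleClasses (s : Multiset (Cycle X)) : Multiset Q :=
  s.bind fun C => C.toMultiset.map cls

/-- The sets of odd cycles of pieces which contain each class in `K` once. -/
def OddSets (K : Finset Q) : Type :=
  {s : Finset (Cycle X) // (∀ C ∈ s, Odd C.length) ∧ cycleClasses cls s.val = K.val}

theorem cycleClasses_cons (C : Cycle X) (s : Multiset (Cycle X)) :
    cycleClasses cls (C ::ₘ s) = C.toMultiset.map cls + cycleClasses cls s :=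
  Multiset.cons_bind _ _ _

theorem mem_cycleClasses_of_mem {C : Cycle X} {s : Multiset (Cycle X)} (hC : C ∈ s) {x : X}
    (hx : x ∈ C.toMultiset) : cls x ∈ cycleClasses cls s :=
  Multiset.mem_bind.2 ⟨C, hC, Multiset.mem_map_of_mem _ hx⟩

/-- A cycle with distinct classes has a single representative that starts in a prescribed class, so
a cycle through `v` amounts to its entry in `v` and the sequence of the others. -/
theorem eq_of_isRotated_cons {x x' : X} {l l' : List X} (h : (x :: l) ~r (x' :: l'))
    (hn : ((x :: l).map cls).Nodup) (hx : cls x = cls x') : x = x' ∧ l = l' := by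
  obtain ⟨n, hn'⟩ := h
  have hnd : (x :: l).Nodup := List.Nodup.of_map _ hn
  have hxx : x = x' := by
    have hmem : x' ∈ x :: l := by
      rw [← List.mem_rotate (n := n), hn']; simp
    exact List.inj_on_of_nodup_map hn (by simp) hmem hx
  subst hxx
  have h1 : (x :: l)[0]? = (x :: l)[n % (x :: l).length]? := by
    have h2 : ((x :: l).rotate n)[0]? = some x := by rw [hn']; rfl
    rw [List.getElem?_rotate (by simp), Nat.zero_add] at h2
    rw [h2]; rfl
  have hlt : n % (x :: l).length < (x :: l).length := Nat.mod_lt _ (by simp)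
  rw [List.getElem?_eq_getElem (by simp), List.getElem?_eq_getElem hlt] at h1
  have h3 := (hnd.getElem_inj_iff).1 (Option.some_injective _ h1)
  rw [← List.rotate_mod, ← h3, List.rotate_zero] at hn'
  simpa using hn'

variable [DecidableEq Q]

/-- Split off the cycle through a fixed class `v`. Its other entries are an arbitrary arrangement of
an even set `J` of classes, and what remains is a set of odd cycles on the complement; summing over
the size of `J` is `sum_even_choose_oddCount`. -/
theorem card_oddSets (hfin : ∀ q, Finite {x // cls x = q}) (K : Finset Q) :
    Finite (OddSets cls K) ∧ Nat.card (OddSets cls K) = wt cls K * oddCount K.card := by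
  classical
  obtain ⟨n, hn⟩ : ∃ n, K.card = n := ⟨_, rfl⟩
  induction n using Nat.strong_induction_on generalizing K with
  | _ n ih =>
  rcases K.eq_empty_or_nonempty with rfl | ⟨v, hv⟩
  · have : Unique (OddSets cls (∅ : Finset Q)) :=
      { default := ⟨∅, by simp, rfl⟩
        uniq := fun s => by
          obtain ⟨s, h1, h2⟩ := s
          have : s = ∅ := by
            rw [Finset.eq_empty_iff_forall_notMem]
            intro C hC
            obtain ⟨l, rfl⟩ := Quot.exists_rep C
            have h3 : Odd l.length := h1 _ hC
            obtain ⟨x, hx⟩ := List.exists_mem_of_length_pos h3.pos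
            have := mem_cycleClasses_of_mem cls (C := (l : Cycle X)) (s := s.val) hC (x := x)
              (Multiset.mem_coe.2 hx)
            rw [h2] at this
            simp at this
          subst this; rfl }
    exact ⟨inferInstance, by simp [wt, oddCount]⟩
  have hcardv : (K.erase v).card + 1 = K.card := Finset.card_erase_add_one hv
  let S : Finset (Finset Q) := (K.erase v).powerset.filter (fun J => Even J.card)
  have hS : ∀ J : S, J.1 ⊆ K.erase v ∧ Even J.1.card := fun J => by
    have h := Finset.mem_filter.1 J.2
    exact ⟨Finset.mem_powerset.1 h.1, h.2⟩
  -- the cycle through the class `v` is chosen first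
  have key : ∀ (J : S) (x : {x // cls x = v}) (l : Arr cls J.1)
      (s : OddSets cls (K.erase v \ J.1)), ((x.1 :: l.1 : List X) : Cycle X) ∉ s.1 := by
    intro J x l s hmem
    have h1 := mem_cycleClasses_of_mem cls (C := ((x.1 :: l.1 : List X) : Cycle X))
      (s := s.1.val) hmem (x := x.1)
      (Multiset.mem_coe.2 (by simp))
    rw [s.2.2, x.2] at h1
    have h2 : v ∈ K.erase v \ J.1 := h1
    simp at h2
  let f : (Σ J : S, {x // cls x = v} × Arr cls J.1 × OddSets cls (K.erase v \ J.1)) →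
      OddSets cls K := fun p =>
    ⟨Finset.cons _ p.2.2.2.1 (key p.1 p.2.1 p.2.2.1 p.2.2.2), by
      obtain ⟨J, ⟨x, hx⟩, ⟨l, hl⟩, ⟨s, h1, h2⟩⟩ := p
      obtain ⟨hJ, hJe⟩ := hS J
      refine ⟨?_, ?_⟩
      · intro C hC
        rcases Finset.mem_cons.1 hC with rfl | hC
        · have : l.length = J.1.card := by
            have := congrArg Multiset.card hl
            simpa using this
          rw [Cycle.length_coe, List.length_cons, this]
          exact hJe.add_one
        · exact h1 C hC
      · show cycleClasses cls (((x :: l : List X) : Cycle X) ::ₘ s.val) = K.val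
        have hx1 : cls x = v := hx
        have hl1 : ((l.map cls : List Q) : Multiset Q) = J.1.val := hl
        rw [cycleClasses_cons, h2, Cycle.coe_toMultiset, Multiset.map_coe,
          List.map_cons, ← Multiset.cons_coe, hl1, hx1, Finset.sdiff_val, Multiset.cons_add,
          add_comm, Multiset.sub_add_cancel (Finset.val_le_iff.2 hJ), Finset.erase_val,
          Multiset.cons_erase hv]⟩
  have hf : Function.Bijective f := by
    constructor
    · rintro ⟨⟨J, hJ⟩, ⟨x, hx⟩, ⟨l, hl⟩, ⟨s, h1, h2⟩⟩ ⟨⟨J', hJ'⟩, ⟨x', hx'⟩, ⟨l', hl'⟩, ⟨s', h1', h2'⟩⟩ h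
      have k1 := key ⟨J, hJ⟩ ⟨x, hx⟩ ⟨l, hl⟩ ⟨s, h1, h2⟩
      have k2 := key ⟨J', hJ'⟩ ⟨x', hx'⟩ ⟨l', hl'⟩ ⟨s', h1', h2'⟩
      have he : Finset.cons _ s k1 = Finset.cons _ s' k2 := congrArg Subtype.val h
      have hx1 : cls x = v := hx
      have hx1' : cls x' = v := hx'
      have hC : ((x :: l : List X) : Cycle X) = ((x' :: l' : List X) : Cycle X) := by
        have hm : ((x :: l : List X) : Cycle X) ∈ Finset.cons _ s' k2 := by
          rw [← he]; exact Finset.mem_cons_self _ _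
        rcases Finset.mem_cons.1 hm with hm | hm
        · exact hm
        · exfalso
          have h3 := mem_cycleClasses_of_mem cls (C := ((x :: l : List X) : Cycle X))
            (s := s'.val) hm (x := x)
            (Multiset.mem_coe.2 (by simp))
          rw [h2', hx1] at h3
          have h4 : v ∈ K.erase v \ J' := h3
          simp at h4
      have hnd : ((x :: l).map cls).Nodup := by
        rw [List.map_cons, List.nodup_cons]
        have hlJ : ((l.map cls : List Q) : Multiset Q) = J.val := hl
        constructor
        · rw [hx1, ← Multiset.mem_coe, hlJ]
          intro h3
          have h4 := (hS ⟨J, hJ⟩).1 h3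
          simp at h4
        · rw [← Multiset.coe_nodup, hlJ]; exact J.nodup
      obtain ⟨rfl, rfl⟩ := eq_of_isRotated_cons cls (Cycle.coe_eq_coe.1 hC) hnd
        (hx1.trans hx1'.symm)
      obtain rfl : J = J' := Finset.val_injective (hl.symm.trans hl')
      obtain rfl : s = s' := by
        have h5 := congrArg Finset.val he
        rw [Finset.cons_val, Finset.cons_val, Multiset.cons_inj_right] at h5
        exact Finset.val_injective h5
      rfl
    · rintro ⟨s, h1, h2⟩
      have hv' : v ∈ cycleClasses cls s.val := by rw [h2]; exact hv
      obtain ⟨C, hC, hvC⟩ := Multiset.mem_bind.1 hv'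
      obtain ⟨x, hx, hxv⟩ := Multiset.mem_map.1 hvC
      obtain ⟨l0, rfl⟩ := Quot.exists_rep C
      have hx0 : x ∈ l0 := Multiset.mem_coe.1 hx
      obtain ⟨a, b, rfl⟩ := List.append_of_mem hx0
      obtain ⟨l, hl⟩ : ∃ l, l = b ++ a := ⟨_, rfl⟩
      have hC2 : (Quot.mk _ (a ++ x :: b) : Cycle X) = ((x :: l : List X) : Cycle X) := by
        rw [hl, ← List.cons_append]
        exact Cycle.coe_eq_coe.2 List.isRotated_append
      rw [hC2] at hC
      have hC' : ((x :: l : List X) : Cycle X) ∈ s := hC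
      have hs : s.val = ((x :: l : List X) : Cycle X) ::ₘ
          (s.erase ((x :: l : List X) : Cycle X)).val := by
        rw [Finset.erase_val, Multiset.cons_erase hC]
      have h3 := h2
      rw [hs, cycleClasses_cons, Cycle.coe_toMultiset, Multiset.map_coe, List.map_cons,
        ← Multiset.cons_coe, hxv, Multiset.cons_add] at h3
      have h4 : (K.erase v).val = ((l.map cls : List Q) : Multiset Q) +
          cycleClasses cls (s.erase ((x :: l : List X) : Cycle X)).val := by
        rw [Finset.erase_val, ← h3, Multiset.erase_cons_head]
      have hle : ((l.map cls : List Q) : Multiset Q) ≤ (K.erase v).val := by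
        rw [h4]; exact Multiset.le_add_right _ _
      let J : Finset Q := ⟨((l.map cls : List Q) : Multiset Q),
        Multiset.nodup_of_le hle (K.erase v).nodup⟩
      have hJ : J ∈ S := by
        refine Finset.mem_filter.2 ⟨Finset.mem_powerset.2 (Finset.val_le_iff.1 hle), ?_⟩
        have h5 := h1 _ hC'
        rw [Cycle.length_coe, List.length_cons] at h5
        have h6 : J.card = l.length := by simp [J, Finset.card]
        rw [h6, ← Nat.not_odd_iff_even]
        intro h7
        exact Nat.not_even_iff_odd.2 h5 h7.add_one
      have hrest : cycleClasses cls (s.erase ((x :: l : List X) : Cycle X)).val =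
          (K.erase v).val - ((l.map cls : List Q) : Multiset Q) := by
        rw [h4, add_tsub_cancel_left]
      refine ⟨⟨⟨J, hJ⟩, ⟨x, hxv⟩, ⟨l, rfl⟩, ⟨s.erase ((x :: l : List X) : Cycle X),
        fun C hC => h1 C (Finset.mem_of_mem_erase hC), ?_⟩⟩, Subtype.ext ?_⟩
      · rw [Finset.sdiff_val]
        exact hrest
      · show Finset.cons ((x :: l : List X) : Cycle X) (s.erase ((x :: l : List X) : Cycle X))
          (Finset.notMem_erase _ _) = s
        rw [Finset.cons_eq_insert, Finset.insert_erase hC']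
  have e := Equiv.ofBijective f hf
  have hlt : ∀ J : S, (K.erase v \ J.1).card < n := fun J => by
    have := Finset.card_le_card (Finset.sdiff_subset (s := K.erase v) (t := J.1))
    omega
  have hfin' : ∀ J : S, Finite ({x // cls x = v} × Arr cls J.1 × OddSets cls (K.erase v \ J.1)) :=
    fun J => by
      have h1 := (card_arr cls hfin J.1).1
      have h2 := (ih _ (hlt J) _ rfl).1
      infer_instance
  refine ⟨Finite.of_equiv _ e, ?_⟩
  rw [← Nat.card_congr e, Nat.card_sigma]
  have hterm : ∀ J : S, Nat.card ({x // cls x = v} × Arr cls J.1 ×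
      OddSets cls (K.erase v \ J.1)) =
      wt cls K * (J.1.card.factorial * oddCount ((K.erase v).card - J.1.card)) := by
    intro J
    obtain ⟨hJ, _⟩ := hS J
    rw [Nat.card_prod, Nat.card_prod, (card_arr cls hfin J.1).2, (ih _ (hlt J) _ rfl).2,
      Finset.card_sdiff_of_subset hJ]
    have h1 : wt cls K = Nat.card {x // cls x = v} * (wt cls J.1 * wt cls (K.erase v \ J.1)) := by
      rw [wt_mul_wt_sdiff hJ, wt, wt, Finset.mul_prod_erase K (fun q => Nat.card {x // cls x = q}) hv]
    rw [h1]; ring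
  rw [Finset.sum_congr rfl (fun J _ => hterm J),
    Finset.sum_coe_sort S
      (fun J => wt cls K * (J.card.factorial * oddCount ((K.erase v).card - J.card))),
    Finset.sum_filter]
  have h1 := Finset.sum_powerset_apply_card (fun j => if Even j then
    wt cls K * (j.factorial * oddCount ((K.erase v).card - j)) else 0) (x := K.erase v)
  rw [h1, ← hcardv, ← sum_even_choose_oddCount, Finset.mul_sum]
  refine Finset.sum_congr rfl fun j _ => ?_
  split
  · rw [smul_eq_mul]; ring
  · simp

end OddSets

/-! ### Paths as ballot sequences of clusters -/

section CutWord
variable {α : Type} [LinearOrder α]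

open Classical in
/-- The height difference between two successive clusters. -/
noncomputable def clusterRise (u v : List α) : ℤ :=
  if ∃ a ∈ u.getLast?, ∃ b ∈ v.head?, a < b then 1 else -1

theorem clusterRise_eq (u v : List α) (hu : u ≠ []) (hv : v ≠ []) :
    clusterRise u v = if u.getLast hu < v.head hv then 1 else -1 := by
  unfold clusterRise
  rw [List.getLast?_eq_some_getLast hu, List.head?_eq_some_head hv]
  simp

/-- The default value `-1`, also taken for empty words and for equal letters, makes every rise `±1`,
as the counting lemmas ask of all pairs. -/
theorem clusterRise_eq_or (u v : List α) : clusterRise u v = 1 ∨ clusterRise u v = -1 := by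
  unfold clusterRise; split <;> simp

/-- The step between two successive clusters. -/
noncomputable def clusterStep (u v : List α) : Step :=
  if clusterRise u v = 1 then Step.up else Step.down

theorem dy_clusterStep (u v : List α) : (clusterStep u v).dy = clusterRise u v := by
  unfold clusterStep
  rcases clusterRise_eq_or u v with h | h <;> rw [h] <;> rfl

theorem clusterStep_ne_flat (u v : List α) : clusterStep u v ≠ Step.flat := by
  unfold clusterStep; split <;> simp

theorem clusterStep_cons_left (a : α) (u v : List α) (hu : u ≠ []) :
    clusterStep (a :: u) v = clusterStep u v := by
  unfold clusterStep clusterRise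
  rw [List.getLast?_cons_of_ne_nil hu]

/-- The path of a sequence of clusters. -/
noncomputable def clusterPath : List (List α) → List Step
  | [] => []
  | [c] => List.replicate (c.length - 1) Step.flat
  | c :: d :: cs => List.replicate (c.length - 1) Step.flat ++ clusterStep c d :: clusterPath (d :: cs)

/-- The letters ascend along the up steps and descend along the down steps. -/
def Compat : List α → List Step → Prop
  | a :: b :: w, s :: p => (s = Step.up → a < b) ∧ (s = Step.down → b < a) ∧ Compat (b :: w) p
  | _, _ => True

theorem compat_iff (w : List α) (p : List Step) :
    Compat w p ↔ ∀ (i : ℕ) (h : i + 1 < w.length), (p[i]? = some Step.up → w[i] < w[i + 1]) ∧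
      (p[i]? = some Step.down → w[i + 1] < w[i]) := by
  induction w generalizing p with
  | nil => simp [Compat]
  | cons a w ih =>
    rcases w with _ | ⟨b, w⟩
    · simp [Compat]
    rcases p with _ | ⟨s, p⟩
    · simp [Compat]
    unfold Compat
    rw [ih]
    constructor
    · rintro ⟨h1, h2, h3⟩ i hi
      cases i with
      | zero => simpa using ⟨h1, h2⟩
      | succ i => exact h3 i (by simpa using hi)
    · intro h
      refine ⟨?_, ?_, fun i hi => ?_⟩
      · have := (h 0 (by simp)).1; simpa using this
      · have := (h 0 (by simp)).2; simpa using this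
      · exact h (i + 1) (by simpa using hi)

theorem clusterPath_cons_cons (a b : α) (c : List α) (cs : List (List α)) :
    clusterPath ((a :: b :: c) :: cs) = Step.flat :: clusterPath ((b :: c) :: cs) := by
  cases cs with
  | nil => simp [clusterPath, List.replicate_succ]
  | cons d cs =>
    rw [clusterPath, clusterPath, clusterStep_cons_left _ _ _ (by simp)]
    simp [List.replicate_succ]

/-- Nothing is lost by cutting: the steps inside a cluster are horizontal, and a step between two
clusters is determined by the comparison of the letters that it joins. -/
theorem cutWord_spec (w : List α) (p : List Step) (hl : p.length = w.length - 1)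
    (hc : Compat w p) :
    (cutWord w p).flatten = w ∧ [] ∉ cutWord w p ∧ clusterPath (cutWord w p) = p := by
  induction w generalizing p with
  | nil =>
    have : p = [] := List.length_eq_zero_iff.1 hl
    subst this
    simp [cutWord, clusterPath]
  | cons a w ih =>
    rcases w with _ | ⟨b, w⟩
    · have : p = [] := List.length_eq_zero_iff.1 hl
      subst this
      simp [cutWord, clusterPath]
    rcases p with _ | ⟨s, p⟩
    · simp at hl
    obtain ⟨h1, h2, h3⟩ := hc
    obtain ⟨i1, i2, i3⟩ := ih p (by simpa using hl) h3
    obtain ⟨c, cs, hcs⟩ : ∃ c cs, cutWord (b :: w) p = (b :: c) :: cs := by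
      cases hcut : cutWord (b :: w) p with
      | nil => rw [hcut] at i1; simp at i1
      | cons d cs =>
        cases d with
        | nil => rw [hcut] at i2; simp at i2
        | cons b' c =>
          rw [hcut] at i1
          simp only [List.flatten_cons, List.cons_append, List.cons.injEq] at i1
          exact ⟨c, cs, by rw [i1.1]⟩
    cases s with
    | flat =>
      have e : cutWord (a :: b :: w) (Step.flat :: p) = (a :: b :: c) :: cs := by
        rw [cutWord, hcs]
      rw [hcs] at i1 i2 i3
      rw [e]
      refine ⟨?_, ?_, ?_⟩
      · rw [List.flatten_cons] at i1 ⊢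
        rw [List.cons_append, i1]
      · simpa using i2
      · rw [clusterPath_cons_cons, i3]
    | up =>
      have e : cutWord (a :: b :: w) (Step.up :: p) = [a] :: cutWord (b :: w) p := by
        rw [cutWord]; simp
      rw [e, hcs]
      rw [hcs] at i1 i2 i3
      refine ⟨?_, ?_, ?_⟩
      · rw [List.flatten_cons, i1]; rfl
      · simpa using i2
      · rw [clusterPath, i3]
        simp [clusterStep, clusterRise, h1 rfl]
    | down =>
      have e : cutWord (a :: b :: w) (Step.down :: p) = [a] :: cutWord (b :: w) p := by
        rw [cutWord]; simp
      rw [e, hcs]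
      rw [hcs] at i1 i2 i3
      refine ⟨?_, ?_, ?_⟩
      · rw [List.flatten_cons, i1]; rfl
      · simpa using i2
      · rw [clusterPath, i3]
        have := h2 rfl
        simp [clusterStep, clusterRise, this.le]

omit [LinearOrder α] in
theorem cutWord_append (c w : List α) (s : Step) (p : List Step) (hc : c ≠ [])
    (hs : s ≠ Step.flat) :
    cutWord (c ++ w) (List.replicate (c.length - 1) Step.flat ++ s :: p) = c :: cutWord w p := by
  induction c with
  | nil => exact absurd rfl hc
  | cons a c ih =>
    cases c with
    | nil => cases s <;> simp_all [cutWord]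
    | cons b c =>
      have ih := ih (by simp)
      simp only [List.length_cons, Nat.add_sub_cancel, List.replicate_succ, List.cons_append] at ih ⊢
      rw [cutWord, ih]

omit [LinearOrder α] in
theorem cutWord_replicate (c : List α) (hc : c ≠ []) :
    cutWord c (List.replicate (c.length - 1) Step.flat) = [c] := by
  induction c with
  | nil => exact absurd rfl hc
  | cons a c ih =>
    cases c with
    | nil => simp [cutWord]
    | cons b c =>
      have ih := ih (by simp)
      simp only [List.length_cons, Nat.add_sub_cancel, List.replicate_succ] at ih ⊢
      rw [cutWord, ih]

theorem cutWord_clusterPath (cs : List (List α)) (hcs : [] ∉ cs) :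
    cutWord cs.flatten (clusterPath cs) = cs := by
  induction cs with
  | nil => rfl
  | cons c cs ih =>
    simp only [List.mem_cons, not_or] at hcs
    have ih := ih hcs.2
    cases cs with
    | nil =>
      rw [clusterPath]
      simpa using cutWord_replicate c (Ne.symm hcs.1)
    | cons d cs =>
      rw [clusterPath, List.flatten_cons,
        cutWord_append _ _ _ _ (Ne.symm hcs.1) (clusterStep_ne_flat c d), ih]

theorem length_clusterPath (cs : List (List α)) (hcs : [] ∉ cs) :
    (clusterPath cs).length = cs.flatten.length - 1 := by
  induction cs with
  | nil => rfl
  | cons c cs ih =>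
    simp only [List.mem_cons, not_or] at hcs
    have ih := ih hcs.2
    have hc := List.length_pos_iff.2 (Ne.symm hcs.1)
    cases cs with
    | nil => simp [clusterPath]
    | cons d cs =>
      simp only [List.mem_cons, not_or] at hcs
      have hd := List.length_pos_iff.2 (Ne.symm hcs.2.1)
      rw [clusterPath, List.length_append, List.length_replicate, List.length_cons, ih]
      simp only [List.flatten_cons, List.length_append]
      omega

theorem compat_append (c w : List α) (s : Step) (p : List Step) (hc : c ≠ []) (hw : w ≠ [])
    (h1 : s = Step.up → c.getLast hc < w.head hw) (h2 : s = Step.down → w.head hw < c.getLast hc)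
    (h3 : Compat w p) :
    Compat (c ++ w) (List.replicate (c.length - 1) Step.flat ++ s :: p) := by
  induction c with
  | nil => exact absurd rfl hc
  | cons a c ih =>
    cases c with
    | nil =>
      obtain ⟨b, w, rfl⟩ := List.exists_cons_of_ne_nil hw
      exact ⟨h1, h2, h3⟩
    | cons b c =>
      have ih := ih (by simp) (by simpa using h1) (by simpa using h2)
      simp only [List.length_cons, Nat.add_sub_cancel, List.replicate_succ, List.cons_append] at ih ⊢
      exact ⟨by simp, by simp, ih⟩

theorem compat_replicate (c : List α) (k : ℕ) : Compat c (List.replicate k Step.flat) := by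
  induction c generalizing k with
  | nil => simp [Compat]
  | cons a c ih =>
    cases c with
    | nil => simp [Compat]
    | cons b c =>
      cases k with
      | zero => simp [Compat]
      | succ k => exact ⟨by simp, by simp, ih k⟩

/-- Distinctness of the letters is needed for the down steps, since `clusterStep` also descends
between equal letters. -/
theorem compat_clusterPath (cs : List (List α)) (hcs : [] ∉ cs) (hn : cs.flatten.Nodup) :
    Compat cs.flatten (clusterPath cs) := by
  induction cs with
  | nil => simp [Compat]
  | cons c cs ih =>
    simp only [List.mem_cons, not_or] at hcs
    rw [List.flatten_cons, List.nodup_append] at hn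
    have ih := ih hcs.2 hn.2.1
    have hc := Ne.symm hcs.1
    cases cs with
    | nil =>
      rw [clusterPath]
      simpa using compat_replicate c _
    | cons d cs =>
      simp only [List.mem_cons, not_or] at hcs
      have hd := Ne.symm hcs.2.1
      have hw : (d :: cs).flatten ≠ [] := by simp [hd]
      have hhead : (d :: cs).flatten.head hw = d.head hd := by
        simp only [List.flatten_cons]
        rw [List.head_append_of_ne_nil hd]
      rw [clusterPath, List.flatten_cons]
      apply compat_append _ _ _ _ hc hw _ _ ih
      · intro h
        unfold clusterStep at h
        split at h
        · rename_i h1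
          rw [clusterRise_eq _ _ hc hd] at h1
          rw [hhead]
          by_contra h2
          rw [if_neg h2] at h1
          exact absurd h1 (by decide)
        · exact absurd h (by simp)
      · intro h
        unfold clusterStep at h
        split at h
        · exact absurd h (by simp)
        · rename_i h1
          rw [clusterRise_eq _ _ hc hd] at h1
          rw [hhead]
          have h2 : ¬ c.getLast hc < d.head hd := fun h2 => h1 (by rw [if_pos h2])
          refine lt_of_le_of_ne (not_lt.1 h2) (Ne.symm ?_)
          exact hn.2.2 _ (List.getLast_mem hc) _ (by
            rw [List.flatten_cons]; exact List.mem_append_left _ (List.head_mem hd))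

theorem nonneg_cons (h : ℤ) (s : Step) (p : List Step) :
    (∀ k, 0 ≤ h + height ((s :: p).take k)) ↔ 0 ≤ h ∧ ∀ k, 0 ≤ h + s.dy + height (p.take k) := by
  constructor
  · intro H
    refine ⟨by simpa [height] using H 0, fun k => ?_⟩
    have := H (k + 1)
    simp only [height, List.take_succ_cons, List.map_cons, List.sum_cons] at this ⊢
    linarith
  · rintro ⟨h1, h2⟩ k
    cases k with
    | zero => simpa [height] using h1
    | succ k =>
      have := h2 k
      simp only [height, List.take_succ_cons, List.map_cons, List.sum_cons] at this ⊢
      linarith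

theorem nonneg_replicate (h : ℤ) (n : ℕ) (p : List Step) :
    (∀ k, 0 ≤ h + height ((List.replicate n Step.flat ++ p).take k)) ↔
      ∀ k, 0 ≤ h + height (p.take k) := by
  induction n with
  | zero => simp
  | succ n ih =>
    rw [List.replicate_succ, List.cons_append, nonneg_cons]
    simp only [Step.dy, add_zero, ih]
    exact ⟨fun h => h.2, fun H => ⟨by simpa [height] using H 0, H⟩⟩

/-- Horizontal steps keep the height, so only the heights of whole clusters matter. The starting
height `h` is arbitrary for the sake of the induction. -/
theorem nonneg_clusterPath (h : ℤ) (cs : List (List α)) :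
    (∀ k, 0 ≤ h + height ((clusterPath cs).take k)) ↔
      ∀ u, u <+: cs → 0 ≤ h + pathHt clusterRise u := by
  induction cs generalizing h with
  | nil =>
    simp only [clusterPath, List.take_nil, List.prefix_nil, forall_eq]
    simp [height]
  | cons c cs ih =>
    cases cs with
    | nil =>
      have e := nonneg_replicate h (c.length - 1) []
      rw [List.append_nil] at e
      rw [clusterPath, e]
      constructor
      · intro H u hu
        have h0 : 0 ≤ h := by simpa [height] using H 0
        rcases List.prefix_concat_iff.1 (show u <+: [] ++ [c] from hu) with rfl | hu
        · simpa using h0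
        · rw [List.prefix_nil.1 hu]; simpa using h0
      · intro H k
        simpa [height] using H [] (by simp)
    | cons d cs =>
      rw [clusterPath, nonneg_replicate, nonneg_cons, dy_clusterStep, ih]
      constructor
      · rintro ⟨h1, h2⟩ u hu
        rcases u with _ | ⟨c', u⟩
        · simpa using h1
        obtain ⟨rfl, hu'⟩ := List.cons_prefix_cons.1 hu
        by_cases hu0 : u = []
        · subst hu0; simpa using h1
        · rw [pathHt_cons _ _ _ hu0, hu'.head hu0]
          have := h2 u hu'
          simp only [List.head_cons]
          linarith
      · intro H
        refine ⟨by simpa using H [] (by simp), fun u hu => ?_⟩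
        by_cases hu0 : u = []
        · subst hu0
          have := H [c, d] (by simp)
          simpa [pathHt_cons_cons] using this
        · have := H (c :: u) (List.cons_prefix_cons.2 ⟨rfl, hu⟩)
          rw [pathHt_cons _ _ _ hu0, hu.head hu0] at this
          simp only [List.head_cons] at this
          linarith

end CutWord

section Clusters
variable {n : ℕ}

theorem WellLabelledPath.clusters_spec (x : WellLabelledPath n) :
    x.clusters.flatten = List.ofFn x.label ∧ [] ∉ x.clusters ∧ clusterPath x.clusters = x.path := by
  apply cutWord_spec
  · rw [x.length_path, List.length_ofFn]
  · rw [compat_iff]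
    intro i hi
    have hi' : i + 1 < n := by simpa using hi
    simp only [List.getElem_ofFn]
    exact ⟨x.label_up i hi', x.label_down i hi'⟩

theorem WellLabelledPath.ballot_clusters (x : WellLabelledPath n) :
    Ballot clusterRise x.clusters := by
  have h := (nonneg_clusterPath 0 x.clusters).1 (by
    rw [x.clusters_spec.2.2]
    simpa using x.nonneg)
  simpa [Ballot] using h

theorem WellLabelledPath.clusters_injective :
    Function.Injective (WellLabelledPath.clusters (n := n)) := by
  intro x y h
  obtain ⟨h1, _, h2⟩ := x.clusters_spec
  obtain ⟨h3, _, h4⟩ := y.clusters_spec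
  rw [h] at h1 h2
  apply WellLabelledPath.ext
  · rw [← h2, h4]
  · exact Equiv.coe_fn_injective (List.ofFn_injective (h1.symm.trans h3))

theorem exists_clusters_eq (cs : List (List (Fin n))) (h0 : [] ∉ cs)
    (hp : cs.flatten.Perm (List.finRange n)) (hb : Ballot clusterRise cs) :
    ∃ x : WellLabelledPath n, x.clusters = cs := by
  obtain ⟨π, hπ⟩ := exists_perm_ofFn cs.flatten hp
  have hc := (compat_iff _ _).1
    (compat_clusterPath cs h0 (hp.nodup_iff.2 (List.nodup_finRange n)))
  have hc' : ∀ (i : ℕ) (h : i + 1 < n),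
      ((clusterPath cs)[i]? = some Step.up → π ⟨i, Nat.lt_of_succ_lt h⟩ < π ⟨i + 1, h⟩) ∧
      ((clusterPath cs)[i]? = some Step.down → π ⟨i + 1, h⟩ < π ⟨i, Nat.lt_of_succ_lt h⟩) := by
    intro i h
    rw [← hπ] at hc
    have := hc i (by simpa using h)
    simp only [List.getElem_ofFn] at this
    exact this
  refine ⟨⟨clusterPath cs, ?_, ?_, π, fun i h => (hc' i h).1, fun i h => (hc' i h).2⟩, ?_⟩
  · rw [length_clusterPath cs h0, ← hπ, List.length_ofFn]
  · have := (nonneg_clusterPath 0 cs).2 (by simpa [Ballot] using hb)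
    simpa using this
  · show cutWord (List.ofFn π) (clusterPath cs) = cs
    rw [hπ, cutWord_clusterPath cs h0]

end Clusters

/-! ### Words up to reversal -/

section RevClass
variable {n : ℕ}

/-- A word up to reversal. -/
abbrev revClass (c : List (Fin n)) : Sym2 (List (Fin n)) := s(c, c.reverse)

theorem revClass_eq_iff {c d : List (Fin n)} : revClass c = revClass d ↔ c = d ∨ c = d.reverse := by
  constructor
  · intro h
    rcases Sym2.eq_iff.1 h with ⟨h, _⟩ | ⟨h, _⟩
    · exact Or.inl h
    · exact Or.inr h
  · rintro (rfl | rfl)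
    · rfl
    · rw [revClass, revClass, List.reverse_reverse]
      exact Sym2.eq_swap

theorem revClass_reverse (c : List (Fin n)) : revClass c.reverse = revClass c :=
  revClass_eq_iff.2 (Or.inr rfl)

theorem finite_revClass_fiber (q : Sym2 (List (Fin n))) :
    Finite {c : List (Fin n) // revClass c = q} := by
  by_cases h : ∃ d, revClass d = q
  · obtain ⟨d, rfl⟩ := h
    refine Set.Finite.subset (Set.toFinite {d, d.reverse}) fun c hc => ?_
    simpa using revClass_eq_iff.1 hc
  · have : IsEmpty {c : List (Fin n) // revClass c = q} := ⟨fun c => h ⟨c.1, c.2⟩⟩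
    infer_instance

/-- The letters of a word, as a function of its class. -/
def classLetters : Sym2 (List (Fin n)) → Multiset (Fin n) :=
  Sym2.lift ⟨fun a b => (a : Multiset (Fin n)) ∪ (b : Multiset (Fin n)),
    fun _ _ => Multiset.union_comm _ _⟩

/-- A word and its reversal have the same letters, so the union (the maximum of multiplicities, not
the sum) gives them once. -/
theorem classLetters_revClass (c : List (Fin n)) :
    classLetters (revClass c) = (c : Multiset (Fin n)) := by
  show (c : Multiset (Fin n)) ∪ (c.reverse : Multiset (Fin n)) = _
  rw [Multiset.coe_reverse, ← Multiset.sup_eq_union, sup_idem]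

theorem bind_classLetters (S : Multiset (List (Fin n))) :
    (S.map revClass).bind classLetters = S.bind fun c => (c : Multiset (Fin n)) := by
  rw [Multiset.bind_map]
  exact Multiset.bind_congr fun c _ => classLetters_revClass c

theorem revClass_nil_mem {S : Multiset (List (Fin n))} :
    revClass [] ∈ S.map revClass ↔ [] ∈ S := by
  rw [Multiset.mem_map]
  constructor
  · rintro ⟨c, hc, h⟩
    rcases revClass_eq_iff.1 h with rfl | rfl <;> exact hc
  · exact fun h => ⟨_, h, rfl⟩

/-- The classes of the members of some set of nonempty words in which each letter occurs once. -/
def IsClusterClasses (K : Multiset (Sym2 (List (Fin n)))) : Prop :=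
  K.bind classLetters = (Finset.univ : Finset (Fin n)).val ∧ revClass [] ∉ K

theorem isClusterClasses_map {S : Multiset (List (Fin n))} :
    IsClusterClasses (S.map revClass) ↔
      (S.bind fun c => (c : Multiset (Fin n))) = (Finset.univ : Finset (Fin n)).val ∧ [] ∉ S := by
  rw [IsClusterClasses, bind_classLetters, revClass_nil_mem]

theorem IsClusterClasses.disjoint {K : Multiset (Sym2 (List (Fin n)))} (hK : IsClusterClasses K)
    {a b : Sym2 (List (Fin n))} {t : Multiset (Sym2 (List (Fin n)))} (h : K = a ::ₘ b ::ₘ t) :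
    Disjoint (classLetters a) (classLetters b) := by
  have h1 : (K.bind classLetters).Nodup := by
    rw [hK.1]; exact Finset.univ.nodup
  rw [h, Multiset.cons_bind, Multiset.cons_bind, ← add_assoc] at h1
  exact (Multiset.nodup_add.1 (Multiset.nodup_add.1 h1).1).2.2

/-- A class occurring twice would have letters disjoint from themselves, hence be the class of the
empty word. -/
theorem IsClusterClasses.nodup {S : Multiset (List (Fin n))}
    (hK : IsClusterClasses (S.map revClass)) : (S.map revClass).Nodup := by
  rw [Multiset.nodup_iff_ne_cons_cons]
  intro a t h
  have h1 := hK.disjoint h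
  have ha : a ∈ S.map revClass := by rw [h]; simp
  obtain ⟨c, hc, rfl⟩ := Multiset.mem_map.1 ha
  rw [classLetters_revClass] at h1
  have h2 : c = [] := by simpa using h1
  exact (isClusterClasses_map.1 hK).2 (h2 ▸ hc)

/-- Words of different classes share no letter, so the two letters at the junction differ; reversing
the pair compares the same two letters in the other order. -/
theorem IsClusterClasses.antiOn {K : Finset (Sym2 (List (Fin n)))} (hK : IsClusterClasses K.val) :
    AntiOn revClass clusterRise List.reverse K := by
  intro x y hx hy hxy
  obtain ⟨t, ht⟩ := Multiset.exists_cons_of_mem (Finset.mem_def.1 hx)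
  have hy' : revClass y ∈ t := by
    have : revClass y ∈ revClass x ::ₘ t := ht ▸ Finset.mem_def.1 hy
    exact (Multiset.mem_cons.1 this).resolve_left (Ne.symm hxy)
  obtain ⟨t', rfl⟩ := Multiset.exists_cons_of_mem hy'
  have hd := hK.disjoint ht
  rw [classLetters_revClass, classLetters_revClass] at hd
  have hx0 : x ≠ [] := by
    rintro rfl; exact hK.2 hx
  have hy0 : y ≠ [] := by
    rintro rfl; exact hK.2 hy
  rw [clusterRise_eq _ _ (by simpa using hy0) (by simpa using hx0), clusterRise_eq _ _ hx0 hy0]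
  simp only [List.getLast_reverse, List.head_reverse]
  have hne : x.getLast hx0 ≠ y.head hy0 := fun h =>
    Multiset.disjoint_left.1 hd (Multiset.mem_coe.2 (List.getLast_mem hx0))
      (by rw [h]; exact Multiset.mem_coe.2 (List.head_mem hy0))
  rcases lt_or_gt_of_ne hne with h | h
  · rw [if_pos h, if_neg h.not_gt]
  · rw [if_pos h, if_neg h.not_gt]; rfl

end RevClass

/-! ### The fibres over a set of cluster classes -/

section Fibers
variable {n : ℕ}

theorem mem_toMultiset {α : Type*} {C : Cycle α} {a : α} : a ∈ C.toMultiset ↔ a ∈ C := by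
  induction C using Quotient.inductionOn'
  rfl

theorem coe_flatten {α : Type*} (cs : List (List α)) :
    (cs.flatten : Multiset α) = (cs : Multiset (List α)).bind fun c => (c : Multiset α) := by
  rw [← List.flatMap_id, Multiset.coe_bind]
  rfl

theorem coe_ofFn_perm (π : Equiv.Perm (Fin n)) :
    (List.ofFn π : Multiset (Fin n)) = (Finset.univ : Finset (Fin n)).val := by
  rw [show (Finset.univ : Finset (Fin n)).val = (List.finRange n : Multiset (Fin n)) from rfl,
    Multiset.coe_eq_coe, List.ofFn_eq_map]
  exact Equiv.Perm.map_finRange_perm π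

theorem WellLabelledPath.isClusterClasses (x : WellLabelledPath n) :
    IsClusterClasses ((x.clusters : Multiset (List (Fin n))).map revClass) := by
  obtain ⟨h1, h2, _⟩ := x.clusters_spec
  rw [isClusterClasses_map, ← coe_flatten, h1]
  exact ⟨coe_ofFn_perm _, h2⟩

theorem OddClusterPerm.isClusterClasses (y : OddClusterPerm n) :
    IsClusterClasses ((y.cycles.val.bind Cycle.toMultiset).map revClass) := by
  rw [isClusterClasses_map, Multiset.bind_assoc]
  refine ⟨y.letters, fun h => ?_⟩
  obtain ⟨C, hC, h⟩ := Multiset.mem_bind.1 h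
  exact y.ne_nil C hC [] (mem_toMultiset.1 h) rfl

/-- The classes of the clusters of a well-labelled positive path. -/
def WellLabelledPath.classes (x : WellLabelledPath n) : Finset (Sym2 (List (Fin n))) :=
  ⟨_, x.isClusterClasses.nodup⟩

/-- The classes of the clusters of an odd order cluster-permutation. -/
def OddClusterPerm.classes (y : OddClusterPerm n) : Finset (Sym2 (List (Fin n))) :=
  ⟨_, y.isClusterClasses.nodup⟩

theorem OddClusterPerm.classes_val (y : OddClusterPerm n) :
    y.classes.val = cycleClasses revClass y.cycles.val :=
  Multiset.map_bind _ _ _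

theorem WellLabelledPath.revClass_mem (x : WellLabelledPath n) (c : List (Fin n)) :
    revClass c ∈ x.classes ↔ x.HasCluster c ∨ x.HasCluster c.reverse := by
  have : revClass c ∈ x.classes ↔
      revClass c ∈ (x.clusters : Multiset (List (Fin n))).map revClass := Iff.rfl
  rw [this, Multiset.mem_map]
  simp only [revClass_eq_iff, Multiset.mem_coe, HasCluster]
  constructor
  · rintro ⟨d, hd, rfl | rfl⟩
    · exact Or.inl hd
    · exact Or.inr hd
  · rintro (h | h)
    · exact ⟨_, h, Or.inl rfl⟩
    · exact ⟨_, h, Or.inr rfl⟩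

theorem OddClusterPerm.revClass_mem (y : OddClusterPerm n) (c : List (Fin n)) :
    revClass c ∈ y.classes ↔ y.HasCluster c ∨ y.HasCluster c.reverse := by
  have : revClass c ∈ y.classes ↔
      revClass c ∈ (y.cycles.val.bind Cycle.toMultiset).map revClass := Iff.rfl
  rw [this, Multiset.mem_map]
  simp only [revClass_eq_iff, Multiset.mem_bind, mem_toMultiset, Finset.mem_val, HasCluster]
  constructor
  · rintro ⟨d, hd, rfl | rfl⟩
    · exact Or.inl hd
    · exact Or.inr hd
  · rintro (h | h)
    · exact ⟨_, h, Or.inl rfl⟩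
    · exact ⟨_, h, Or.inr rfl⟩

/-- The well-labelled positive paths with given classes of clusters are the ballot arrangements
of these classes. -/
noncomputable def pathFiberEquiv {K : Finset (Sym2 (List (Fin n)))}
    (hK : IsClusterClasses K.val) :
    {x : WellLabelledPath n // x.classes = K} ≃ BalArr revClass clusterRise K := by
  refine Equiv.ofBijective (fun x => ⟨x.1.clusters, ?_, x.1.ballot_clusters⟩) ⟨?_, ?_⟩
  · exact congrArg Finset.val x.2
  · intro x y h
    exact Subtype.ext (WellLabelledPath.clusters_injective (congrArg Subtype.val h))
  · rintro ⟨cs, h1, h2⟩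
    rw [← Multiset.map_coe] at h1
    rw [← h1, isClusterClasses_map, ← coe_flatten] at hK
    obtain ⟨x, rfl⟩ := exists_clusters_eq cs hK.2 (Multiset.coe_eq_coe.1 hK.1) h2
    exact ⟨⟨x, Finset.val_injective h1⟩, rfl⟩

/-- The odd order cluster-permutations with given classes of clusters are the sets of odd cycles
on these classes. -/
noncomputable def cycleFiberEquiv {K : Finset (Sym2 (List (Fin n)))}
    (hK : IsClusterClasses K.val) :
    {y : OddClusterPerm n // y.classes = K} ≃ OddSets revClass K := by
  refine Equiv.ofBijective (fun y => ⟨y.1.cycles, y.1.odd_length, ?_⟩) ⟨?_, ?_⟩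
  · exact y.1.classes_val.symm.trans (congrArg Finset.val y.2)
  · intro x y h
    exact Subtype.ext (OddClusterPerm.ext (congrArg Subtype.val h))
  · rintro ⟨s, h1, h2⟩
    have h3 : (s.val.bind Cycle.toMultiset).map revClass = K.val :=
      (Multiset.map_bind _ _ _).trans h2
    rw [← h3, isClusterClasses_map, Multiset.bind_assoc] at hK
    refine ⟨⟨⟨s, h1, fun C hC c hc h0 => hK.2 ?_, hK.1⟩, Finset.val_injective h3⟩, rfl⟩
    exact Multiset.mem_bind.2 ⟨C, hC, mem_toMultiset.2 (h0 ▸ hc)⟩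

/-- Both sides equal `wt * oddCount` when `K` comes from a set of nonempty words that uses each
letter once, and both are empty otherwise. -/
theorem card_fibers (K : Finset (Sym2 (List (Fin n)))) :
    Finite {x : WellLabelledPath n // x.classes = K} ∧
    Finite {y : OddClusterPerm n // y.classes = K} ∧
    Nat.card {x : WellLabelledPath n // x.classes = K} =
      Nat.card {y : OddClusterPerm n // y.classes = K} := by
  by_cases hK : IsClusterClasses K.val
  · have h1 := card_oddSets revClass finite_revClass_fiber K
    have h2 := finite_balArr (r := clusterRise) finite_revClass_fiber K
    have := h1.1
    refine ⟨Finite.of_equiv _ (pathFiberEquiv hK).symm,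
      Finite.of_equiv _ (cycleFiberEquiv hK).symm, ?_⟩
    rw [Nat.card_congr (pathFiberEquiv hK), Nat.card_congr (cycleFiberEquiv hK), h1.2]
    exact card_balArr clusterRise_eq_or List.reverse_reverse revClass_reverse
      finite_revClass_fiber K hK.antiOn
  · have h1 : IsEmpty {x : WellLabelledPath n // x.classes = K} :=
      ⟨fun x => hK (x.2 ▸ x.1.isClusterClasses)⟩
    have h2 : IsEmpty {y : OddClusterPerm n // y.classes = K} :=
      ⟨fun y => hK (y.2 ▸ y.1.isClusterClasses)⟩
    exact ⟨inferInstance, inferInstance, by simp⟩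

end Fibers

/-! ### One-letter clusters and the assembly of the bijection -/

section Singletons
variable {n : ℕ}

/-- The classes of the words with one letter. -/
def singletonClasses (n : ℕ) : Finset (Sym2 (List (Fin n))) :=
  Finset.univ.image fun a => revClass [a]

theorem revClass_mem_singletonClasses {c : List (Fin n)} :
    revClass c ∈ singletonClasses n ↔ ∃ a, c = [a] := by
  simp only [singletonClasses, Finset.mem_image, Finset.mem_univ, true_and]
  exact exists_congr fun a => ⟨fun h => (revClass_eq_iff.1 h.symm).elim id id, fun h => h ▸ rfl⟩

theorem cutWord_wordPath {α : Type*} [LinearOrder α] (w : List α) :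
    cutWord w (wordPath w) = w.map fun a => [a] := by
  induction w with
  | nil => rfl
  | cons a w ih =>
    cases w with
    | nil => rfl
    | cons b w =>
      rw [wordPath, List.map_cons, ← ih]
      split <;> simp [cutWord]

theorem BallotPerm.clusters_toPath (π : BallotPerm n) :
    π.toPath.clusters = (List.ofFn π.1).map fun a => [a] :=
  cutWord_wordPath _

theorem BallotPerm.classes_toPath (π : BallotPerm n) :
    π.toPath.classes = singletonClasses n := by
  apply Finset.val_injective
  show (Multiset.ofList π.toPath.clusters).map revClass = _
  rw [singletonClasses, Finset.image_val_of_injOn, π.clusters_toPath, ← Multiset.map_coe,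
    Multiset.map_map, coe_ofFn_perm]
  · rfl
  · intro a _ b _ h
    simpa [revClass_eq_iff] using h

theorem BallotPerm.toPath_injective : Function.Injective (BallotPerm.toPath (n := n)) :=
  fun _ _ h => Subtype.ext (congrArg WellLabelledPath.label h)

theorem OddClusterPerm.length_eq_one {y : OddClusterPerm n} (hy : y.classes = singletonClasses n) :
    ∀ C ∈ y.cycles, ∀ c ∈ C, c.length = 1 := by
  intro C hC c hc
  have : revClass c ∈ y.classes := (y.revClass_mem c).2 (Or.inl ⟨C, hC, hc⟩)
  rw [hy, revClass_mem_singletonClasses] at this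
  obtain ⟨a, rfl⟩ := this
  rfl

/-- All ballot permutations lie in the fibre of one-letter clusters, so `Ψ` constrains the
equivalence only there. -/
theorem exists_fiberEquiv (K : Finset (Sym2 (List (Fin n)))) :
    ∃ e : {x : WellLabelledPath n // x.classes = K} ≃ {y : OddClusterPerm n // y.classes = K},
      ∀ (π : BallotPerm n) (h : π.toPath.classes = K), (e ⟨π.toPath, h⟩).1.cycles = Psi π := by
  obtain ⟨h1, h2, h3⟩ := card_fibers K
  by_cases hK : K = singletonClasses n
  · subst hK
    -- `g` is a section of `Ψ`, hence injective. As the two fibres have the same finite size, it is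
    -- a bijection onto the fibre of paths, and its inverse is `Ψ`.
    choose g hg using fun y : {y : OddClusterPerm n // y.classes = singletonClasses n} =>
      exists_Psi_eq y.1 (OddClusterPerm.length_eq_one y.2)
    have hinj : Function.Injective
        fun y => (⟨(g y).toPath, (g y).classes_toPath⟩ :
          {x : WellLabelledPath n // x.classes = singletonClasses n}) := by
      intro y z h
      have h' : g y = g z := BallotPerm.toPath_injective (congrArg Subtype.val h)
      exact Subtype.ext (OddClusterPerm.ext (by rw [← hg, ← hg, h']))
    have hbij := hinj.bijective_of_nat_card_le h3.le
    refine ⟨(Equiv.ofBijective _ hbij).symm, fun π h => ?_⟩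
    obtain ⟨y, hy⟩ := hbij.2 ⟨π.toPath, h⟩
    have hy' : g y = π := BallotPerm.toPath_injective (congrArg Subtype.val hy)
    rw [(Equiv.symm_apply_eq _).2 (show _ = Equiv.ofBijective _ hbij y from hy.symm), ← hg, hy']
  · exact ⟨(Finite.equivFin _).trans ((finCongr h3).trans (Finite.equivFin _).symm), fun π h => absurd (h.symm.trans π.classes_toPath) hK⟩

end Singletons

end BallotCluster

theorem theorem3p1 (n : ℕ) :
    ∃ Φ : BallotCluster.WellLabelledPath n → BallotCluster.OddClusterPerm n,
      Function.Bijective Φ ∧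
      (∀ (x : BallotCluster.WellLabelledPath n) (c : List (Fin n)),
        (x.HasCluster c ∨ x.HasCluster c.reverse) ↔
          ((Φ x).HasCluster c ∨ (Φ x).HasCluster c.reverse)) ∧
      ∀ π : BallotCluster.BallotPerm n, (Φ π.toPath).cycles = BallotCluster.Psi π := by
  choose e he using BallotCluster.exists_fiberEquiv (n := n)
  -- Both sets are the disjoint unions of their fibres over the cluster classes, and the
  -- equivalences are glued along this decomposition. Clusters are preserved up to reversal because
  -- classes are.
  let E : BallotCluster.WellLabelledPath n ≃ BallotCluster.OddClusterPerm n :=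
    (Equiv.sigmaFiberEquiv BallotCluster.WellLabelledPath.classes).symm.trans
      ((Equiv.sigmaCongrRight e).trans (Equiv.sigmaFiberEquiv BallotCluster.OddClusterPerm.classes))
  have hE : ∀ x, E x = (e x.classes ⟨x, rfl⟩).1 := fun _ => rfl
  refine ⟨E, E.bijective, fun x c => ?_, fun π => ?_⟩
  · rw [← x.revClass_mem, ← BallotCluster.OddClusterPerm.revClass_mem, hE,
      (e x.classes ⟨x, rfl⟩).2]
  · rw [hE]
    exact he _ π rfl
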